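/- **Conventions.** Spacetime is $\mathbb R^4$ with global coordinates $x^\mu$ ($x^0=t$), with a smooth metric $g_{\mu\nu}$ of signature $(-,+,+,+)$ such that $g^{00}<0$, $g^{ii}>0$ (no summation); $\Gamma^\rho_{\mu\nu}$, $R_{\mu\nu}=\partial_\rho\Gamma^\rho_{\mu\nu}-\dots$, $R$ are its Christoffel symbols, Ricci tensor and scalar curvature, and $G_\mu{}^\nu=\sqrt{|g|}\,(R_\mu{}^\nu-\frac12\delta_\mu^\nu R)$. Latin $i,j$ are spatial. Put $\xi(0)=-1$, $\xi(i)=1$, $\gamma^{\rho\sigma}(\mu)=g^{\rho\sigma}-g^{\rho\mu}g^{\mu\sigma}/g^{\mu\mu}$; let $\gamma(\mu)$ be the determinant of $(g_{ab})_{a,b\ne\mu}$ and, for $\mu\neq\nu$, $\gamma(\mu\nu)$ that of $(g_{AB})_{A,B\neq\mu,\nu}$; $K(\mu)=-\gamma^{ab}(\mu)\Gamma^\mu_{ab}/\sqrt{|g^{\mu\mu}|}$; $q(\mu\nu)=g^{\mu\nu}/\sqrt{\xi(\mu)\xi(\nu)g^{\mu\mu}g^{\nu\nu}}$; $\alpha(0i)=\alpha(i0)=\operatorname{arcsinh}q(0i)$,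 $\alpha(ij)=\arcsin q(ij)$, where $|q(ij)|<1$ for $i\ne j$ is assumed. The trace $K$ Lagrangian is the function of $(g,\partial g,\partial\partial g)$ $$\mathcal L_K=\sqrt{|g|}R+2\sum_\mu\partial_\mu\big(\sqrt{|\gamma(\mu)|}K(\mu)\big)-\sum_{\mu\ne\nu}\partial_\mu\partial_\nu\big(\sqrt{|\gamma(\mu\nu)|}\,\alpha(\mu\nu)\big).$$ For a Lagrangian $\mathcal L(\phi,\phi_\mu,\phi_{\mu\nu})$, with $\phi_{\mu\nu}$ and $\phi_{\nu\mu}$ varied independently (for $\mathcal L_K$, with $\mathcal L$ depending symmetrically on them), let $$\frac{\delta S}{\delta\phi}=\frac{\partial\mathcal L}{\partial\phi}-\partial_\mu\frac{\partial\mathcal L}{\partial\phi_\mu}+\partial_\nu\partial_\mu\frac{\partial\mathcal L}{\partial\phi_{\mu\nu}},\quad \frac{\delta S}{\delta\dot\phi}=\frac{\partial\mathcal L}{\partial\phi_0}-\partial_\nu\Big(\frac{\partial\mathcal L}{\partial\phi_{0\nu}}+\frac{\partial\mathcal L}{\partial\phi_{\nu0}}\Big),\quad \frac{\delta S}{\delta\dot\phi_i}=\frac{\partial\mathcal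 L}{\partial\phi_{0i}}+\frac{\partial\mathcal L}{\partial\phi_{i0}},$$ $$\mathcal E=\frac{\delta S}{\delta\dot\phi}\dot\phi-\mathcal L+\partial_i\Big(\frac{\delta S}{\delta\dot\phi_i}\dot\phi\Big)\quad\text{(Noether energy density)};$$ "on shell" means $\delta S/\delta\phi=0$. The metric is asymptotically flat if for every $t$ and every $m\ge0$, $\partial^{(m)}(g_{\mu\nu}-\eta_{\mu\nu})=O(r^{-(m+1)})$ as $r\to\infty$ at time $t$, with $r^2=(x^1)^2+(x^2)^2+(x^3)^2$. Write $\oint_{r}d\sigma_i$ for the flux through the coordinate sphere of radius $r$ and $\mathrm{ADM}(t,r)=\oint_r d\sigma_i\,(\partial_jg_{ij}-\partial_ig_{jj})$. **(1) Energy density.** For every such metric, the energy density of $\mathcal L_K$ is $$\mathcal E=2G_0{}^0+\partial_iX^i,\qquad X^i=\sum_{j\ne i}\alpha(ij)\,\partial_j\sqrt{|\gamma(ij)|}+\sum_j\sqrt{|g|}\big(\Gamma^i_{j\mu}\gamma^{\mu j}(i)-\Gamma^j_{j\mu}\gamma^{\mu i}(j)\big).$$ **(2) Total energy.** If $g$ is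 asymptotically flat and on shell for $\mathcal L_K$, then at each time $t$ the energy density is integrable over $\mathbb R^3$ and $$E=\int_{\mathbb R^3}\mathcal E\,d^3x=\lim_{r\to\infty}\oint_r d\sigma_i\,(\partial_jg_{ij}-\partial_ig_{jj}).$$ **(3) Matter.** Let $g$ be asymptotically flat. Let the matter field $\psi$ be smooth with values in a finite-dimensional space carrying a representation $\rho$ of $\mathfrak{gl}(4,\mathbb R)$ (a field of tensorial type, $\delta_D\psi=\epsilon^\mu\partial_\mu\psi-\rho(\partial\epsilon)\psi$), and let $\mathcal L_m(g,\psi,\partial\psi)$ be a smooth first order Lagrangian, defined on an open set containing the values of the fields, without derivatives of $g$, which is a scalar density: $\delta_D\mathcal L_m=\partial_\mu(\epsilon^\mu\mathcal L_m)$ for all $\epsilon$. Define $T_\mu{}^\nu$ by $8\pi T^{\mu\nu}=\partial\mathcal L_m/\partial g_{\mu\nu}$. If the matter equations of motion hold, then the energy density of $\mathcal L_K+\mathcal L_m$ is $$\mathcal E=2\big(G_0{}^0-8\pi T_0{}^0\big)+\partial_i\Big(X^i+\frac{\partial\mathcal L_m}{\partial\psi_i}\,\rho(E_{0}{}^{0})\psi\Big),$$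 where $E_0{}^0$ is the matrix whose only nonzero entry is $1$ in position $(0,0)$. If all equations of motion of $\mathcal L_K+\mathcal L_m$ hold, then $G_0{}^0=8\pi T_0{}^0$; if moreover the matter satisfies the boundary condition $\lim_{r\to\infty}\oint_r d\sigma_i\,\frac{\partial\mathcal L_m}{\partial\psi_i}\delta\psi=0$ at every time for the variations $\delta\psi=\rho(M)\psi$, $M\in\mathfrak{gl}(4,\mathbb R)$ (no condition for scalar fields), then at each time $$\lim_{r\to\infty}\Big(\int_{|x|<r}\mathcal E\,d^3x-\mathrm{ADM}(t,r)\Big)=0,$$ so that, whenever $\mathcal E$ is integrable over the slice, $\int_{\mathbb R^3}\mathcal E\,d^3x=\lim_{r\to\infty}\oint_r d\sigma_i\,(\partial_jg_{ij}-\partial_ig_{jj})$. -/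

import Mathlib

open scoped ContDiff Topology
open Filter MeasureTheory Asymptotics

noncomputable section

namespace TraceK

/-! ### Coordinates, slices, partial derivatives -/

/-- Spacetime with its global coordinates `x⁰, x¹, x², x³`. -/
abbrev Spacetime := Fin 4 → ℝ

/-- Euclidean coordinate space `ℝ³` of a slice `x⁰ = t`. -/
abbrev Space := EuclideanSpace ℝ (Fin 3)

/-- The event `(t, x)`. -/
def event (t : ℝ) (x : Space) : Spacetime := Fin.cons t (fun i => x i)

/-- The partial derivative `∂_μ f` at `x`. -/
def pd {F : Type*} [NormedAddCommGroup F] [NormedSpace ℝ F]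
    (μ : Fin 4) (f : Spacetime → F) (x : Spacetime) : F :=
  fderiv ℝ f x (Pi.single μ 1)

/-- The gradient `(∂_0 f, ∂_1 f, ∂_2 f, ∂_3 f)` at `x`. -/
def grad {F : Type*} [NormedAddCommGroup F] [NormedSpace ℝ F]
    (f : Spacetime → F) (x : Spacetime) : Fin 4 → F := fun μ => pd μ f x

/-- The integral `∮ dσ_i F^i` over the coordinate sphere of radius `r` about the origin, with
outward unit normal and Euclidean surface measure. -/
def sphereFlux (F : Space → Fin 3 → ℝ) (r : ℝ) : ℝ :=
  r ^ 2 * ∫ n : Metric.sphere (0 : Space) 1,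
    ∑ i : Fin 3, F (r • (n : Space)) i * (n : Space) i ∂((volume : Measure Space).toSphere)

/-! ### Second order Lagrangians, Euler-Lagrange derivatives and Noether energy -/

section Lagrangian

variable {W : Type*} [NormedAddCommGroup W] [NormedSpace ℝ W]

/-- Values `(φ, φ_μ, φ_{μν})` of a field and of its first and second derivatives. -/
abbrev Jet (W : Type*) := W × (Fin 4 → W) × (Fin 4 → Fin 4 → W)

/-- The values `(φ, ∂_μ φ, ∂_μ ∂_ν φ)` of a field at `x`. -/
def jet (φ : Spacetime → W) (x : Spacetime) : Jet W :=
  (φ x, fun μ => pd μ φ x, fun μ ν => pd μ (pd ν φ) x)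

/-- `(∂L/∂φ) · w`. -/
def dL0 (L : Jet W → ℝ) (j : Jet W) (w : W) : ℝ := fderiv ℝ L j (w, 0, 0)

/-- `(∂L/∂φ_μ) · w`. -/
def dL1 (L : Jet W → ℝ) (μ : Fin 4) (j : Jet W) (w : W) : ℝ :=
  fderiv ℝ L j (0, Pi.single μ w, 0)

/-- `(∂L/∂φ_{μν}) · w`, where `φ_{μν}` and `φ_{νμ}` are varied independently. -/
def dL2 (L : Jet W → ℝ) (μ ν : Fin 4) (j : Jet W) (w : W) : ℝ :=
  fderiv ℝ L j (0, 0, Pi.single μ (Pi.single ν w))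

/-- The Euler-Lagrange derivative
`δS/δφ · w = (∂L/∂φ - ∂_μ (∂L/∂φ_μ) + ∂_ν ∂_μ (∂L/∂φ_{μν})) · w` at `x`. -/
def eulerLagrange (L : Jet W → ℝ) (φ : Spacetime → W) (x : Spacetime) (w : W) : ℝ :=
  dL0 L (jet φ x) w - ∑ μ, pd μ (fun y => dL1 L μ (jet φ y) w) x
    + ∑ μ, ∑ ν, pd ν (pd μ (fun y => dL2 L μ ν (jet φ y) w)) x

/-- The equations of motion `δS/δφ = 0`. -/
def OnShell (L : Jet W → ℝ) (φ : Spacetime → W) : Prop :=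
  ∀ x w, eulerLagrange L φ x w = 0

/-- `δS/δφ_μ · w = (∂L/∂φ_μ - ∂_ν (∂L/∂φ_{μν} + ∂L/∂φ_{νμ})) · w` at `x`. -/
def deltaS1 (L : Jet W → ℝ) (φ : Spacetime → W) (μ : Fin 4) (x : Spacetime) (w : W) : ℝ :=
  dL1 L μ (jet φ x) w
    - ∑ ν, pd ν (fun y => dL2 L μ ν (jet φ y) w + dL2 L ν μ (jet φ y) w) x

/-- `δS/δφ̇_i · w = (∂L/∂φ_{0i} + ∂L/∂φ_{i0}) · w` at `x`. -/
def deltaS2 (L : Jet W → ℝ) (φ : Spacetime → W) (i : Fin 3) (x : Spacetime) (w : W) : ℝ :=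
  dL2 L 0 i.succ (jet φ x) w + dL2 L i.succ 0 (jet φ x) w

/-- The Noether energy density
`δS/δφ̇ · φ̇ - L + ∂_i (δS/δφ̇_i · φ̇)` of a second order Lagrangian without second order time
derivatives. -/
def energyDensity (L : Jet W → ℝ) (φ : Spacetime → W) (x : Spacetime) : ℝ :=
  deltaS1 L φ 0 x (pd 0 φ x) - L (jet φ x)
    + ∑ i : Fin 3, pd i.succ (fun y => deltaS2 L φ i y (pd 0 φ y)) x

/-- The quadratic field whose value, first and second derivatives at the origin are `j`
(with `j.2.2` symmetrised). -/
def quadraticField (j : Jet W) (x : Spacetime) : W :=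
  j.1 + ∑ μ, x μ • j.2.1 μ + (1 / 2 : ℝ) • ∑ μ, ∑ ν, (x μ * x ν) • j.2.2 μ ν

end Lagrangian

/-! ### Metrics -/

/-- Symmetric covariant 2-tensors on `ℝ⁴`. -/
def symTensors : Submodule ℝ (Fin 4 → Fin 4 → ℝ) where
  carrier := {A | ∀ μ ν, A μ ν = A ν μ}
  add_mem' := by
    intro a b ha hb μ ν
    simp only [Pi.add_apply]
    rw [ha μ ν, hb μ ν]
  zero_mem' := by
    intro μ ν
    rfl
  smul_mem' := by
    intro c a ha μ ν
    simp only [Pi.smul_apply]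
    rw [ha μ ν]

abbrev SymTensor := ↥symTensors

/-- The signs `ξ(μ) = η_{μμ}`. -/
def sgn (μ : Fin 4) : ℝ := if μ = 0 then -1 else 1

/-- The Minkowski metric `diag(-1, 1, 1, 1)`. -/
def minkowski : SymTensor :=
  ⟨fun μ ν => if μ = ν then sgn μ else 0, by
    intro μ ν
    by_cases h : μ = ν
    · subst h; rfl
    · simp [h, Ne.symm h]⟩

def mat (A : SymTensor) : Matrix (Fin 4) (Fin 4) ℝ := Matrix.of A.1

/-- Components `g^{μν}` of the inverse metric. -/
def up (A : SymTensor) (μ ν : Fin 4) : ℝ := (mat A)⁻¹ μ ν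

/-- `√|g|`. -/
def sqrtDet (A : SymTensor) : ℝ := √|(mat A).det|

/-- `γ^{ρσ}(μ) = g^{ρσ} - g^{ρμ} g^{μσ} / g^{μμ}`. -/
def gammaUp (A : SymTensor) (μ ρ σ : Fin 4) : ℝ := up A ρ σ - up A ρ μ * up A μ σ / up A μ μ

/-- `γ(μ)`, the determinant of `g_{ab}` with `a, b ≠ μ`. -/
def gamma1 (A : SymTensor) (μ : Fin 4) : ℝ :=
  (Matrix.of fun a b : {a : Fin 4 // a ≠ μ} => A.1 a b).det

/-- `γ(μν)`, the determinant of `g_{AB}` with `A, B ≠ μ, ν` (used for `μ ≠ ν`). -/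
def gamma2 (A : SymTensor) (μ ν : Fin 4) : ℝ :=
  (Matrix.of fun a b : {a : Fin 4 // a ≠ μ ∧ a ≠ ν} => A.1 a b).det

/-- `q(μν) = g^{μν} / √(ξ(μ) ξ(ν) g^{μμ} g^{νν})`. -/
def q (A : SymTensor) (μ ν : Fin 4) : ℝ :=
  up A μ ν / √(sgn μ * sgn ν * up A μ μ * up A ν ν)

/-- The angles `α(0i) = α(i0) = arcsinh q(0i)`, `α(ij) = arcsin q(ij)` (used for `μ ≠ ν`). -/
def angle (A : SymTensor) (μ ν : Fin 4) : ℝ :=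
  if μ = 0 ∨ ν = 0 then Real.arsinh (q A μ ν) else Real.arcsin (q A μ ν)

/-- A metric of signature `(-,+,+,+)` in a 3+1 adapted frame: `g^{00} < 0`, `g^{ii} > 0`, and
`|q(ij)| < 1` for `i ≠ j`, so that the angles `α(ij)` are defined. -/
def Admissible (A : SymTensor) : Prop :=
  (∃ P : Matrix (Fin 4) (Fin 4) ℝ, IsUnit P.det ∧ mat A = P.transpose * mat minkowski * P) ∧
  up A 0 0 < 0 ∧ (∀ i : Fin 3, 0 < up A i.succ i.succ) ∧
  ∀ i j : Fin 3, i ≠ j → |q A i.succ j.succ| < 1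

/-- `Γ^ρ_{μν} = ½ g^{ρσ} (∂_μ g_{σν} + ∂_ν g_{σμ} - ∂_σ g_{μν})`. -/
def christoffel (g : Spacetime → SymTensor) (ρ μ ν : Fin 4) (x : Spacetime) : ℝ :=
  (1 / 2) * ∑ σ, up (g x) ρ σ *
    ((pd μ g x).1 σ ν + (pd ν g x).1 σ μ - (pd σ g x).1 μ ν)

/-- The Ricci tensor `R_{μν}`. -/
def ricci (g : Spacetime → SymTensor) (μ ν : Fin 4) (x : Spacetime) : ℝ :=
  ∑ ρ, (pd ρ (christoffel g ρ μ ν) x - pd ν (christoffel g ρ μ ρ) x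
    + ∑ σ, (christoffel g ρ ρ σ x * christoffel g σ μ ν x
      - christoffel g ρ ν σ x * christoffel g σ μ ρ x))

/-- The scalar curvature `R`. -/
def scalarCurvature (g : Spacetime → SymTensor) (x : Spacetime) : ℝ :=
  ∑ μ, ∑ ν, up (g x) μ ν * ricci g μ ν x

/-- The Einstein tensor density `G_μ^ν = √|g| (R_μ^ν - ½ δ_μ^ν R)`. -/
def einstein (g : Spacetime → SymTensor) (μ ν : Fin 4) (x : Spacetime) : ℝ :=
  sqrtDet (g x) * (∑ ρ, up (g x) ν ρ * ricci g ρ μ x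
    - (1 / 2) * (if μ = ν then scalarCurvature g x else 0))

/-- The trace `K(μ) = γ^{ab}(μ) K_{ab}(μ)` of the extrinsic curvature
`K_{ab}(μ) = - Γ^μ_{ab} / √|g^{μμ}|` of `x^μ = constant`. -/
def extrinsicTrace (g : Spacetime → SymTensor) (μ : Fin 4) (x : Spacetime) : ℝ :=
  ∑ a, ∑ b, gammaUp (g x) μ a b * (-(christoffel g μ a b x / √|up (g x) μ μ|))

/-! ### The trace K Lagrangian -/

/-- The value at `x`, for the metric field `g`, of
`√|g| R + 2 ∂_μ (√|γ(μ)| K(μ)) - ∂_μ ∂_ν (√|γ(μν)| α(μν))`, the last sum being over `μ ≠ ν`. -/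
def traceK (g : Spacetime → SymTensor) (x : Spacetime) : ℝ :=
  sqrtDet (g x) * scalarCurvature g x
    + 2 * ∑ μ, pd μ (fun y => √|gamma1 (g y) μ| * extrinsicTrace g μ y) x
    - ∑ μ, ∑ ν, if μ = ν then 0 else
        pd μ (pd ν (fun y => √|gamma2 (g y) μ ν| * angle (g y) μ ν)) x

/-- The trace K Lagrangian as a function of the values of the metric and of its first and second
derivatives at a point. -/
def lagrangianK (j : Jet SymTensor) : ℝ := traceK (quadraticField j) 0

/-- The superpotential
`α(ij) ∂_j √|γ(ij)| + √|g| (Γ^i_{jμ} γ^{μj}(i) - Γ^j_{jμ} γ^{μi}(j))`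
(`i`, `j` spatial and summed over `j`, the first term over `j ≠ i`; `μ` summed over `0, …, 3`). -/
def superpotential (g : Spacetime → SymTensor) (i : Fin 3) (x : Spacetime) : ℝ :=
  ∑ j : Fin 3,
    ((if i = j then 0 else
        angle (g x) i.succ j.succ * pd j.succ (fun y => √|gamma2 (g y) i.succ j.succ|) x)
      + sqrtDet (g x) * ∑ μ : Fin 4,
          (christoffel g i.succ j.succ μ x * gammaUp (g x) i.succ μ j.succ
            - christoffel g j.succ j.succ μ x * gammaUp (g x) j.succ μ i.succ))

/-- Asymptotic flatness: for every time `t` and every order `m`,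
`∂^{(m)} (g - η) = O(r^{-(m+1)})` as `r → ∞` in the slice `x⁰ = t`. -/
def AsymptoticallyFlat (g : Spacetime → SymTensor) : Prop :=
  ∀ (t : ℝ) (m : ℕ),
    (fun x : Space => iteratedFDeriv ℝ m (fun y => g y - minkowski) (event t x))
      =O[Bornology.cobounded Space] fun x => (‖x‖ ^ (m + 1))⁻¹

/-- The ADM integral `∮ dσ_i (∂_j g_{ij} - ∂_i g_{jj})` over the sphere of radius `r` at time
`t`. -/
def admFlux (g : Spacetime → SymTensor) (t r : ℝ) : ℝ :=
  sphereFlux (fun x i => ∑ j : Fin 3,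
    ((pd j.succ g (event t x)).1 i.succ j.succ - (pd i.succ g (event t x)).1 j.succ j.succ)) r

/-! ### Matter -/

section Matter

variable {V : Type*} [NormedAddCommGroup V] [NormedSpace ℝ V]

/-- `δ_D g_{μν} = ε^ρ ∂_ρ g_{μν} + g_{μρ} ∂_ν ε^ρ + g_{ρν} ∂_μ ε^ρ`. -/
def lieMetric (ε : Spacetime → Fin 4 → ℝ) (g : Spacetime → SymTensor) (x : Spacetime) :
    SymTensor :=
  ⟨fun μ ν => ∑ ρ, (ε x ρ * (pd ρ g x).1 μ ν + (g x).1 μ ρ * pd ν ε x ρ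
      + (g x).1 ρ ν * pd μ ε x ρ), by
    intro μ ν
    refine Finset.sum_congr rfl fun ρ _ => ?_
    rw [(pd ρ g x).2 μ ν, (g x).2 μ ρ, (g x).2 ρ ν]
    ring⟩

/-- The linear map `ρ` is a representation on `V` of the Lie algebra `gl(4, ℝ)`. -/
def IsRepresentation (ρ : Matrix (Fin 4) (Fin 4) ℝ →ₗ[ℝ] Module.End ℝ V) : Prop :=
  ∀ M N, ρ (M * N - N * M) = ρ M * ρ N - ρ N * ρ M

/-- The Lie derivative `δ_D ψ = ε^μ ∂_μ ψ - ρ(∂ε) ψ` of a field of tensorial type `ρ`, where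
`(∂ε)^μ_ν = ∂_ν ε^μ` and `ρ` is a representation of `gl(4, ℝ)` (for contravariant vectors, the
standard one). -/
def lieMatter (ρ : Matrix (Fin 4) (Fin 4) ℝ →ₗ[ℝ] Module.End ℝ V)
    (ε : Spacetime → Fin 4 → ℝ) (ψ : Spacetime → V) (x : Spacetime) : V :=
  ∑ μ, ε x μ • pd μ ψ x - ρ (Matrix.of fun μ ν => pd ν ε x μ) (ψ x)

/-- The first order Lagrangian `Lm(g, ψ, ∂ψ)`, with domain `D`, is a scalar density:
`δ_D Lm = ∂_μ (ε^μ Lm)` for every infinitesimal diffeomorphism `ε`. -/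
def IsScalarDensity (ρ : Matrix (Fin 4) (Fin 4) ℝ →ₗ[ℝ] Module.End ℝ V)
    (D : Set (SymTensor × V × (Fin 4 → V))) (Lm : SymTensor × V × (Fin 4 → V) → ℝ) : Prop :=
  ∀ (g : Spacetime → SymTensor) (ψ : Spacetime → V) (ε : Spacetime → Fin 4 → ℝ),
    ContDiff ℝ ∞ g → ContDiff ℝ ∞ ψ → ContDiff ℝ ∞ ε →
    ∀ x, (g x, ψ x, grad ψ x) ∈ D →
      fderiv ℝ Lm (g x, ψ x, grad ψ x)
          (lieMetric ε g x, lieMatter ρ ε ψ x, grad (lieMatter ρ ε ψ) x)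
        = ∑ μ, pd μ (fun y => ε y μ * Lm (g y, ψ y, grad ψ y)) x

/-- The total Lagrangian `L_K + Lm(g, ψ, ∂ψ)` of gravity and nonderivatively coupled matter. -/
def totalLagrangian (Lm : SymTensor × V × (Fin 4 → V) → ℝ) (j : Jet (SymTensor × V)) : ℝ :=
  lagrangianK (j.1.1, fun μ => (j.2.1 μ).1, fun μ ν => (j.2.2 μ ν).1)
    + Lm (j.1.1, j.1.2, fun μ => (j.2.1 μ).2)

/-- The flux density `(∂Lm/∂ψ_i) · ρ(M) ψ` of the boundary term `∮ dσ_i (∂Lm/∂ψ_i) δψ` of the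
variational principle, for the variation `δψ = ρ(M) ψ`. -/
def matterFlux (ρ : Matrix (Fin 4) (Fin 4) ℝ →ₗ[ℝ] Module.End ℝ V)
    (Lm : SymTensor × V × (Fin 4 → V) → ℝ) (g : Spacetime → SymTensor) (ψ : Spacetime → V)
    (M : Matrix (Fin 4) (Fin 4) ℝ) (i : Fin 3) (x : Spacetime) : ℝ :=
  fderiv ℝ Lm (g x, ψ x, grad ψ x) (0, 0, Pi.single i.succ (ρ M (ψ x)))

/-- The symmetric tensor `½ (e^μ ⊗ e^ν + e^ν ⊗ e^μ)`. -/
def symUnit (μ ν : Fin 4) : SymTensor :=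
  ⟨fun a b => (1 / 2) * ((if a = μ ∧ b = ν then 1 else 0) + (if a = ν ∧ b = μ then 1 else 0)), by
    intro a b
    simp only [and_comm]
    ring⟩

/-- The energy-momentum tensor density `T_μ^ν` of matter, `8π T^{νσ} = ∂Lm/∂g_{νσ}`, where
`δLm = (∂Lm/∂g_{νσ}) δg_{νσ}` is summed over all `ν, σ`; it is normalised so that the metric
equations of motion of `L_K + Lm` read `G^{νσ} = 8π T^{νσ}`. -/
def energyMomentum (Lm : SymTensor × V × (Fin 4 → V) → ℝ) (g : Spacetime → SymTensor)
    (ψ : Spacetime → V) (μ ν : Fin 4) (x : Spacetime) : ℝ :=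
  (1 / (8 * Real.pi)) * ∑ σ,
    fderiv ℝ Lm (g x, ψ x, grad ψ x) (symUnit ν σ, 0, 0) * (g x).1 σ μ

end Matter

end TraceK

end

/-!
The trace K Lagrangian contains second derivatives of the metric, but only in a harmless form. On
non-degenerate metrics `√|g| R` is a first order Lagrangian, quadratic in the Christoffel symbols,
plus a divergence (`scalarCurvature_eq`). The extrinsic curvature and angle terms modify the component
of this divergence in the direction `μ` so that every derivative `∂_μ` in it disappears, and what
remains is a sum of terms `θ^{μa}(g)(∂_a g)` with `a ≠ μ`, for certain 1-forms `θ^{μa}` on the space of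
metrics (`boundary_terms`). The key is that `√|γ(μν)| dα(μν)` contains neither the angle nor a square
root other than `√|g|`, because `γ(μν)` is a complementary minor of the inverse metric
(`sqrt_gamma2_mul_fderiv_angle`, `det_mul_det_inv_minor`). Hence the Lagrangian is
`ℓ(g, ∂g) + ∑ ∂_μ (θ^{μa}(g)(∂_a g))` with `a ≠ μ` (`traceK_eq`, `HasDivergenceForm`).

For Lagrangians of this form the divergences do not affect the equations of motion, and in the energy
density only the spatial ones survive, those with both indices spatial
(`HasDivergenceForm.eulerLagrange_eq`, `HasDivergenceForm.energyDensity_eq`). The rest is the energy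
density of `ℓ`, the Einstein pseudotensor. Its momentum comes from the first variation of `ℓ`, which is
the Einstein tensor plus a divergence by the Palatini identity (`palatini`, `fderiv_gammaLagrangian`).
The same identity has an infinitesimal counterpart for translations: the contracted time derivative of
the connection is `2 √|g| R_0^0` up to the divergence of the Komar superpotential of `∂_t`, which is
antisymmetric and so has no time component (`gupTrace_pd_christoffel`). Together they show that the
pseudotensor is `2 G_0^0` plus a spatial divergence (`gammaLagrangian_energy`), and adding the spatial
`θ`-terms turns its superpotential into the stated one (`superpotential_eq`). The equation of motion
tested with `δg_{μν} = g_{μ0} δ_ν^0 + g_{0ν} δ_μ^0` is `G_0^0 = 0` (`einsteinPairing_timeLowering`).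

On shell the energy density is therefore a spatial divergence, and the divergence theorem turns its
integral over a ball into the flux of the superpotential. Mathlib has no divergence theorem on balls;
it is obtained from polar coordinates by integration by parts against radial test functions, which
identifies the radial derivative of the flux (`integral_ball_spaceDiv`). For asymptotically flat
metrics the superpotential differs from the ADM integrand by `O(r⁻³)`
(`hasDecay_superpotential_sub`), which does not contribute to the flux in the limit. The energy density
is `O(r⁻⁴)` and so integrable: it is quadratic in `∂g`, except for the terms `θ(g)(∂∂g)`, and the
1-forms `θ` vanish at the Minkowski metric (`theta_minkowski`, `hasDecay_energyDensity`).

A first order matter Lagrangian keeps the form above (`HasDivergenceForm.couple`) and adds its Legendre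
transform in `∂_0 ψ` to the energy density. Diffeomorphism invariance, tested at the time `t₀` with the
vector field `(t - t₀) ∂_t`, shows that on the matter equations of motion this is `-16π T_0^0` plus the
divergence of `(∂L/∂ψ_μ) ρ(E) ψ`; the vector field `(t - t₀)² ∂_t / 2` shows that the time component
of the latter vanishes (`IsScalarDensity.fderiv_timeShift`, `matter_energy`).
-/

noncomputable section

namespace TraceK

section

/-! ### Calculus of partial derivatives -/

section PartialDerivatives

theorem two_le_smooth : (2 : WithTop ℕ∞) ≤ ∞ :=
  WithTop.coe_le_coe.2 (le_top (a := (2 : ℕ∞)))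

variable {F : Type*} [NormedAddCommGroup F] [NormedSpace ℝ F]
  {F' : Type*} [NormedAddCommGroup F'] [NormedSpace ℝ F']
  {f f₁ f₂ : Spacetime → F} {x : Spacetime} {μ ν : Fin 4}

theorem pd_congr (h : f₁ =ᶠ[𝓝 x] f₂) : pd μ f₁ x = pd μ f₂ x := by
  rw [pd, pd, h.fderiv_eq]

theorem pd_add (h₁ : DifferentiableAt ℝ f₁ x) (h₂ : DifferentiableAt ℝ f₂ x) :
    pd μ (fun y => f₁ y + f₂ y) x = pd μ f₁ x + pd μ f₂ x := by
  simp only [pd, fderiv_fun_add h₁ h₂]; rfl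

theorem pd_sub (h₁ : DifferentiableAt ℝ f₁ x) (h₂ : DifferentiableAt ℝ f₂ x) :
    pd μ (fun y => f₁ y - f₂ y) x = pd μ f₁ x - pd μ f₂ x := by
  simp only [pd, fderiv_fun_sub h₁ h₂]; rfl

theorem pd_neg : pd μ (fun y => -f y) x = -pd μ f x := by
  simp only [pd, fderiv_fun_neg]; rfl

theorem pd_const_smul (c : ℝ) (h : DifferentiableAt ℝ f x) :
    pd μ (fun y => c • f y) x = c • pd μ f x := by
  simp only [pd, fderiv_fun_const_smul h]; rfl

@[simp]
theorem pd_const (c : F) : pd μ (fun _ => c) x = 0 := by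
  simp [pd]

theorem pd_sum {ι : Type*} {s : Finset ι} {f : ι → Spacetime → F}
    (h : ∀ i ∈ s, DifferentiableAt ℝ (f i) x) :
    pd μ (fun y => ∑ i ∈ s, f i y) x = ∑ i ∈ s, pd μ (f i) x := by
  simp only [pd, fderiv_fun_sum h, sum_apply]

theorem pd_mul {f₁ f₂ : Spacetime → ℝ} (h₁ : DifferentiableAt ℝ f₁ x)
    (h₂ : DifferentiableAt ℝ f₂ x) :
    pd μ (fun y => f₁ y * f₂ y) x = f₁ x * pd μ f₂ x + pd μ f₁ x * f₂ x := by
  simp only [pd, fderiv_fun_mul h₁ h₂]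
  simp [mul_comm]

theorem pd_const_mul {f : Spacetime → ℝ} (c : ℝ) (h : DifferentiableAt ℝ f x) :
    pd μ (fun y => c * f y) x = c * pd μ f x :=
  pd_const_smul c h

theorem pd_smul {c : Spacetime → ℝ} (h₁ : DifferentiableAt ℝ c x)
    (h₂ : DifferentiableAt ℝ f x) :
    pd μ (fun y => c y • f y) x = c x • pd μ f x + pd μ c x • f x := by
  simp only [pd, fderiv_fun_smul h₁ h₂]
  simp

/-- The chain rule. -/
theorem pd_comp {h : F → F'} (hh : DifferentiableAt ℝ h (f x)) (hf : DifferentiableAt ℝ f x) :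
    pd μ (fun y => h (f y)) x = fderiv ℝ h (f x) (pd μ f x) := by
  have := fderiv_comp x hh hf
  simp only [pd]
  change (fderiv ℝ (h ∘ f) x) _ = _
  rw [this]; rfl

theorem pd_clm (A : F →L[ℝ] F') (hf : DifferentiableAt ℝ f x) :
    pd μ (fun y => A (f y)) x = A (pd μ f x) := by
  rw [pd_comp (A.differentiableAt) hf, A.fderiv]

theorem pd_clm_apply {A : Spacetime → F →L[ℝ] F'} (hA : DifferentiableAt ℝ A x)
    (hf : DifferentiableAt ℝ f x) :
    pd μ (fun y => A y (f y)) x = pd μ A x (f x) + A x (pd μ f x) := by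
  simp only [pd, fderiv_clm_apply hA hf]
  simp [add_comm]

theorem pd_pi {ι : Type*} [Fintype ι] {f : Spacetime → ι → F}
    (hf : DifferentiableAt ℝ f x) (i : ι) : pd μ f x i = pd μ (fun y => f y i) x :=
  (pd_clm (ContinuousLinearMap.proj (R := ℝ) (φ := fun _ : ι => F) i) hf).symm

theorem contDiffAt_pd {m n : WithTop ℕ∞} (hf : ContDiffAt ℝ n f x) (hmn : m + 1 ≤ n) :
    ContDiffAt ℝ m (pd μ f) x :=
  (hf.fderiv_right hmn).clm_apply contDiffAt_const

theorem contDiffAt_pd_top (hf : ContDiffAt ℝ ∞ f x) : ContDiffAt ℝ ∞ (pd μ f) x :=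
  contDiffAt_pd hf (by simp)

theorem contDiffAt_grad_top (hf : ContDiffAt ℝ ∞ f x) : ContDiffAt ℝ ∞ (grad f) x :=
  contDiffAt_pi.2 fun _ => contDiffAt_pd_top hf

theorem pd_pd_eq_fderiv_fderiv (hf : ContDiffAt ℝ ∞ f x) :
    pd μ (pd ν f) x = fderiv ℝ (fderiv ℝ f) x (Pi.single μ 1) (Pi.single ν 1) := by
  have h : DifferentiableAt ℝ (fderiv ℝ f) x :=
    (hf.fderiv_right (m := ∞) (by simp)).differentiableAt (by simp)
  simp only [pd]
  rw [show pd ν f = fun y => fderiv ℝ f y (Pi.single ν 1) from rfl,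
    fderiv_clm_apply h (differentiableAt_const _)]
  simp

theorem pd_comm (hf : ContDiffAt ℝ ∞ f x) : pd μ (pd ν f) x = pd ν (pd μ f) x := by
  rw [pd_pd_eq_fderiv_fderiv hf, pd_pd_eq_fderiv_fderiv hf]
  exact (hf.isSymmSndFDerivAt (by simpa using two_le_smooth)).eq _ _

@[simp]
theorem pd_coord_sub (c : ℝ) : pd ν (fun y : Spacetime => y μ - c) x = if ν = μ then 1 else 0 := by
  have : HasFDerivAt (fun y : Spacetime => y μ - c)
      (ContinuousLinearMap.proj (R := ℝ) (φ := fun _ : Fin 4 => ℝ) μ) x :=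
    ((ContinuousLinearMap.proj (R := ℝ) (φ := fun _ : Fin 4 => ℝ) μ).hasFDerivAt).sub_const c
  rw [pd, this.fderiv]
  simp [Pi.single_apply, eq_comm]

theorem contDiffAt_coord_sub (c : ℝ) {n : WithTop ℕ∞} :
    ContDiffAt ℝ n (fun y : Spacetime => y μ - c) x := by
  fun_prop

end PartialDerivatives

end

section

/-! ### Lagrangians that are first order up to divergences -/

section DivergenceForm

variable {W : Type*} [NormedAddCommGroup W] [NormedSpace ℝ W]

/-- The function of jets given by the divergence `∂_μ (θ(φ)(∂_a φ))`, for a 1-form `θ` on the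
space of field values. The second derivatives enter symmetrized, so that `∂_μ∂_a φ` and `∂_a∂_μ φ`
can be varied independently. -/
def divJet (θ : W → W →L[ℝ] ℝ) (μ a : Fin 4) (j : Jet W) : ℝ :=
  fderiv ℝ θ j.1 (j.2.1 μ) (j.2.1 a) + θ j.1 ((1 / 2 : ℝ) • (j.2.2 μ a + j.2.2 a μ))

/-- The Lagrangian `L` equals `ℓ(φ, ∂φ) + ∑ ∂_μ (θ_{μa}(φ)(∂_a φ))`, summed over `μ ≠ a`, wherever
`(φ, ∂φ) ∈ O` and `φ ∈ U`. As `μ = a` is excluded, `L` does not depend on any `∂_μ∂_μ φ`, and in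
particular not on second time derivatives. -/
structure HasDivergenceForm (L : Jet W → ℝ) (ℓ : W × (Fin 4 → W) → ℝ)
    (θ : Fin 4 → Fin 4 → W → W →L[ℝ] ℝ) (O : Set (W × (Fin 4 → W))) (U : Set W) : Prop where
  isOpen_fst : IsOpen O
  isOpen_snd : IsOpen U
  contDiffOn_fst : ContDiffOn ℝ ∞ ℓ O
  contDiffOn_snd : ∀ μ a, ContDiffOn ℝ ∞ (θ μ a) U
  diag : ∀ μ, θ μ μ = 0
  eq : ∀ j : Jet W, (j.1, j.2.1) ∈ O → j.1 ∈ U →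
    L j = ℓ (j.1, j.2.1) + ∑ μ, ∑ a, divJet (θ μ a) μ a j

theorem pd_oneForm {θ : W → W →L[ℝ] ℝ} {φ : Spacetime → W} {x : Spacetime} {μ : Fin 4}
    {v : Spacetime → W} (hθ : ContDiffAt ℝ ∞ θ (φ x)) (hφ : ContDiffAt ℝ ∞ φ x)
    (hv : DifferentiableAt ℝ v x) :
    pd μ (fun y => θ (φ y) (v y)) x = fderiv ℝ θ (φ x) (pd μ φ x) (v x) + θ (φ x) (pd μ v x) := by
  have h1 : DifferentiableAt ℝ θ (φ x) := hθ.differentiableAt (by simp)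
  have h2 : DifferentiableAt ℝ φ x := hφ.differentiableAt (by simp)
  rw [pd_clm_apply (h1.fun_comp' x h2) hv, pd_comp h1 h2]

/-- On the jet of a field, `divJet` is the divergence that it stands for. -/
theorem divJet_jet {θ : W → W →L[ℝ] ℝ} {φ : Spacetime → W} {x : Spacetime} {μ a : Fin 4}
    (hθ : ContDiffAt ℝ ∞ θ (φ x)) (hφ : ContDiffAt ℝ ∞ φ x) :
    divJet θ μ a (jet φ x) = pd μ (fun y => θ (φ y) (pd a φ y)) x := by
  rw [pd_oneForm hθ hφ ((contDiffAt_pd_top hφ).differentiableAt (by simp)), divJet, jet]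
  simp only
  rw [pd_comm hφ (μ := a), ← two_smul ℝ, smul_smul]
  norm_num

theorem fderiv_divJet {θ : W → W →L[ℝ] ℝ} {μ a : Fin 4} {j : Jet W}
    (hθ : ContDiffAt ℝ ∞ θ j.1) :
    DifferentiableAt ℝ (divJet θ μ a) j ∧ ∀ k : Jet W, fderiv ℝ (divJet θ μ a) j k =
      fderiv ℝ (fderiv ℝ θ) j.1 k.1 (j.2.1 μ) (j.2.1 a)
      + fderiv ℝ θ j.1 (k.2.1 μ) (j.2.1 a) + fderiv ℝ θ j.1 (j.2.1 μ) (k.2.1 a)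
      + fderiv ℝ θ j.1 k.1 ((1 / 2 : ℝ) • (j.2.2 μ a + j.2.2 a μ))
      + θ j.1 ((1 / 2 : ℝ) • (k.2.2 μ a + k.2.2 a μ)) := by
  have h1 : HasFDerivAt θ (fderiv ℝ θ j.1) j.1 :=
    (hθ.differentiableAt (by simp)).hasFDerivAt
  have h2 : HasFDerivAt (fderiv ℝ θ) (fderiv ℝ (fderiv ℝ θ) j.1) j.1 :=
    ((hθ.fderiv_right (m := ∞) (by simp)).differentiableAt (by simp)).hasFDerivAt
  let p0 : Jet W →L[ℝ] W := ContinuousLinearMap.fst ℝ _ _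
  let p1 (ν : Fin 4) : Jet W →L[ℝ] W :=
    (ContinuousLinearMap.proj (R := ℝ) (φ := fun _ : Fin 4 => W) ν).comp
      ((ContinuousLinearMap.fst ℝ _ _).comp (ContinuousLinearMap.snd ℝ _ _))
  let p2 (ν κ : Fin 4) : Jet W →L[ℝ] W :=
    (ContinuousLinearMap.proj (R := ℝ) (φ := fun _ : Fin 4 => W) κ).comp
    ((ContinuousLinearMap.proj (R := ℝ) (φ := fun _ : Fin 4 => Fin 4 → W) ν).comp
      ((ContinuousLinearMap.snd ℝ _ _).comp (ContinuousLinearMap.snd ℝ _ _)))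
  have e1 : HasFDerivAt (fun j : Jet W => θ j.1) ((fderiv ℝ θ j.1).comp p0) j :=
    HasFDerivAt.comp j (f := fun j : Jet W => j.1) h1 p0.hasFDerivAt
  have e2 : HasFDerivAt (fun j : Jet W => fderiv ℝ θ j.1) ((fderiv ℝ (fderiv ℝ θ) j.1).comp p0) j :=
    HasFDerivAt.comp (g := fderiv ℝ θ) j (f := fun j : Jet W => j.1) h2 p0.hasFDerivAt
  have e3 : HasFDerivAt (divJet θ μ a) _ j :=
    ((e2.clm_apply (p1 μ).hasFDerivAt).clm_apply (p1 a).hasFDerivAt).add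
      (e1.clm_apply ((((p2 μ a).hasFDerivAt).add (p2 a μ).hasFDerivAt).const_smul (1 / 2 : ℝ)))
  refine ⟨e3.differentiableAt, fun k => ?_⟩
  rw [e3.fderiv]
  simp [p0, p1, p2]
  ring

variable {L : Jet W → ℝ} {ℓ : W × (Fin 4 → W) → ℝ} {θ : Fin 4 → Fin 4 → W → W →L[ℝ] ℝ}
  {O : Set (W × (Fin 4 → W))} {U : Set W}

namespace HasDivergenceForm

theorem contDiffAt_fst (h : HasDivergenceForm L ℓ θ O U) {p : W × (Fin 4 → W)} (hp : p ∈ O) :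
    ContDiffAt ℝ ∞ ℓ p :=
  h.contDiffOn_fst.contDiffAt (h.isOpen_fst.mem_nhds hp)

theorem contDiffAt_snd (h : HasDivergenceForm L ℓ θ O U) {w : W} (hw : w ∈ U) (μ a : Fin 4) :
    ContDiffAt ℝ ∞ (θ μ a) w :=
  (h.contDiffOn_snd μ a).contDiffAt (h.isOpen_snd.mem_nhds hw)

theorem fderiv_eq (h : HasDivergenceForm L ℓ θ O U) {j : Jet W} (hj : (j.1, j.2.1) ∈ O)
    (hj' : j.1 ∈ U) (k : Jet W) :
    fderiv ℝ L j k = fderiv ℝ ℓ (j.1, j.2.1) (k.1, k.2.1)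
      + ∑ μ, ∑ a, fderiv ℝ (divJet (θ μ a) μ a) j k := by
  let P : Jet W →L[ℝ] W × (Fin 4 → W) :=
    (ContinuousLinearMap.fst ℝ _ _).prod
      ((ContinuousLinearMap.fst ℝ _ _).comp (ContinuousLinearMap.snd ℝ _ _))
  have hev : L =ᶠ[𝓝 j] fun j => ℓ (P j) + ∑ μ, ∑ a, divJet (θ μ a) μ a j := by
    have h1 : ∀ᶠ k in 𝓝 j, P k ∈ O := P.continuous.continuousAt.eventually
      (h.isOpen_fst.mem_nhds hj)
    have h2 : ∀ᶠ k : Jet W in 𝓝 j, k.1 ∈ U := continuousAt_fst.eventually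
      (h.isOpen_snd.mem_nhds hj')
    filter_upwards [h1, h2] with k hk hk' using h.eq k hk hk'
  have hℓ : HasFDerivAt (fun j => ℓ (P j)) ((fderiv ℝ ℓ (P j)).comp P) j :=
    HasFDerivAt.comp j (((h.contDiffAt_fst hj).differentiableAt (by simp)).hasFDerivAt)
      P.hasFDerivAt
  have hd : ∀ μ a, HasFDerivAt (divJet (θ μ a) μ a) (fderiv ℝ (divJet (θ μ a) μ a) j) j :=
    fun μ a => (fderiv_divJet (h.contDiffAt_snd hj' μ a)).1.hasFDerivAt
  have := hℓ.fun_add (HasFDerivAt.fun_sum (u := Finset.univ) fun μ _ =>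
    HasFDerivAt.fun_sum (u := Finset.univ) fun a _ => hd μ a)
  rw [hev.fderiv_eq, HasFDerivAt.fderiv this]
  simp [P, sum_apply]

theorem dL0_eq (h : HasDivergenceForm L ℓ θ O U) {j : Jet W} (hj : (j.1, j.2.1) ∈ O)
    (hj' : j.1 ∈ U) (w : W) :
    dL0 L j w = fderiv ℝ ℓ (j.1, j.2.1) (w, 0) + ∑ μ, ∑ a,
      (fderiv ℝ (fderiv ℝ (θ μ a)) j.1 w (j.2.1 μ) (j.2.1 a)
      + fderiv ℝ (θ μ a) j.1 w ((1 / 2 : ℝ) • (j.2.2 μ a + j.2.2 a μ))) := by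
  rw [dL0, h.fderiv_eq hj hj']
  congr 1
  refine Finset.sum_congr rfl fun μ _ => Finset.sum_congr rfl fun a _ => ?_
  rw [(fderiv_divJet (h.contDiffAt_snd hj' μ a)).2]
  simp

theorem dL1_eq (h : HasDivergenceForm L ℓ θ O U) {j : Jet W} (hj : (j.1, j.2.1) ∈ O)
    (hj' : j.1 ∈ U) (ν : Fin 4) (w : W) :
    dL1 L ν j w = fderiv ℝ ℓ (j.1, j.2.1) (0, Pi.single ν w)
      + ∑ a, fderiv ℝ (θ ν a) j.1 w (j.2.1 a) + ∑ a, fderiv ℝ (θ a ν) j.1 (j.2.1 a) w := by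
  rw [dL1, h.fderiv_eq hj hj', add_assoc]
  congr 1
  have : ∀ μ a, fderiv ℝ (divJet (θ μ a) μ a) j (0, Pi.single ν w, 0) =
      (if μ = ν then fderiv ℝ (θ μ a) j.1 w (j.2.1 a) else 0)
      + (if a = ν then fderiv ℝ (θ μ a) j.1 (j.2.1 μ) w else 0) := by
    intro μ a
    rw [(fderiv_divJet (h.contDiffAt_snd hj' μ a)).2]
    have e : ∀ κ : Fin 4, (Pi.single ν w : Fin 4 → W) κ = if κ = ν then w else 0 := by
      intro κ; simp [Pi.single_apply]
    simp only [e]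
    split_ifs <;> simp
  simp only [this, Finset.sum_add_distrib]
  congr 1
  · rw [Finset.sum_comm]; simp
  · simp

theorem dL2_eq (h : HasDivergenceForm L ℓ θ O U) {j : Jet W} (hj : (j.1, j.2.1) ∈ O)
    (hj' : j.1 ∈ U) (ν κ : Fin 4) (w : W) :
    dL2 L ν κ j w = (1 / 2) * (θ ν κ j.1 w + θ κ ν j.1 w) := by
  rw [dL2, h.fderiv_eq hj hj', show ((0 : W), (0 : Fin 4 → W)) = 0 from rfl, map_zero, zero_add]
  have : ∀ μ a, fderiv ℝ (divJet (θ μ a) μ a) j (0, 0, Pi.single ν (Pi.single κ w)) =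
      (if μ = ν then (if a = κ then (1 / 2) * θ μ a j.1 w else 0) else 0)
      + (if μ = κ then (if a = ν then (1 / 2) * θ μ a j.1 w else 0) else 0) := by
    intro μ a
    rw [(fderiv_divJet (h.contDiffAt_snd hj' μ a)).2]
    have e : ∀ m n : Fin 4, (Pi.single ν (Pi.single κ w) : Fin 4 → Fin 4 → W) m n
        = if m = ν then (if n = κ then w else 0) else 0 := by
      intro m n
      by_cases hm : m = ν
      · subst hm; simp [Pi.single_apply]
      · simp [hm]
    simp only [e]
    split_ifs <;> simp_all
  simp only [this, Finset.sum_add_distrib]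
  simp
  ring

end HasDivergenceForm

end DivergenceForm

end

section

section DivergenceForm

variable {W : Type*} [NormedAddCommGroup W] [NormedSpace ℝ W]
  {L : Jet W → ℝ} {ℓ : W × (Fin 4 → W) → ℝ} {θ : Fin 4 → Fin 4 → W → W →L[ℝ] ℝ}
  {O : Set (W × (Fin 4 → W))} {U : Set W}

namespace HasDivergenceForm

variable {φ : Spacetime → W}

theorem apply_jet (h : HasDivergenceForm L ℓ θ O U) (hφ : ContDiff ℝ ∞ φ) {x : Spacetime}
    (hO : (φ x, grad φ x) ∈ O) (hU : φ x ∈ U) :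
    L (jet φ x) = ℓ (φ x, grad φ x)
      + ∑ μ, ∑ a, pd μ (fun y => θ μ a (φ y) (pd a φ y)) x := by
  rw [h.eq _ hO hU]
  simp only [divJet_jet (h.contDiffAt_snd hU _ _) hφ.contDiffAt]
  rfl

theorem pd_theta (h : HasDivergenceForm L ℓ θ O U) (hφ : ContDiff ℝ ∞ φ) {x : Spacetime}
    (hU : φ x ∈ U) (μ a ν : Fin 4) (w : W) :
    pd ν (fun y => θ μ a (φ y) w) x = fderiv ℝ (θ μ a) (φ x) (pd ν φ x) w := by
  rw [pd_oneForm (h.contDiffAt_snd hU _ _) hφ.contDiffAt (differentiableAt_const _)]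
  simp

theorem contDiffAt_theta (h : HasDivergenceForm L ℓ θ O U) (hφ : ContDiff ℝ ∞ φ) {x : Spacetime}
    (hU : φ x ∈ U) (μ a : Fin 4) {v : Spacetime → W} (hv : ContDiffAt ℝ ∞ v x) :
    ContDiffAt ℝ ∞ (fun y => θ μ a (φ y) (v y)) x :=
  ContDiffAt.clm_apply (ContDiffAt.comp x (h.contDiffAt_snd hU μ a) hφ.contDiffAt) hv

theorem differentiableAt_theta (h : HasDivergenceForm L ℓ θ O U) (hφ : ContDiff ℝ ∞ φ)
    {x : Spacetime}
    (hU : φ x ∈ U) (μ a : Fin 4) {v : Spacetime → W} (hv : ContDiffAt ℝ ∞ v x) :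
    DifferentiableAt ℝ (fun y => θ μ a (φ y) (v y)) x :=
  (h.contDiffAt_theta hφ hU μ a hv).differentiableAt (by simp)

/-- Only the spatial divergences contribute to the energy density of a Lagrangian in divergence
form: those with a time derivative, inner or outer, drop out. -/
theorem energyDensity_eq (h : HasDivergenceForm L ℓ θ O U) (hφ : ContDiff ℝ ∞ φ)
    (hO : ∀ x, (φ x, grad φ x) ∈ O) (hU : ∀ x, φ x ∈ U) (x : Spacetime) :
    energyDensity L φ x = fderiv ℝ ℓ (φ x, grad φ x) (0, Pi.single 0 (pd 0 φ x))
      - ℓ (φ x, grad φ x)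
      - ∑ i : Fin 3, pd i.succ (fun y => ∑ j : Fin 3, θ i.succ j.succ (φ y) (pd j.succ φ y)) x := by
  have hd : ∀ a, ContDiffAt ℝ ∞ (pd a φ) x := fun a => contDiffAt_pd_top hφ.contDiffAt
  have h1 : ∀ ν, pd ν (fun y => dL2 L 0 ν (jet φ y) (pd 0 φ x)
      + dL2 L ν 0 (jet φ y) (pd 0 φ x)) x =
      fderiv ℝ (θ 0 ν) (φ x) (pd ν φ x) (pd 0 φ x)
      + fderiv ℝ (θ ν 0) (φ x) (pd ν φ x) (pd 0 φ x) := by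
    intro ν
    have : (fun y => dL2 L 0 ν (jet φ y) (pd 0 φ x) + dL2 L ν 0 (jet φ y) (pd 0 φ x)) =
        fun y => θ 0 ν (φ y) (pd 0 φ x) + θ ν 0 (φ y) (pd 0 φ x) := by
      funext y
      rw [h.dL2_eq (hO y) (hU y), h.dL2_eq (hO y) (hU y)]
      simp only [jet]
      ring
    rw [this, pd_add (h.differentiableAt_theta hφ (hU x) _ _ contDiffAt_const)
      (h.differentiableAt_theta hφ (hU x) _ _ contDiffAt_const),
      h.pd_theta hφ (hU x), h.pd_theta hφ (hU x)]
  have h2 : ∀ i : Fin 3, pd i.succ (fun y => deltaS2 L φ i y (pd 0 φ y)) x =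
      pd i.succ (fun y => θ 0 i.succ (φ y) (pd 0 φ y)) x
      + pd i.succ (fun y => θ i.succ 0 (φ y) (pd 0 φ y)) x := by
    intro i
    have : (fun y => deltaS2 L φ i y (pd 0 φ y)) =
        fun y => θ 0 i.succ (φ y) (pd 0 φ y) + θ i.succ 0 (φ y) (pd 0 φ y) := by
      funext y
      rw [deltaS2, h.dL2_eq (hO y) (hU y), h.dL2_eq (hO y) (hU y)]
      simp only [jet]
      ring
    rw [this, pd_add (h.differentiableAt_theta hφ (hU x) _ _ (hd _))
      (h.differentiableAt_theta hφ (hU x) _ _ (hd _))]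
  have h3 : ∀ μ a b, pd μ (fun y => θ a b (φ y) (pd 0 φ y)) x =
      fderiv ℝ (θ a b) (φ x) (pd μ φ x) (pd 0 φ x) + θ a b (φ x) (pd μ (pd 0 φ) x) :=
    fun μ a b => pd_oneForm (h.contDiffAt_snd (hU x) _ _) hφ.contDiffAt
      ((hd 0).differentiableAt (by simp))
  -- the derivative `∂_0 ∂_c φ` is written in the order in which it appears in `h3`
  have h4 : ∀ a b c, pd 0 (fun y => θ a b (φ y) (pd c φ y)) x =
      fderiv ℝ (θ a b) (φ x) (pd 0 φ x) (pd c φ x) + θ a b (φ x) (pd c (pd 0 φ) x) := by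
    intro a b c
    rw [pd_oneForm (h.contDiffAt_snd (hU x) _ _) hφ.contDiffAt
      ((hd c).differentiableAt (by simp)), pd_comm hφ.contDiffAt]
  have h5 : ∀ i : Fin 3,
      pd i.succ (fun y => ∑ j : Fin 3, θ i.succ j.succ (φ y) (pd j.succ φ y)) x =
      ∑ j : Fin 3, pd i.succ (fun y => θ i.succ j.succ (φ y) (pd j.succ φ y)) x :=
    fun i => pd_sum fun j _ => h.differentiableAt_theta hφ (hU x) _ _ (hd _)
  -- the second time derivatives all come with `θ_{00}`, which vanishes
  have hdiag : θ 0 0 = 0 := h.diag 0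
  have hz : fderiv ℝ (0 : W → W →L[ℝ] ℝ) (φ x) = 0 :=
    (hasFDerivAt_const (0 : W →L[ℝ] ℝ) (φ x)).fderiv
  rw [energyDensity, deltaS1, h.dL1_eq (hO x) (hU x), h.apply_jet hφ (hO x) (hU x)]
  simp only [h1, h2, h5]
  simp only [jet, Fin.sum_univ_succ (n := 3), h4, h3, Finset.sum_add_distrib, hdiag, hz]
  simp only [zero_apply, Pi.zero_apply]
  unfold grad
  ring

/-- Divergences do not contribute to the equations of motion. -/
theorem eulerLagrange_eq (h : HasDivergenceForm L ℓ θ O U) (hφ : ContDiff ℝ ∞ φ)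
    (hO : ∀ x, (φ x, grad φ x) ∈ O) (hU : ∀ x, φ x ∈ U) (x : Spacetime) (w : W) :
    eulerLagrange L φ x w = fderiv ℝ ℓ (φ x, grad φ x) (w, 0)
      - ∑ μ, pd μ (fun y => fderiv ℝ ℓ (φ y, grad φ y) (0, Pi.single μ w)) x := by
  have hφ' : ∀ y, ContDiffAt ℝ ∞ φ y := fun y => hφ.contDiffAt
  have hd : ∀ y a, ContDiffAt ℝ ∞ (pd a φ) y := fun y a => contDiffAt_pd_top (hφ' y)
  have hθ : ∀ y a b, ContDiffAt ℝ ∞ (θ a b) (φ y) := fun y => h.contDiffAt_snd (hU y)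
  have hdθ : ∀ y a b, ContDiffAt ℝ ∞ (fun z => fderiv ℝ (θ a b) (φ z)) y := fun y a b =>
    ContDiffAt.comp y ((hθ y a b).fderiv_right (m := ∞) (by simp)) (hφ' y)
  have hA : ∀ a b c, ContDiffAt ℝ ∞ (fun y => fderiv ℝ (θ a b) (φ y) w (pd c φ y)) x :=
    fun a b c => ((hdθ x a b).clm_apply contDiffAt_const).clm_apply (hd x c)
  have hB : ∀ a b c, ContDiffAt ℝ ∞ (fun y => fderiv ℝ (θ a b) (φ y) (pd c φ y) w) x :=
    fun a b c => ((hdθ x a b).clm_apply (hd x c)).clm_apply contDiffAt_const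
  have hℓ : ∀ μ, ContDiffAt ℝ ∞ (fun y => fderiv ℝ ℓ (φ y, grad φ y) (0, Pi.single μ w)) x :=
    fun μ => ContDiffAt.clm_apply
      (ContDiffAt.comp x (f := fun y => (φ y, grad φ y)) (g := fderiv ℝ ℓ)
        ((h.contDiffAt_fst (hO x)).fderiv_right (m := ∞) (by simp))
        ((hφ' x).prodMk (contDiffAt_grad_top (hφ' x)))) contDiffAt_const
  -- the variation of the divergence along constant `w` is a divergence
  have h1 : ∀ μ a, fderiv ℝ (fderiv ℝ (θ μ a)) (φ x) w (pd μ φ x) (pd a φ x)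
      + fderiv ℝ (θ μ a) (φ x) w ((1 / 2 : ℝ) • (pd μ (pd a φ) x + pd a (pd μ φ) x)) =
      pd μ (fun y => fderiv ℝ (θ μ a) (φ y) w (pd a φ y)) x := by
    intro μ a
    have e1 : DifferentiableAt ℝ (fderiv ℝ (θ μ a)) (φ x) :=
      ((hθ x μ a).fderiv_right (m := ∞) (by simp)).differentiableAt (by simp)
    have e2 : DifferentiableAt ℝ φ x := (hφ' x).differentiableAt (by simp)
    have e3 : DifferentiableAt ℝ (fun z => fderiv ℝ (θ μ a) (φ z)) x :=
      (hdθ x μ a).differentiableAt (by simp)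
    rw [pd_clm_apply (A := fun y => fderiv ℝ (θ μ a) (φ y) w)
      (e3.clm_apply (differentiableAt_const _)) ((hd x a).differentiableAt (by simp)),
      pd_clm_apply (A := fun y => fderiv ℝ (θ μ a) (φ y)) e3 (differentiableAt_const _),
      pd_comp (h := fderiv ℝ (θ μ a)) e1 e2, pd_comm (hφ' x) (μ := a), ← two_smul ℝ, smul_smul]
    rw [((hθ x μ a).isSymmSndFDerivAt (by simpa using two_le_smooth)).eq w]
    simp
  have h2 : ∀ μ, pd μ (fun y => dL1 L μ (jet φ y) w) x =
      pd μ (fun y => fderiv ℝ ℓ (φ y, grad φ y) (0, Pi.single μ w)) x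
      + ∑ a, pd μ (fun y => fderiv ℝ (θ μ a) (φ y) w (pd a φ y)) x
      + ∑ a, pd μ (fun y => fderiv ℝ (θ a μ) (φ y) (pd a φ y) w) x := by
    intro μ
    have : (fun y => dL1 L μ (jet φ y) w) = fun y =>
        fderiv ℝ ℓ (φ y, grad φ y) (0, Pi.single μ w)
        + ∑ a, fderiv ℝ (θ μ a) (φ y) w (pd a φ y)
        + ∑ a, fderiv ℝ (θ a μ) (φ y) (pd a φ y) w :=
      funext fun y => h.dL1_eq (hO y) (hU y) μ w
    have d1 : ∀ a, DifferentiableAt ℝ (fun y => fderiv ℝ (θ μ a) (φ y) w (pd a φ y)) x :=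
      fun a => (hA μ a a).differentiableAt (by simp)
    have d2 : ∀ a, DifferentiableAt ℝ (fun y => fderiv ℝ (θ a μ) (φ y) (pd a φ y) w) x :=
      fun a => (hB a μ a).differentiableAt (by simp)
    have d0 := (hℓ μ).differentiableAt (by simp)
    rw [this, pd_add (d0.fun_add (.fun_sum fun a _ => d1 a)) (.fun_sum fun a _ => d2 a),
      pd_add d0 (.fun_sum fun a _ => d1 a), pd_sum fun a _ => d1 a, pd_sum fun a _ => d2 a]
  have h3 : ∀ μ ν, pd ν (pd μ (fun y => dL2 L μ ν (jet φ y) w)) x =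
      (1 / 2) * (pd ν (fun y => fderiv ℝ (θ μ ν) (φ y) (pd μ φ y) w) x
        + pd μ (fun y => fderiv ℝ (θ ν μ) (φ y) (pd ν φ y) w) x) := by
    intro μ ν
    have e : (fun y => dL2 L μ ν (jet φ y) w) = fun y =>
        (1 / 2) * (θ μ ν (φ y) w + θ ν μ (φ y) w) :=
      funext fun y => h.dL2_eq (hO y) (hU y) μ ν w
    have c : ∀ a b y, ContDiffAt ℝ ∞ (fun y => θ a b (φ y) w) y :=
      fun a b y => h.contDiffAt_theta hφ (hU y) a b contDiffAt_const
    have c' : ∀ a b y, DifferentiableAt ℝ (fun y => θ a b (φ y) w) y :=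
      fun a b y => (c a b y).differentiableAt (by simp)
    have e' : ∀ a b κ, pd κ (fun y => θ a b (φ y) w) =
        fun y => fderiv ℝ (θ a b) (φ y) (pd κ φ y) w :=
      fun a b κ => funext fun y => h.pd_theta hφ (hU y) a b κ w
    have e'' : pd μ (fun y => dL2 L μ ν (jet φ y) w) = fun y =>
        (1 / 2) * (pd μ (fun y => θ μ ν (φ y) w) y + pd μ (fun y => θ ν μ (φ y) w) y) := by
      funext y
      rw [e, pd_const_mul _ ((c' _ _ y).fun_add (c' _ _ y)), pd_add (c' _ _ y) (c' _ _ y)]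
    have c2 : ∀ a b κ, DifferentiableAt ℝ (pd κ (fun y => θ a b (φ y) w)) x :=
      fun a b κ => (contDiffAt_pd_top (c a b x)).differentiableAt (by simp)
    rw [e'', pd_const_mul _ ((c2 _ _ _).fun_add (c2 _ _ _)), pd_add (c2 _ _ _) (c2 _ _ _),
      pd_comm (c ν μ x), e', e']
  rw [eulerLagrange, h.dL0_eq (hO x) (hU x)]
  simp only [h2, h3]
  have h4 : ∀ μ a, fderiv ℝ (fderiv ℝ (θ μ a)) (jet φ x).1 w ((jet φ x).2.1 μ) ((jet φ x).2.1 a)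
      + fderiv ℝ (θ μ a) (jet φ x).1 w
        ((1 / 2 : ℝ) • ((jet φ x).2.2 μ a + (jet φ x).2.2 a μ)) =
      pd μ (fun y => fderiv ℝ (θ μ a) (φ y) w (pd a φ y)) x := h1
  simp only [h4, mul_add, Finset.sum_add_distrib, ← Finset.mul_sum]
  rw [Finset.sum_comm (f := fun μ ν => pd μ (fun y => fderiv ℝ (θ ν μ) (φ y) (pd ν φ y) w) x)]
  simp only [jet]
  unfold grad
  ring

end HasDivergenceForm

end DivergenceForm

end

section

/-! ### Pointwise functions of the metric and their differentials -/

/-- The component `A ↦ A_{μν}` as a continuous linear map. -/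
def entry (μ ν : Fin 4) : SymTensor →L[ℝ] ℝ :=
  (ContinuousLinearMap.proj (R := ℝ) (φ := fun _ : Fin 4 => ℝ) ν).comp
    ((ContinuousLinearMap.proj (R := ℝ) (φ := fun _ : Fin 4 => Fin 4 → ℝ) μ).comp
      symTensors.subtypeL)

@[simp]
theorem entry_apply (μ ν : Fin 4) (A : SymTensor) : entry μ ν A = A.1 μ ν := rfl

theorem SymTensor.symm (A : SymTensor) (μ ν : Fin 4) : A.1 μ ν = A.1 ν μ := A.2 μ ν

theorem mat_isSymm (A : SymTensor) : (mat A).transpose = mat A :=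
  Matrix.ext fun μ ν => A.2 ν μ

theorem up_symm (A : SymTensor) (μ ν : Fin 4) : up A μ ν = up A ν μ := by
  have : (mat A)⁻¹.transpose = (mat A)⁻¹ := by rw [Matrix.transpose_nonsing_inv, mat_isSymm]
  rw [up, up, ← this, Matrix.transpose_apply, this]

theorem contDiff_det {E ι : Type*} [NormedAddCommGroup E] [NormedSpace ℝ E] [Fintype ι]
    [DecidableEq ι] {n : WithTop ℕ∞} {M : E → Matrix ι ι ℝ}
    (hM : ∀ i j, ContDiff ℝ n fun x => M x i j) : ContDiff ℝ n fun x => (M x).det := by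
  simp only [Matrix.det_apply]
  refine ContDiff.sum fun σ _ => ?_
  exact (contDiff_prod fun i _ => hM _ _).const_smul _

theorem contDiff_det_mat {n : WithTop ℕ∞} : ContDiff ℝ n fun A : SymTensor => (mat A).det :=
  contDiff_det fun i j => (entry i j).contDiff

variable {A : SymTensor}

theorem contDiffAt_up (hA : (mat A).det ≠ 0) (μ ν : Fin 4) {n : WithTop ℕ∞} :
    ContDiffAt ℝ n (fun B => up B μ ν) A := by
  have h : (fun B => up B μ ν) = fun B => ((mat B).det)⁻¹ * (mat B).adjugate μ ν := by
    funext B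
    rw [up, Matrix.inv_def, Ring.inverse_eq_inv', Matrix.smul_apply, smul_eq_mul]
  rw [h]
  refine (contDiff_det_mat.contDiffAt.inv hA).mul (ContDiff.contDiffAt ?_)
  simp only [Matrix.adjugate_apply]
  refine contDiff_det fun i j => ?_
  simp only [Matrix.updateRow_apply]
  split_ifs
  · exact contDiff_const
  · exact (entry i j).contDiff

theorem contDiffAt_sqrtDet (hA : (mat A).det ≠ 0) : ContDiffAt ℝ ∞ sqrtDet A :=
  ContDiffAt.sqrt (f := fun B : SymTensor => |(mat B).det|)
    (contDiff_det_mat.contDiffAt.abs hA) (abs_ne_zero.2 hA)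

theorem sqrtDet_pos (hA : (mat A).det ≠ 0) : 0 < sqrtDet A :=
  Real.sqrt_pos.2 (abs_pos.2 hA)

theorem sum_up_mul (hA : (mat A).det ≠ 0) (a c : Fin 4) :
    ∑ b, up A a b * A.1 b c = if a = c then 1 else 0 := by
  have := congrFun (congrFun (Matrix.nonsing_inv_mul (mat A) (isUnit_iff_ne_zero.2 hA)) a) c
  rw [Matrix.mul_apply, Matrix.one_apply] at this
  exact this

theorem sum_mul_up (hA : (mat A).det ≠ 0) (a c : Fin 4) :
    ∑ b, A.1 a b * up A b c = if a = c then 1 else 0 := by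
  have := congrFun (congrFun (Matrix.mul_nonsing_inv (mat A) (isUnit_iff_ne_zero.2 hA)) a) c
  rw [Matrix.mul_apply, Matrix.one_apply] at this
  exact this

theorem eventually_det_ne_zero (hA : (mat A).det ≠ 0) : ∀ᶠ B in 𝓝 A, (mat B).det ≠ 0 :=
  (contDiff_det_mat (n := 0)).continuous.continuousAt.eventually_ne hA

/-- `δ g^{ab} = - g^{am} δg_{mn} g^{nb}`. -/
theorem fderiv_up (hA : (mat A).det ≠ 0) (a b : Fin 4) (w : SymTensor) :
    fderiv ℝ (fun B => up B a b) A w = -∑ m, ∑ n, up A a m * w.1 m n * up A n b := by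
  have hd : ∀ a b, HasFDerivAt (fun B => up B a b) (fderiv ℝ (fun B => up B a b) A) A :=
    fun a b => ((contDiffAt_up hA a b (n := 1)).differentiableAt (by simp)).hasFDerivAt
  have h1 : ∀ c, ∑ n, fderiv ℝ (fun B => up B a n) A w * A.1 n c
      = -∑ n, up A a n * w.1 n c := by
    intro c
    have h2 : HasFDerivAt (fun B : SymTensor => ∑ n, up B a n * entry n c B) _ A :=
      HasFDerivAt.fun_sum fun n _ => (hd a n).mul (entry n c).hasFDerivAt
    have h3 : (fun B : SymTensor => ∑ n, up B a n * entry n c B) =ᶠ[𝓝 A]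
        fun _ => if a = c then 1 else 0 := by
      filter_upwards [eventually_det_ne_zero hA] with B hB using sum_up_mul hB a c
    have h4 := h2.fderiv
    rw [h3.fderiv_eq] at h4
    have h5 := congrArg (fun T : SymTensor →L[ℝ] ℝ => T w) h4
    simp [sum_apply, Finset.sum_add_distrib] at h5
    rw [eq_neg_iff_add_eq_zero, add_comm, h5]
    simp only [mul_comm]
  calc fderiv ℝ (fun B => up B a b) A w
      = ∑ n, fderiv ℝ (fun B => up B a n) A w * ∑ c, A.1 n c * up A c b := by
        simp [sum_mul_up hA]
    _ = ∑ c, (∑ n, fderiv ℝ (fun B => up B a n) A w * A.1 n c) * up A c b := by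
        simp only [Finset.mul_sum, Finset.sum_mul]
        rw [Finset.sum_comm]
        simp only [mul_assoc]
    _ = _ := by
        simp only [h1, neg_mul, Finset.sum_neg_distrib, Finset.sum_mul]
        rw [Finset.sum_comm]

/-- Jacobi's formula for the differential of the determinant. -/
theorem fderiv_det (hA : (mat A).det ≠ 0) (w : SymTensor) :
    fderiv ℝ (fun B => (mat B).det) A w = (mat A).det * ∑ m, ∑ n, up A m n * w.1 n m := by
  have h1 : HasFDerivAt (fun B => (mat B).det) (fderiv ℝ (fun B => (mat B).det) A) A :=
    ((contDiff_det_mat (n := 1)).differentiable (by simp) A).hasFDerivAt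
  have h2 : HasDerivAt (fun s : ℝ => (mat (A + s • w)).det)
      (fderiv ℝ (fun B => (mat B).det) A w) 0 := by
    have := h1.hasLineDerivAt w
    simpa [HasLineDerivAt] using this
  obtain ⟨P, h3⟩ : ∃ P : Polynomial ℝ, ∀ s : ℝ, (mat (A + s • w)).det =
      (mat A).det * (1 + ((mat A)⁻¹ * mat w).trace * s + P.eval s * s ^ 2) := by
    refine ⟨(Matrix.det (1 + (Polynomial.X : Polynomial ℝ) •
      ((mat A)⁻¹ * mat w).map Polynomial.C)).divX.divX, fun s => ?_⟩
    rw [← Matrix.det_one_add_smul, ← Matrix.det_mul, mul_add, mul_one, Matrix.mul_smul,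
      ← mul_assoc, Matrix.mul_nonsing_inv _ (isUnit_iff_ne_zero.2 hA), one_mul]
    rfl
  rw [funext h3] at h2
  have h4 := h2.unique (HasDerivAt.const_mul (mat A).det
    (((hasDerivAt_const (0 : ℝ) (1 : ℝ)).fun_add ((hasDerivAt_id (0 : ℝ)).const_mul
      ((mat A)⁻¹ * mat w).trace)).fun_add ((P.hasDerivAt (0 : ℝ)).fun_mul
        ((hasDerivAt_id (0 : ℝ)).fun_pow 2))))
  rw [h4]
  simp [Matrix.trace, Matrix.mul_apply, up, mat]

theorem fderiv_sqrtDet (hA : (mat A).det ≠ 0) (w : SymTensor) :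
    fderiv ℝ sqrtDet A w = (1 / 2) * sqrtDet A * ∑ m, ∑ n, up A m n * w.1 n m := by
  have h1 : HasFDerivAt (fun B => (mat B).det) (fderiv ℝ (fun B => (mat B).det) A) A :=
    ((contDiff_det_mat (n := 1)).differentiable (by simp) A).hasFDerivAt
  have h2 := (h1.abs hA).sqrt (abs_ne_zero.2 hA)
  have h3 : fderiv ℝ sqrtDet A = _ := h2.fderiv
  have h4 : sqrtDet A ≠ 0 := (sqrtDet_pos hA).ne'
  have h5 : sqrtDet A * sqrtDet A = |(mat A).det| := Real.mul_self_sqrt (abs_nonneg _)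
  rw [h3]
  simp only [smul_apply, fderiv_det hA, smul_eq_mul]
  change 1 / (2 * sqrtDet A) * _ = _
  have h6 : (SignType.sign (mat A).det : ℝ) * (mat A).det = sqrtDet A * sqrtDet A := by
    rw [h5, sign_mul_self]
  field_simp
  linear_combination (∑ m, ∑ n, up A m n * w.1 n m) * h6

end

section

/-! ### The metric density and the Christoffel symbols -/

/-- The contravariant metric density `√|g| g^{ab}`. -/
def gup (A : SymTensor) (a b : Fin 4) : ℝ := sqrtDet A * up A a b

/-- The Christoffel symbol `Γ^ρ_{μν}` as a function of the metric and its gradient. -/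
def chr (ρ μ ν : Fin 4) (p : SymTensor × (Fin 4 → SymTensor)) : ℝ :=
  (1 / 2) * ∑ σ, up p.1 ρ σ * ((p.2 μ).1 σ ν + (p.2 ν).1 σ μ - (p.2 σ).1 μ ν)

theorem christoffel_eq (g : Spacetime → SymTensor) (ρ μ ν : Fin 4) (x : Spacetime) :
    christoffel g ρ μ ν x = chr ρ μ ν (g x, grad g x) := rfl

theorem chr_symm (ρ μ ν : Fin 4) (p : SymTensor × (Fin 4 → SymTensor)) :
    chr ρ μ ν p = chr ρ ν μ p := by
  simp only [chr]
  congr 1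
  refine Finset.sum_congr rfl fun σ _ => ?_
  rw [(p.2 σ).symm μ ν]
  ring

theorem christoffel_symm (g : Spacetime → SymTensor) (ρ μ ν : Fin 4) (x : Spacetime) :
    christoffel g ρ μ ν x = christoffel g ρ ν μ x :=
  chr_symm ρ μ ν (g x, grad g x)

theorem gup_symm (A : SymTensor) (a b : Fin 4) : gup A a b = gup A b a := by
  rw [gup, gup, up_symm]

theorem contDiffAt_gup {A : SymTensor} (hA : (mat A).det ≠ 0) (a b : Fin 4) :
    ContDiffAt ℝ ∞ (fun B => gup B a b) A :=
  (contDiffAt_sqrtDet hA).mul (contDiffAt_up hA a b)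

theorem contDiffAt_chr {p : SymTensor × (Fin 4 → SymTensor)} (hp : (mat p.1).det ≠ 0)
    (ρ μ ν : Fin 4) : ContDiffAt ℝ ∞ (chr ρ μ ν) p := by
  have h1 : ∀ σ, ContDiffAt ℝ ∞ (fun p : SymTensor × (Fin 4 → SymTensor) => up p.1 ρ σ) p :=
    fun σ => ContDiffAt.comp p (contDiffAt_up hp ρ σ) contDiffAt_fst
  have h2 : ∀ κ m n, ContDiff ℝ ∞ (fun p : SymTensor × (Fin 4 → SymTensor) => (p.2 κ).1 m n) :=
    fun κ m n => (entry m n).contDiff.comp ((contDiff_apply ℝ SymTensor κ).comp contDiff_snd)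
  refine contDiffAt_const.mul (ContDiffAt.sum fun σ _ => (h1 σ).mul ?_)
  exact (((h2 _ _ _).add (h2 _ _ _)).sub (h2 _ _ _)).contDiffAt

/-- `δ (√|g| g^{ab}) = √|g| (½ g^{ab} g^{mn} - g^{am} g^{bn}) δg_{mn}`. -/
theorem fderiv_gup {A : SymTensor} (hA : (mat A).det ≠ 0) (a b : Fin 4) (w : SymTensor) :
    fderiv ℝ (fun B => gup B a b) A w =
      sqrtDet A * ((1 / 2) * up A a b * ∑ m, ∑ n, up A m n * w.1 m n
        - ∑ m, ∑ n, up A a m * up A b n * w.1 m n) := by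
  have h1 := (contDiffAt_sqrtDet hA).differentiableAt (by simp)
  have h2 := (contDiffAt_up hA a b (n := ∞)).differentiableAt (by simp)
  simp only [gup]
  rw [fderiv_fun_mul h1 h2]
  simp only [add_apply, smul_apply, fderiv_sqrtDet hA, fderiv_up hA, smul_eq_mul]
  have e1 : ∑ m, ∑ n, up A a m * w.1 m n * up A n b = ∑ m, ∑ n, up A a m * up A b n * w.1 m n :=
    Finset.sum_congr rfl fun m _ => Finset.sum_congr rfl fun n _ => by rw [up_symm A n b]; ring
  have e2 : ∑ m, ∑ n, up A m n * w.1 n m = ∑ m, ∑ n, up A m n * w.1 m n :=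
    Finset.sum_congr rfl fun m _ => Finset.sum_congr rfl fun n _ => by rw [w.symm]
  rw [e1, e2]
  ring

/-- Metric compatibility: `g^{am} g^{bn} ∂_c g_{mn} = g^{ad} Γ^b_{cd} + g^{bd} Γ^a_{cd}`. -/
theorem sum_up_up_eq_chr (p : SymTensor × (Fin 4 → SymTensor)) (a b c : Fin 4) :
    ∑ m, ∑ n, up p.1 a m * up p.1 b n * (p.2 c).1 m n =
      ∑ d, (up p.1 a d * chr b c d p + up p.1 b d * chr a c d p) := by
  have h : ∀ a b, ∑ d, up p.1 a d * chr b c d p = (1 / 2) * ∑ d, ∑ σ, up p.1 a d * up p.1 b σ *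
      ((p.2 c).1 σ d + (p.2 d).1 σ c - (p.2 σ).1 c d) := by
    intro a b
    simp only [chr, Finset.mul_sum]
    exact Finset.sum_congr rfl fun d _ => Finset.sum_congr rfl fun σ _ => by ring
  rw [Finset.sum_add_distrib, h a b, h b a, Finset.sum_comm (f := fun d σ => up p.1 b d *
    up p.1 a σ * ((p.2 c).1 σ d + (p.2 d).1 σ c - (p.2 σ).1 c d)), ← mul_add,
    ← Finset.sum_add_distrib, Finset.mul_sum]
  refine Finset.sum_congr rfl fun m _ => ?_
  rw [← Finset.sum_add_distrib, Finset.mul_sum]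
  refine Finset.sum_congr rfl fun n _ => ?_
  rw [(p.2 c).symm n m, (p.2 m).symm n c, (p.2 n).symm c m]
  ring

/-- `½ g^{mn} ∂_c g_{mn} = Γ^d_{cd}`. -/
theorem sum_up_eq_chr (p : SymTensor × (Fin 4 → SymTensor)) (c : Fin 4) :
    (1 / 2) * ∑ m, ∑ n, up p.1 m n * (p.2 c).1 m n = ∑ d, chr d c d p := by
  have h : ∑ d, chr d c d p = (1 / 2) * (∑ d, ∑ σ, up p.1 d σ * (p.2 c).1 σ d
      + (∑ d, ∑ σ, up p.1 d σ * (p.2 d).1 σ c - ∑ d, ∑ σ, up p.1 d σ * (p.2 σ).1 c d)) := by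
    simp only [chr, Finset.mul_sum, ← Finset.sum_add_distrib, ← Finset.sum_sub_distrib]
    exact Finset.sum_congr rfl fun d _ => Finset.sum_congr rfl fun σ _ => by ring
  rw [h, Finset.sum_comm (f := fun d σ => up p.1 d σ * (p.2 σ).1 c d)]
  rw [sub_eq_zero.2, add_zero]
  · congr 1
    exact Finset.sum_congr rfl fun d _ => Finset.sum_congr rfl fun σ _ => by
      rw [(p.2 c).symm σ d]
  · exact Finset.sum_congr rfl fun d _ => Finset.sum_congr rfl fun σ _ => by
      rw [(p.2 d).symm σ c, up_symm p.1 d σ]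

/-! ### Derivatives of the metric density -/

section Field

variable {g : Spacetime → SymTensor} {x : Spacetime}

theorem eventually_det_field (hg : ContDiff ℝ ∞ g) (hx : (mat (g x)).det ≠ 0) :
    ∀ᶠ y in 𝓝 x, (mat (g y)).det ≠ 0 :=
  hg.continuous.continuousAt.eventually (eventually_det_ne_zero hx)

theorem contDiffAt_up_field (hg : ContDiff ℝ ∞ g) (hx : (mat (g x)).det ≠ 0) (a b : Fin 4) :
    ContDiffAt ℝ ∞ (fun y => up (g y) a b) x :=
  ContDiffAt.comp x (contDiffAt_up hx a b) hg.contDiffAt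

theorem contDiffAt_sqrtDet_field (hg : ContDiff ℝ ∞ g) (hx : (mat (g x)).det ≠ 0) :
    ContDiffAt ℝ ∞ (fun y => sqrtDet (g y)) x :=
  ContDiffAt.comp x (g := sqrtDet) (contDiffAt_sqrtDet hx) hg.contDiffAt

theorem contDiffAt_gup_field (hg : ContDiff ℝ ∞ g) (hx : (mat (g x)).det ≠ 0) (a b : Fin 4) :
    ContDiffAt ℝ ∞ (fun y => gup (g y) a b) x :=
  (contDiffAt_sqrtDet_field hg hx).mul (contDiffAt_up_field hg hx a b)

theorem contDiffAt_pair (hg : ContDiff ℝ ∞ g) : ContDiffAt ℝ ∞ (fun y => (g y, grad g y)) x :=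
  hg.contDiffAt.prodMk (contDiffAt_grad_top hg.contDiffAt)

theorem contDiffAt_christoffel (hg : ContDiff ℝ ∞ g) (hx : (mat (g x)).det ≠ 0)
    (ρ μ ν : Fin 4) : ContDiffAt ℝ ∞ (christoffel g ρ μ ν) x :=
  ContDiffAt.comp x (g := chr ρ μ ν) (f := fun y => (g y, grad g y)) (contDiffAt_chr (p := (g x, grad g x)) hx ρ μ ν)
    (contDiffAt_pair hg)

/-- `∂_c g^{ab} = - g^{ad} Γ^b_{cd} - g^{bd} Γ^a_{cd}`. -/
theorem pd_up (hg : ContDiff ℝ ∞ g) (hx : (mat (g x)).det ≠ 0) (a b c : Fin 4) :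
    pd c (fun y => up (g y) a b) x = -∑ d, (up (g x) a d * christoffel g b c d x
      + up (g x) b d * christoffel g a c d x) := by
  rw [pd_comp ((contDiffAt_up hx a b (n := ∞)).differentiableAt (by simp))
    (hg.differentiable (by simp) x), fderiv_up hx]
  simp only [christoffel_eq]
  rw [← sum_up_up_eq_chr (g x, grad g x)]
  congr 1
  exact Finset.sum_congr rfl fun m _ => Finset.sum_congr rfl fun n _ => by
    rw [up_symm (g x) n b]; unfold grad; ring

/-- `∂_c √|g| = √|g| Γ^d_{cd}`. -/
theorem pd_sqrtDet (hg : ContDiff ℝ ∞ g) (hx : (mat (g x)).det ≠ 0) (c : Fin 4) :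
    pd c (fun y => sqrtDet (g y)) x = sqrtDet (g x) * ∑ d, christoffel g d c d x := by
  rw [pd_comp ((contDiffAt_sqrtDet hx).differentiableAt (by simp))
    (hg.differentiable (by simp) x), fderiv_sqrtDet hx]
  simp only [christoffel_eq]
  rw [← sum_up_eq_chr (g x, grad g x)]
  have : ∑ m, ∑ n, up (g x) m n * (pd c g x).1 n m = ∑ m, ∑ n, up (g x) m n * (pd c g x).1 m n :=
    Finset.sum_congr rfl fun m _ => Finset.sum_congr rfl fun n _ => by rw [(pd c g x).symm]
  rw [this]
  unfold grad
  ring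

/-- The metric density is covariantly constant: `∂_c G^{ab} = - G^{ad} Γ^b_{cd} - G^{bd} Γ^a_{cd} +
G^{ab} Γ^d_{cd}` for `G^{ab} = √|g| g^{ab}`. -/
theorem pd_gup (hg : ContDiff ℝ ∞ g) (hx : (mat (g x)).det ≠ 0) (a b c : Fin 4) :
    pd c (fun y => gup (g y) a b) x = -∑ d, (gup (g x) a d * christoffel g b c d x
      + gup (g x) b d * christoffel g a c d x) + gup (g x) a b * ∑ d, christoffel g d c d x := by
  simp only [gup]
  rw [pd_mul ((contDiffAt_sqrtDet_field hg hx).differentiableAt (by simp))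
    ((contDiffAt_up_field hg hx a b).differentiableAt (by simp)), pd_up hg hx, pd_sqrtDet hg hx]
  have : ∑ d, (sqrtDet (g x) * up (g x) a d * christoffel g b c d x
      + sqrtDet (g x) * up (g x) b d * christoffel g a c d x) = sqrtDet (g x) *
      ∑ d, (up (g x) a d * christoffel g b c d x + up (g x) b d * christoffel g a c d x) := by
    rw [Finset.mul_sum]
    exact Finset.sum_congr rfl fun d _ => by ring
  rw [this]
  ring

/-- `∂_b (√|g| g^{ab}) = - √|g| g^{bd} Γ^a_{bd}`. -/
theorem sum_pd_gup (hg : ContDiff ℝ ∞ g) (hx : (mat (g x)).det ≠ 0) (a : Fin 4) :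
    ∑ b, pd b (fun y => gup (g y) a b) x =
      -∑ b, ∑ d, gup (g x) b d * christoffel g a b d x := by
  have h : ∑ b, ∑ d, gup (g x) a d * christoffel g b b d x =
      ∑ b, gup (g x) a b * ∑ d, christoffel g d b d x := by
    rw [Finset.sum_comm]
    simp only [Finset.mul_sum, christoffel_symm g _ _ _ x]
  simp only [pd_gup hg hx, Finset.sum_add_distrib, Finset.sum_neg_distrib, h]
  ring

/-- `Γ^d_{ad} = ∂_a log √|g|` is a closed form. -/
theorem pd_christoffel_trace (hg : ContDiff ℝ ∞ g) (hx : (mat (g x)).det ≠ 0) (a c : Fin 4) :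
    pd c (fun y => ∑ d, christoffel g d a d y) x = pd a (fun y => ∑ d, christoffel g d c d y) x := by
  have h : ∀ a, (fun y => ∑ d, christoffel g d a d y) =ᶠ[𝓝 x]
      pd a (fun y => Real.log (sqrtDet (g y))) := by
    intro a
    filter_upwards [eventually_det_field hg hx] with y hy
    rw [pd_comp (h := Real.log) (Real.differentiableAt_log (sqrtDet_pos hy).ne')
      ((contDiffAt_sqrtDet_field hg hy).differentiableAt (by simp)), pd_sqrtDet hg hy]
    have : sqrtDet (g y) ≠ 0 := (sqrtDet_pos hy).ne'
    simp
    field_simp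
  rw [pd_congr (h a), pd_congr (h c), pd_comm]
  exact (contDiffAt_sqrtDet_field hg hx).log (sqrtDet_pos hx).ne'

end Field

end

section

/-! ### The curvature density as a divergence and a first order Lagrangian -/

section SumPermutations

variable {f : Fin 4 → Fin 4 → Fin 4 → Fin 4 → ℝ}

theorem sum_swap₁₂ : ∑ a, ∑ b, ∑ c, ∑ d, f a b c d = ∑ b, ∑ a, ∑ c, ∑ d, f a b c d :=
  Finset.sum_comm

theorem sum_swap₂₃ : ∑ a, ∑ b, ∑ c, ∑ d, f a b c d = ∑ a, ∑ c, ∑ b, ∑ d, f a b c d :=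
  Finset.sum_congr rfl fun _ _ => Finset.sum_comm

theorem sum_swap₃₄ : ∑ a, ∑ b, ∑ c, ∑ d, f a b c d = ∑ a, ∑ b, ∑ d, ∑ c, f a b c d :=
  Finset.sum_congr rfl fun _ _ => Finset.sum_congr rfl fun _ _ => Finset.sum_comm

end SumPermutations

/-- The algebra behind the Palatini identity: `dG` is the derivative of the density `G` that is
covariantly constant for the connection `Γ`. -/
theorem palatini_algebra (G : Fin 4 → Fin 4 → ℝ) (Γ D dG : Fin 4 → Fin 4 → Fin 4 → ℝ)
    (hG : ∀ a b, G a b = G b a) (hΓ : ∀ r a b, Γ r a b = Γ r b a) (hD : ∀ r a b, D r a b = D r b a)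
    (hdG : ∀ c a b, dG c a b = -∑ d, (G a d * Γ b c d + G b d * Γ a c d) + G a b * ∑ d, Γ d c d)
    (hdG' : ∀ a, ∑ b, dG b a b = -∑ b, ∑ d, G b d * Γ a b d) :
    ∑ m, ∑ n, G m n * ∑ r, ∑ s, (D r r s * Γ s m n + Γ r r s * D s m n
        - D r n s * Γ s m r - Γ r n s * D s m r)
      = ∑ r, (∑ m, ∑ n, dG r m n * D r m n - ∑ m, dG r m r * ∑ s, D s m s) := by
  -- the four contractions
  have t1 : ∑ r, ∑ m, dG r m r * ∑ s, D s m s = -∑ m, ∑ n, ∑ r, ∑ s, G m n * (D r r s * Γ s m n) := by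
    rw [Finset.sum_comm]
    simp only [← Finset.sum_mul, hdG']
    simp only [neg_mul, Finset.sum_neg_distrib, Finset.sum_mul, Finset.mul_sum]
    rw [neg_inj]
    refine (((sum_swap₁₂.trans sum_swap₂₃).trans sum_swap₃₄).trans
      (sum_swap₁₂.trans sum_swap₂₃)).trans ?_
    refine Finset.sum_congr rfl fun m _ => Finset.sum_congr rfl fun n _ =>
      Finset.sum_congr rfl fun r _ => Finset.sum_congr rfl fun s _ => ?_
    rw [hD r s r]
    ring
  have t2 : ∑ r, ∑ m, ∑ n, (G m n * ∑ d, Γ d r d) * D r m n =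
      ∑ m, ∑ n, ∑ r, ∑ s, G m n * (Γ r r s * D s m n) := by
    simp only [Finset.sum_mul, Finset.mul_sum]
    refine ((sum_swap₁₂.trans sum_swap₂₃).trans sum_swap₃₄).trans ?_
    refine Finset.sum_congr rfl fun m _ => Finset.sum_congr rfl fun n _ =>
      Finset.sum_congr rfl fun r _ => Finset.sum_congr rfl fun s _ => ?_
    rw [hΓ r s r]
    ring
  have t3 : ∑ r, ∑ m, ∑ n, (∑ d, G m d * Γ n r d) * D r m n =
      ∑ m, ∑ n, ∑ r, ∑ s, G m n * (Γ r n s * D s m r) := by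
    simp only [Finset.sum_mul]
    refine (((sum_swap₁₂.trans sum_swap₃₄).trans sum_swap₂₃).trans sum_swap₃₄).trans ?_
    refine Finset.sum_congr rfl fun m _ => Finset.sum_congr rfl fun n _ =>
      Finset.sum_congr rfl fun r _ => Finset.sum_congr rfl fun s _ => ?_
    rw [hΓ r s n]
    ring
  have t4 : ∑ r, ∑ m, ∑ n, (∑ d, G n d * Γ m r d) * D r m n =
      ∑ m, ∑ n, ∑ r, ∑ s, G m n * (Γ r n s * D s m r) := by
    rw [← t3]
    refine Finset.sum_congr rfl fun r _ => ?_
    rw [Finset.sum_comm]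
    exact Finset.sum_congr rfl fun m _ => Finset.sum_congr rfl fun n _ => by rw [hD]
  have t5 : ∑ m, ∑ n, ∑ r, ∑ s, G m n * (D r n s * Γ s m r) =
      ∑ m, ∑ n, ∑ r, ∑ s, G m n * (Γ r n s * D s m r) := by
    refine (sum_swap₁₂.trans sum_swap₃₄).trans ?_
    refine Finset.sum_congr rfl fun m _ => Finset.sum_congr rfl fun n _ =>
      Finset.sum_congr rfl fun r _ => Finset.sum_congr rfl fun s _ => ?_
    rw [hG n m]
    ring
  have e1 : ∑ m, ∑ n, G m n * ∑ r, ∑ s, (D r r s * Γ s m n + Γ r r s * D s m n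
        - D r n s * Γ s m r - Γ r n s * D s m r)
      = ∑ m, ∑ n, ∑ r, ∑ s, G m n * (D r r s * Γ s m n)
        + ∑ m, ∑ n, ∑ r, ∑ s, G m n * (Γ r r s * D s m n)
        - ∑ m, ∑ n, ∑ r, ∑ s, G m n * (D r n s * Γ s m r)
        - ∑ m, ∑ n, ∑ r, ∑ s, G m n * (Γ r n s * D s m r) := by
    simp only [Finset.mul_sum, mul_add, mul_sub, Finset.sum_add_distrib, Finset.sum_sub_distrib]
  have e2 : ∑ r, ∑ m, ∑ n, dG r m n * D r m n =
      -(∑ r, ∑ m, ∑ n, (∑ d, G m d * Γ n r d) * D r m n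
        + ∑ r, ∑ m, ∑ n, (∑ d, G n d * Γ m r d) * D r m n)
      + ∑ r, ∑ m, ∑ n, (G m n * ∑ d, Γ d r d) * D r m n := by
    simp only [hdG, add_mul, neg_mul, Finset.sum_add_distrib, Finset.sum_neg_distrib]
  rw [Finset.sum_sub_distrib, e1, e2, t1, t2, t3, t4, t5]
  ring

variable {g : Spacetime → SymTensor} {x : Spacetime}

/-- Contraction of the variation `D` of a connection with the metric density, in the order in which
it appears in the variation of the curvature: `√|g| (g^{mn} D^r_{mn} - g^{mr} D^s_{ms})`. -/
def gupTrace (A : SymTensor) (D : Fin 4 → Fin 4 → Fin 4 → ℝ) (r : Fin 4) : ℝ :=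
  ∑ m, ∑ n, gup A m n * D r m n - ∑ m, gup A m r * ∑ s, D s m s

theorem pd_sum_gup_mul (hg : ContDiff ℝ ∞ g) (hx : (mat (g x)).det ≠ 0) {c : Fin 4}
    {F : Fin 4 → Fin 4 → Spacetime → ℝ} (hF : ∀ m n, DifferentiableAt ℝ (F m n) x) :
    pd c (fun y => ∑ m, ∑ n, gup (g y) m n * F m n y) x =
      ∑ m, ∑ n, gup (g x) m n * pd c (F m n) x
        + ∑ m, ∑ n, pd c (fun y => gup (g y) m n) x * F m n x := by
  have h1 : ∀ m n, DifferentiableAt ℝ (fun y => gup (g y) m n) x :=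
    fun m n => (contDiffAt_gup_field hg hx m n).differentiableAt (by simp)
  rw [pd_sum fun m _ => .fun_sum fun n _ => (h1 m n).fun_mul (hF m n), ← Finset.sum_add_distrib]
  refine Finset.sum_congr rfl fun m _ => ?_
  rw [pd_sum fun n _ => (h1 m n).fun_mul (hF m n), ← Finset.sum_add_distrib]
  exact Finset.sum_congr rfl fun n _ => pd_mul (h1 m n) (hF m n)

theorem pd_sum_gup_mul' (hg : ContDiff ℝ ∞ g) (hx : (mat (g x)).det ≠ 0) {c r : Fin 4}
    {F : Fin 4 → Spacetime → ℝ} (hF : ∀ m, DifferentiableAt ℝ (F m) x) :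
    pd c (fun y => ∑ m, gup (g y) m r * F m y) x =
      ∑ m, gup (g x) m r * pd c (F m) x
        + ∑ m, pd c (fun y => gup (g y) m r) x * F m x := by
  have h1 : ∀ m n, DifferentiableAt ℝ (fun y => gup (g y) m n) x :=
    fun m n => (contDiffAt_gup_field hg hx m n).differentiableAt (by simp)
  rw [pd_sum fun m _ => (h1 m r).fun_mul (hF m), ← Finset.sum_add_distrib]
  exact Finset.sum_congr rfl fun m _ => pd_mul (h1 m r) (hF m)

/-- The Palatini identity: for a symmetric field `D` in place of a variation of the connection,
the contracted variation of the Ricci tensor is a divergence. -/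
theorem palatini (hg : ContDiff ℝ ∞ g) (hx : (mat (g x)).det ≠ 0)
    {D : Fin 4 → Fin 4 → Fin 4 → Spacetime → ℝ} (hD : ∀ r m n, DifferentiableAt ℝ (D r m n) x)
    (hsymm : ∀ r m n, D r m n = D r n m) :
    ∑ m, ∑ n, gup (g x) m n * ∑ r, (pd r (D r m n) x - pd n (D r m r) x
      + ∑ s, (D r r s x * christoffel g s m n x + christoffel g r r s x * D s m n x
        - D r n s x * christoffel g s m r x - christoffel g r n s x * D s m r x))
      = ∑ r, pd r (fun y => gupTrace (g y) (fun a b c => D a b c y) r) x := by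
  have h0 : ∀ r, pd r (fun y => gupTrace (g y) (fun a b c => D a b c y) r) x =
      (∑ m, ∑ n, gup (g x) m n * pd r (D r m n) x
        + ∑ m, ∑ n, pd r (fun y => gup (g y) m n) x * D r m n x)
      - (∑ m, gup (g x) m r * ∑ s, pd r (D s m s) x
        + ∑ m, pd r (fun y => gup (g y) m r) x * ∑ s, D s m s x) := by
    intro r
    have h1 : ∀ m n, DifferentiableAt ℝ (fun y => gup (g y) m n) x :=
      fun m n => (contDiffAt_gup_field hg hx m n).differentiableAt (by simp)
    have h2 : ∀ m, DifferentiableAt ℝ (fun y => ∑ s, D s m s y) x :=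
      fun m => .fun_sum fun s _ => hD s m s
    simp only [gupTrace]
    rw [pd_sub (.fun_sum fun m _ => .fun_sum fun n _ => (h1 m n).fun_mul (hD r m n))
      (.fun_sum fun m _ => (h1 m r).fun_mul (h2 m)), pd_sum_gup_mul hg hx (fun m n => hD r m n),
      pd_sum_gup_mul' hg hx h2]
    simp only [pd_sum fun s _ => hD s _ s]
  have h3 := palatini_algebra (fun a b => gup (g x) a b) (fun a b c => christoffel g a b c x)
    (fun a b c => D a b c x) (fun c a b => pd c (fun y => gup (g y) a b) x)
    (fun a b => gup_symm _ _ _) (fun r a b => christoffel_symm _ _ _ _ _)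
    (fun r a b => by rw [hsymm]) (fun c a b => pd_gup hg hx a b c) (sum_pd_gup hg hx)
  simp only [h0, Finset.sum_add_distrib, Finset.sum_sub_distrib, mul_add, mul_sub] at h3 ⊢
  have e1 : ∑ r, ∑ m, ∑ n, gup (g x) m n * pd r (D r m n) x =
      ∑ m, ∑ n, gup (g x) m n * ∑ r, pd r (D r m n) x := by
    simp only [Finset.mul_sum]
    rw [Finset.sum_comm]
    exact Finset.sum_congr rfl fun m _ => Finset.sum_comm
  have e2 : ∑ r, ∑ m, gup (g x) m r * ∑ s, pd r (D s m s) x =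
      ∑ m, ∑ n, gup (g x) m n * ∑ r, pd n (D r m r) x := Finset.sum_comm
  rw [e1, e2]
  linear_combination h3

/-- The first order Lagrangian `√|g| g^{μν} (Γ^ρ_{νσ} Γ^σ_{μρ} - Γ^ρ_{ρσ} Γ^σ_{μν})` of general
relativity, as a function of the metric and its gradient. -/
def gammaLagrangian (p : SymTensor × (Fin 4 → SymTensor)) : ℝ :=
  ∑ m, ∑ n, gup p.1 m n * ∑ r, ∑ s, (chr r n s p * chr s m r p - chr r r s p * chr s m n p)

theorem sqrtDet_mul_scalarCurvature (g : Spacetime → SymTensor) (x : Spacetime) :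
    sqrtDet (g x) * scalarCurvature g x = ∑ m, ∑ n, gup (g x) m n * ricci g m n x := by
  simp only [scalarCurvature, Finset.mul_sum, gup, mul_assoc]

/-- The decomposition of `√|g| R` into a first order Lagrangian and a divergence: the Palatini identity
with the Christoffel symbols themselves as the field `D`. -/
theorem scalarCurvature_eq (hg : ContDiff ℝ ∞ g) (hx : (mat (g x)).det ≠ 0) :
    sqrtDet (g x) * scalarCurvature g x = gammaLagrangian (g x, grad g x)
      + ∑ r, pd r (fun y => gupTrace (g y) (fun a b c => christoffel g a b c y) r) x := by
  rw [sqrtDet_mul_scalarCurvature, ← palatini hg hx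
    (fun r m n => (contDiffAt_christoffel hg hx r m n).differentiableAt (by simp))
    (fun r m n => funext fun y => christoffel_symm g r m n y)]
  simp only [gammaLagrangian, ← christoffel_eq, ← Finset.sum_add_distrib]
  refine Finset.sum_congr rfl fun m _ => Finset.sum_congr rfl fun n _ => ?_
  rw [ricci, ← mul_add]
  congr 1
  simp only [Finset.sum_add_distrib, Finset.sum_sub_distrib]
  ring

/-- The Ricci tensor is symmetric. -/
theorem ricci_symm (hg : ContDiff ℝ ∞ g) (hx : (mat (g x)).det ≠ 0) (m n : Fin 4) :
    ricci g m n x = ricci g n m x := by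
  have hd : ∀ r a b, DifferentiableAt ℝ (christoffel g r a b) x :=
    fun r a b => (contDiffAt_christoffel hg hx r a b).differentiableAt (by simp)
  have h1 := pd_christoffel_trace hg hx m n
  rw [pd_sum fun r _ => hd _ _ _, pd_sum fun r _ => hd _ _ _] at h1
  have h2 : ∀ r a b, christoffel g r a b = christoffel g r b a :=
    fun r a b => funext fun y => christoffel_symm g r a b y
  simp only [ricci, Finset.sum_add_distrib, Finset.sum_sub_distrib]
  rw [h1]
  have h3 : ∑ r, ∑ s, christoffel g r n s x * christoffel g s m r x =
      ∑ r, ∑ s, christoffel g r m s x * christoffel g s n r x := by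
    rw [Finset.sum_comm]
    simp only [mul_comm]
  simp only [h3, h2 _ m n]

end

section

/-! ### The superpotential of the Einstein tensor -/

/-- The terms quadratic in the connection in `gupTrace_pd_christoffel` cancel; `dG` is the derivative of
the density `G` that is covariantly constant for the connection `Γ`. -/
theorem komar_algebra (G : Fin 4 → Fin 4 → ℝ) (Γ dG : Fin 4 → Fin 4 → Fin 4 → ℝ) (z : Fin 4)
    (hG : ∀ a b, G a b = G b a) (hΓ : ∀ r a b, Γ r a b = Γ r b a)
    (hdG : ∀ c a b, dG c a b = -∑ d, (G a d * Γ b c d + G b d * Γ a c d) + G a b * ∑ d, Γ d c d) :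
    2 * ∑ m, G z m * ∑ r, ∑ s, (Γ r r s * Γ s m z - Γ r z s * Γ s m r)
      - 2 * ∑ n, ∑ m, dG n z m * Γ n z m + ∑ a, ∑ b, dG z a b * Γ z a b
      - (∑ a, ∑ b, G a b * Γ z a b) * ∑ d, Γ d z d = 0 := by
  have p₁₂ : ∀ {f : Fin 4 → Fin 4 → Fin 4 → ℝ},
      ∑ a, ∑ b, ∑ c, f a b c = ∑ b, ∑ a, ∑ c, f a b c := Finset.sum_comm
  have p₂₃ : ∀ {f : Fin 4 → Fin 4 → Fin 4 → ℝ},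
      ∑ a, ∑ b, ∑ c, f a b c = ∑ a, ∑ c, ∑ b, f a b c :=
    Finset.sum_congr rfl fun _ _ => Finset.sum_comm
  have e1 : ∑ m, G z m * ∑ r, ∑ s, (Γ r r s * Γ s m z - Γ r z s * Γ s m r) =
      ∑ m, ∑ r, ∑ s, G z m * (Γ r r s * Γ s m z) - ∑ m, ∑ r, ∑ s, G z m * (Γ r z s * Γ s m r) := by
    simp only [Finset.mul_sum, mul_sub, Finset.sum_sub_distrib]
  have e2 : ∑ n, ∑ m, dG n z m * Γ n z m = -(∑ n, ∑ m, ∑ d, G z d * Γ m n d * Γ n z m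
      + ∑ n, ∑ m, ∑ d, G m d * Γ z n d * Γ n z m) + ∑ n, ∑ m, ∑ d, G z m * Γ d n d * Γ n z m := by
    simp only [hdG, add_mul, neg_mul, Finset.sum_add_distrib, Finset.sum_neg_distrib,
      Finset.sum_mul, Finset.mul_sum]
  have e3 : ∑ a, ∑ b, dG z a b * Γ z a b = -(∑ a, ∑ b, ∑ d, G a d * Γ b z d * Γ z a b
      + ∑ a, ∑ b, ∑ d, G b d * Γ a z d * Γ z a b) + (∑ a, ∑ b, G a b * Γ z a b) * ∑ d, Γ d z d := by
    rw [Finset.sum_mul]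
    simp only [hdG, add_mul, neg_mul, Finset.sum_add_distrib, Finset.sum_neg_distrib,
      Finset.sum_mul]
    congr 1
    exact Finset.sum_congr rfl fun a _ => Finset.sum_congr rfl fun b _ => by ring
  have t1 : ∑ n, ∑ m, ∑ d, G z m * Γ d n d * Γ n z m =
      ∑ m, ∑ r, ∑ s, G z m * (Γ r r s * Γ s m z) := by
    refine (p₁₂.trans p₂₃).trans ?_
    refine Finset.sum_congr rfl fun m _ => Finset.sum_congr rfl fun r _ =>
      Finset.sum_congr rfl fun s _ => ?_
    rw [hΓ r s r, hΓ s z m]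
    ring
  have t2 : ∑ n, ∑ m, ∑ d, G z d * Γ m n d * Γ n z m =
      ∑ m, ∑ r, ∑ s, G z m * (Γ r z s * Γ s m r) := by
    refine (p₂₃.trans p₁₂).trans ?_
    refine Finset.sum_congr rfl fun m _ => Finset.sum_congr rfl fun r _ =>
      Finset.sum_congr rfl fun s _ => ?_
    rw [hΓ s r m]
    ring
  have t3 : ∑ a, ∑ b, ∑ d, G b d * Γ a z d * Γ z a b =
      ∑ a, ∑ b, ∑ d, G a d * Γ b z d * Γ z a b := by
    refine p₁₂.trans ?_
    refine Finset.sum_congr rfl fun m _ => Finset.sum_congr rfl fun r _ =>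
      Finset.sum_congr rfl fun s _ => ?_
    rw [hΓ z r m]
  have t4 : ∑ n, ∑ m, ∑ d, G m d * Γ z n d * Γ n z m =
      ∑ a, ∑ b, ∑ d, G a d * Γ b z d * Γ z a b := by
    refine (p₂₃.trans p₁₂).trans ?_
    refine Finset.sum_congr rfl fun m _ => Finset.sum_congr rfl fun r _ =>
      Finset.sum_congr rfl fun s _ => ?_
    rw [hΓ z r m, hG s m]
    ring
  rw [e1, e2, e3, t1, t2, t3, t4]
  ring

variable {g : Spacetime → SymTensor} {x : Spacetime}

/-- The Komar superpotential `√|g| (g^{zμ} Γ^ν_{zμ} - g^{νμ} Γ^z_{zμ})` of the coordinate vector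
field `∂_z`. -/
def komar (g : Spacetime → SymTensor) (z ν : Fin 4) (y : Spacetime) : ℝ :=
  ∑ m, gup (g y) m z * christoffel g ν z m y - ∑ m, gup (g y) m ν * christoffel g z z m y

/-- The change of the connection under translation along `x^z`, contracted as in the Palatini
identity, is `2 √|g| R_z^z` up to the divergence of the Komar superpotential. -/
theorem gupTrace_pd_christoffel (hg : ContDiff ℝ ∞ g) (hx : (mat (g x)).det ≠ 0) (z : Fin 4) :
    gupTrace (g x) (fun r m n => pd z (christoffel g r m n) x) z =
      2 * ∑ m, gup (g x) z m * ricci g m z x - ∑ n, pd n (komar g z n) x := by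
  have hΓ : ∀ {y}, (mat (g y)).det ≠ 0 → ∀ r a b, DifferentiableAt ℝ (christoffel g r a b) y :=
    fun hy r a b => (contDiffAt_christoffel hg hy r a b).differentiableAt (by simp)
  have hG : ∀ {y}, (mat (g y)).det ≠ 0 → ∀ a b, DifferentiableAt ℝ (fun y => gup (g y) a b) y :=
    fun hy a b => (contDiffAt_gup_field hg hy a b).differentiableAt (by simp)
  have hGs : ∀ a b, (fun y => gup (g y) a b) = fun y => gup (g y) b a :=
    fun a b => funext fun y => gup_symm _ _ _
  have hτ : DifferentiableAt ℝ (fun y => ∑ d, christoffel g d z d y) x := .fun_sum fun d _ =>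
    hΓ hx d z d
  have hQ : ∀ r s t, DifferentiableAt ℝ
      (fun y => ∑ m, gup (g y) m r * christoffel g s t m y) x :=
    fun r s t => .fun_sum fun m _ => (hG hx m r).fun_mul (hΓ hx s t m)
  have hGΓ : DifferentiableAt ℝ (fun y => ∑ a, ∑ b, gup (g y) a b * christoffel g z a b y) x :=
    .fun_sum fun a _ => .fun_sum fun b _ => (hG hx a b).fun_mul (hΓ hx z a b)
  -- the commutator of `∂_z` and `∂_c` on `√|g| g^{zc}`
  have hcomm : pd z (fun y => ∑ a, ∑ b, gup (g y) a b * christoffel g z a b y) x =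
      ∑ c, (pd c (fun y => ∑ m, gup (g y) m z * christoffel g c z m y) x
        + pd c (fun y => ∑ m, gup (g y) m c * christoffel g z z m y) x
        - pd c (fun y => gup (g y) c z * ∑ d, christoffel g d z d y) x) := by
    have h1 : ∑ c, pd z (pd c (fun y => gup (g y) z c)) x =
        -pd z (fun y => ∑ a, ∑ b, gup (g y) a b * christoffel g z a b y) x := by
      rw [← pd_sum fun c _ => (contDiffAt_pd_top (contDiffAt_gup_field hg hx z c)).differentiableAt
        (by simp), ← pd_neg]
      refine pd_congr ?_
      filter_upwards [eventually_det_field hg hx] with y hy using sum_pd_gup hg hy z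
    have h2 : ∀ c, pd c (pd z (fun y => gup (g y) z c)) x =
        -(pd c (fun y => ∑ m, gup (g y) m z * christoffel g c z m y) x
        + pd c (fun y => ∑ m, gup (g y) m c * christoffel g z z m y) x
        - pd c (fun y => gup (g y) c z * ∑ d, christoffel g d z d y) x) := by
      intro c
      rw [← pd_add (hQ _ _ _) (hQ _ _ _), ← pd_sub ((hQ _ _ _).fun_add (hQ _ _ _))
        ((hG hx c z).fun_mul hτ), ← pd_neg]
      refine pd_congr ?_
      filter_upwards [eventually_det_field hg hx] with y hy
      rw [pd_gup hg hy, Finset.sum_add_distrib]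
      have e : ∀ (r : Fin 4) (f : Fin 4 → ℝ),
          ∑ m, gup (g y) m r * f m = ∑ m, gup (g y) r m * f m :=
        fun r f => Finset.sum_congr rfl fun m _ => by rw [gup_symm]
      rw [e, e, gup_symm (g y) c z]
      ring
    rw [← neg_inj, ← h1, ← Finset.sum_neg_distrib]
    exact Finset.sum_congr rfl fun c _ => by
      rw [pd_comm (contDiffAt_gup_field hg hx z c), h2]
  have h3 : ∀ c, pd c (fun y => gup (g y) c z * ∑ d, christoffel g d z d y) x =
      gup (g x) c z * pd z (fun y => ∑ d, christoffel g d c d y) x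
      + pd c (fun y => gup (g y) z c) x * ∑ d, christoffel g d z d x := by
    intro c
    rw [pd_mul (hG hx c z) hτ, pd_christoffel_trace hg hx, hGs c z]
  have h4 : ∀ n, pd n (komar g z n) x =
      pd n (fun y => ∑ m, gup (g y) m z * christoffel g n z m y) x
      - pd n (fun y => ∑ m, gup (g y) m n * christoffel g z z m y) x :=
    fun n => pd_sub (hQ _ _ _) (hQ _ _ _)
  have h5 : ∀ n, pd n (fun y => ∑ m, gup (g y) m z * christoffel g n z m y) x =
      ∑ m, gup (g x) m z * pd n (christoffel g n z m) x
        + ∑ m, pd n (fun y => gup (g y) m z) x * christoffel g n z m x :=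
    fun n => pd_sum_gup_mul' hg hx fun m => hΓ hx n z m
  have h6 := pd_sum_gup_mul hg hx (c := z) fun m n => hΓ hx z m n
  have hs : ∀ r a b, christoffel g r a b = christoffel g r b a :=
    fun r a b => funext fun y => christoffel_symm g r a b y
  have h7 : ∑ m, gup (g x) z m * ricci g m z x =
      ∑ n, ∑ m, gup (g x) m z * pd n (christoffel g n z m) x
      - ∑ m, gup (g x) m z * pd z (fun y => ∑ d, christoffel g d m d y) x
      + ∑ m, gup (g x) z m * ∑ r, ∑ s, (christoffel g r r s x * christoffel g s m z x
          - christoffel g r z s x * christoffel g s m r x) := by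
    rw [Finset.sum_comm, ← Finset.sum_sub_distrib, ← Finset.sum_add_distrib]
    refine Finset.sum_congr rfl fun m _ => ?_
    rw [ricci, pd_sum fun d _ => hΓ hx d m d, gup_symm (g x) m z, Finset.sum_add_distrib,
      Finset.sum_sub_distrib, mul_add, mul_sub, Finset.mul_sum]
    simp only [hs _ z m]
  have h8 := komar_algebra (fun a b => gup (g x) a b) (fun a b c => christoffel g a b c x)
    (fun c a b => pd c (fun y => gup (g y) a b) x) z
    (fun a b => gup_symm _ _ _) (fun r a b => christoffel_symm _ _ _ _ _)
    (fun c a b => pd_gup hg hx a b c)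
  have h9 : ∑ n, pd n (komar g z n) x =
      2 * ∑ n, pd n (fun y => ∑ m, gup (g y) m z * christoffel g n z m y) x
      - pd z (fun y => ∑ a, ∑ b, gup (g y) a b * christoffel g z a b y) x
      - ∑ c, pd c (fun y => gup (g y) c z * ∑ d, christoffel g d z d y) x := by
    rw [hcomm]
    simp only [h4, Finset.sum_add_distrib, Finset.sum_sub_distrib]
    ring
  have h10 : ∑ c, pd c (fun y => gup (g y) z c) x * ∑ d, christoffel g d z d x =
      -(∑ a, ∑ b, gup (g x) a b * christoffel g z a b x) * ∑ d, christoffel g d z d x := by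
    rw [← Finset.sum_mul, sum_pd_gup hg hx]
  have h11 : ∑ m, gup (g x) m z * ∑ s, pd z (christoffel g s m s) x =
      ∑ m, gup (g x) m z * pd z (fun y => ∑ d, christoffel g d m d y) x :=
    Finset.sum_congr rfl fun m _ => by rw [pd_sum fun d _ => hΓ hx d m d]
  have h12 : ∀ n, ∑ m, pd n (fun y => gup (g y) m z) x * christoffel g n z m x =
      ∑ m, pd n (fun y => gup (g y) z m) x * christoffel g n z m x := fun n =>
    Finset.sum_congr rfl fun m _ => by rw [hGs m z]
  rw [gupTrace, h9, h6, h7, h11]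
  simp only [h5, h3, Finset.sum_add_distrib, h12, h10]
  linear_combination -h8

end

section

/-! ### The first variation of the first order Lagrangian -/

section Families

variable {E : Type*} [NormedAddCommGroup E] [NormedSpace ℝ E] {f : E → ℝ} {Φ Ψ : Spacetime → E}
  {x : Spacetime}

theorem hasDerivAt_family (p q : E) (hf : ContDiffAt ℝ ∞ f p) :
    HasDerivAt (fun s : ℝ => f (p + s • q)) (fderiv ℝ f p q) 0 := by
  have := ((hf.differentiableAt (by simp)).hasFDerivAt).hasLineDerivAt q
  simpa [HasLineDerivAt] using this

/-- Variations commute with partial derivatives. -/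
theorem hasDerivAt_pd_family (hf : ContDiffAt ℝ ∞ f (Φ x)) (hΦ : ContDiffAt ℝ ∞ Φ x)
    (hΨ : ContDiffAt ℝ ∞ Ψ x) (ρ : Fin 4) :
    HasDerivAt (fun s : ℝ => pd ρ (fun y => f (Φ y + s • Ψ y)) x)
      (pd ρ (fun y => fderiv ℝ f (Φ y) (Ψ y)) x) 0 := by
  have hΦd : DifferentiableAt ℝ Φ x := hΦ.differentiableAt (by simp)
  have hΨd : DifferentiableAt ℝ Ψ x := hΨ.differentiableAt (by simp)
  have hf' : ContDiffAt ℝ ∞ (fderiv ℝ f) (Φ x) := hf.fderiv_right (m := ∞) (by simp)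
  have hf'd : DifferentiableAt ℝ (fderiv ℝ f) (Φ x) := hf'.differentiableAt (by simp)
  have hline : HasDerivAt (fun s : ℝ => Φ x + s • Ψ x) (Ψ x) 0 := by
    simpa using ((hasDerivAt_id (0 : ℝ)).smul_const (Ψ x)).const_add (Φ x)
  have hev : ∀ᶠ s : ℝ in 𝓝 0, DifferentiableAt ℝ f (Φ x + s • Ψ x) := by
    have h1 : ∀ᶠ p in 𝓝 (Φ x), DifferentiableAt ℝ f p := by
      filter_upwards [(hf.of_le (m := 1) (by simp)).eventually (by simp)] with p hp
      exact hp.differentiableAt (by simp)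
    have h2 : Tendsto (fun s : ℝ => Φ x + s • Ψ x) (𝓝 0) (𝓝 (Φ x)) := by
      simpa using hline.continuousAt.tendsto
    exact h2.eventually h1
  have h1 : (fun s : ℝ => pd ρ (fun y => f (Φ y + s • Ψ y)) x) =ᶠ[𝓝 0]
      fun s => fderiv ℝ f (Φ x + s • Ψ x) (pd ρ Φ x + s • pd ρ Ψ x) := by
    filter_upwards [hev] with s hs
    rw [pd_comp (f := fun y => Φ y + s • Ψ y) hs (hΦd.fun_add (hΨd.fun_const_smul s)),
      pd_add hΦd (hΨd.fun_const_smul s), pd_const_smul s hΨd]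
  have h2 : HasDerivAt (fun s : ℝ => fderiv ℝ f (Φ x + s • Ψ x))
      (fderiv ℝ (fderiv ℝ f) (Φ x) (Ψ x)) 0 := by
    have h3 : HasFDerivAt (fderiv ℝ f) (fderiv ℝ (fderiv ℝ f) (Φ x)) (Φ x + (0 : ℝ) • Ψ x) := by
      simpa using hf'd.hasFDerivAt
    exact h3.comp_hasDerivAt (0 : ℝ) hline
  have h3 : HasDerivAt (fun s : ℝ => pd ρ Φ x + s • pd ρ Ψ x) (pd ρ Ψ x) 0 := by
    simpa using ((hasDerivAt_id (0 : ℝ)).smul_const (pd ρ Ψ x)).const_add (pd ρ Φ x)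
  have h4 := (h2.clm_apply h3).congr_of_eventuallyEq h1
  refine h4.congr_deriv ?_
  rw [pd_clm_apply (A := fun y => fderiv ℝ f (Φ y))
    ((ContDiffAt.comp x hf' hΦ).differentiableAt (by simp)) hΨd,
    pd_comp (h := fderiv ℝ f) hf'd hΦd,
    (hf.isSymmSndFDerivAt (by simpa using two_le_smooth)).eq]
  simp

end Families

variable {g η : Spacetime → SymTensor} {x : Spacetime}

/-- The momentum `δ(√|g| g^{mn}) Γ^r_{mn} - δ(√|g| g^{mr}) Γ^s_{ms}` conjugate to the metric, for
the variation `δg = w`. -/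
def momentum (r : Fin 4) (p : SymTensor × (Fin 4 → SymTensor)) (w : SymTensor) : ℝ :=
  ∑ m, ∑ n, fderiv ℝ (fun B => gup B m n) p.1 w * chr r m n p
    - ∑ m, fderiv ℝ (fun B => gup B m r) p.1 w * ∑ s, chr s m s p

/-- The variation of the connection, `δΓ^r_{mn}`. -/
def varChristoffel (g η : Spacetime → SymTensor) (r m n : Fin 4) (y : Spacetime) : ℝ :=
  fderiv ℝ (chr r m n) (g y, grad g y) (η y, grad η y)

/-- The pairing `δ(√|g| g^{mn}) R_{mn} = - √|g| (R^{mn} - ½ g^{mn} R) w_{mn}` of the Einstein tensor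
density with the variation `δg = w`. -/
def einsteinPairing (g : Spacetime → SymTensor) (x : Spacetime) (w : SymTensor) : ℝ :=
  ∑ m, ∑ n, fderiv ℝ (fun B => gup B m n) (g x) w * ricci g m n x

theorem grad_add_smul (hg : ContDiff ℝ ∞ g) (hη : ContDiff ℝ ∞ η) (s : ℝ) (y : Spacetime) :
    grad (fun y => g y + s • η y) y = grad g y + s • grad η y := by
  funext μ
  have h1 := hg.differentiable (by simp) y
  have h2 := hη.differentiable (by simp) y
  simp only [grad, Pi.add_apply, Pi.smul_apply]
  rw [pd_add h1 (h2.fun_const_smul s), pd_const_smul s h2]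

theorem pair_add_smul (hg : ContDiff ℝ ∞ g) (hη : ContDiff ℝ ∞ η) (s : ℝ) (y : Spacetime) :
    (g y + s • η y, grad (fun y => g y + s • η y) y) = (g y, grad g y) + s • (η y, grad η y) := by
  rw [grad_add_smul hg hη]
  rfl

/-- The contraction `gupTrace` of the Christoffel symbols as a function of metric and gradient. -/
def chrTrace (r : Fin 4) (p : SymTensor × (Fin 4 → SymTensor)) : ℝ :=
  gupTrace p.1 (fun a b c => chr a b c p) r

theorem hasFDerivAt_gup_fst {p : SymTensor × (Fin 4 → SymTensor)} (hp : (mat p.1).det ≠ 0)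
    (m n : Fin 4) : HasFDerivAt (fun p : SymTensor × (Fin 4 → SymTensor) => gup p.1 m n)
      ((fderiv ℝ (fun B => gup B m n) p.1).comp (ContinuousLinearMap.fst ℝ _ _)) p :=
  HasFDerivAt.comp p (f := Prod.fst) (g := fun B => gup B m n)
    ((contDiffAt_gup hp m n).differentiableAt (by simp)).hasFDerivAt
    (ContinuousLinearMap.fst ℝ SymTensor (Fin 4 → SymTensor)).hasFDerivAt

theorem contDiffAt_gup_fst {p : SymTensor × (Fin 4 → SymTensor)} (hp : (mat p.1).det ≠ 0)
    (m n : Fin 4) :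
    ContDiffAt ℝ ∞ (fun p : SymTensor × (Fin 4 → SymTensor) => gup p.1 m n) p :=
  ContDiffAt.comp p (f := Prod.fst) (g := fun B => gup B m n) (contDiffAt_gup hp m n)
    contDiffAt_fst

theorem contDiffAt_chrTrace {p : SymTensor × (Fin 4 → SymTensor)} (hp : (mat p.1).det ≠ 0)
    (r : Fin 4) : ContDiffAt ℝ ∞ (chrTrace r) p :=
  (ContDiffAt.sum fun m _ => ContDiffAt.sum fun n _ =>
    (contDiffAt_gup_fst hp m n).mul (contDiffAt_chr hp r m n)).sub
  (ContDiffAt.sum fun m _ => (contDiffAt_gup_fst hp m r).mul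
    (ContDiffAt.sum fun s _ => contDiffAt_chr hp s m s))

theorem contDiffAt_gammaLagrangian {p : SymTensor × (Fin 4 → SymTensor)}
    (hp : (mat p.1).det ≠ 0) : ContDiffAt ℝ ∞ gammaLagrangian p :=
  ContDiffAt.sum fun m _ => ContDiffAt.sum fun n _ => (contDiffAt_gup_fst hp m n).mul
    (ContDiffAt.sum fun _ _ => ContDiffAt.sum fun _ _ =>
      ((contDiffAt_chr hp _ _ _).mul (contDiffAt_chr hp _ _ _)).sub
        ((contDiffAt_chr hp _ _ _).mul (contDiffAt_chr hp _ _ _)))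

theorem fderiv_chrTrace {p : SymTensor × (Fin 4 → SymTensor)} (hp : (mat p.1).det ≠ 0)
    (r : Fin 4) (k : SymTensor × (Fin 4 → SymTensor)) :
    fderiv ℝ (chrTrace r) p k =
      gupTrace p.1 (fun a b c => fderiv ℝ (chr a b c) p k) r + momentum r p k.1 := by
  have hc : ∀ a b c, HasFDerivAt (chr a b c) (fderiv ℝ (chr a b c) p) p :=
    fun a b c => ((contDiffAt_chr hp a b c).differentiableAt (by simp)).hasFDerivAt
  have h : HasFDerivAt (chrTrace r) _ p :=
    (HasFDerivAt.fun_sum (u := Finset.univ) fun m _ => HasFDerivAt.fun_sum (u := Finset.univ)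
      fun n _ => (hasFDerivAt_gup_fst hp m n).mul (hc r m n)).sub
    (HasFDerivAt.fun_sum (u := Finset.univ) fun m _ => (hasFDerivAt_gup_fst hp m r).mul
      (HasFDerivAt.fun_sum (u := Finset.univ) fun s _ => hc s m s))
  rw [h.fderiv]
  simp only [sub_apply, sum_apply, add_apply, smul_apply, smul_eq_mul,
    ContinuousLinearMap.comp_apply, ContinuousLinearMap.coe_fst', gupTrace, momentum,
    Finset.sum_add_distrib]
  simp only [mul_comm]
  ring

theorem contDiffAt_varChristoffel (hg : ContDiff ℝ ∞ g) (hη : ContDiff ℝ ∞ η)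
    (hx : (mat (g x)).det ≠ 0) (r m n : Fin 4) :
    ContDiffAt ℝ ∞ (varChristoffel g η r m n) x :=
  ContDiffAt.clm_apply (ContDiffAt.comp x (f := fun y => (g y, grad g y))
    (g := fderiv ℝ (chr r m n)) ((contDiffAt_chr (p := (g x, grad g x)) hx r m n).fderiv_right
      (m := ∞) (by simp)) (contDiffAt_pair hg)) (contDiffAt_pair hη)

theorem contDiffAt_momentum (hg : ContDiff ℝ ∞ g) (hη : ContDiff ℝ ∞ η)
    (hx : (mat (g x)).det ≠ 0) (r : Fin 4) :
    ContDiffAt ℝ ∞ (fun y => momentum r (g y, grad g y) (η y)) x := by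
  have h1 : ∀ m n, ContDiffAt ℝ ∞ (fun y => fderiv ℝ (fun B => gup B m n) (g y) (η y)) x :=
    fun m n => ContDiffAt.clm_apply (ContDiffAt.comp x (g := fderiv ℝ fun B => gup B m n)
      ((contDiffAt_gup hx m n).fderiv_right (m := ∞) (by simp)) hg.contDiffAt) hη.contDiffAt
  exact (ContDiffAt.sum fun m _ => ContDiffAt.sum fun n _ =>
    (h1 m n).mul (contDiffAt_christoffel hg hx r m n)).sub
    (ContDiffAt.sum fun m _ => (h1 m r).mul
      (ContDiffAt.sum fun s _ => contDiffAt_christoffel hg hx s m s))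

/-- The first variation of the first order Lagrangian: Einstein tensor plus a divergence. The
second derivatives in the variation of `√|g| R` cancel against those in the divergence by the
Palatini identity. -/
theorem fderiv_gammaLagrangian (hg : ContDiff ℝ ∞ g) (hη : ContDiff ℝ ∞ η)
    (hx : (mat (g x)).det ≠ 0) :
    fderiv ℝ gammaLagrangian (g x, grad g x) (η x, grad η x) =
      einsteinPairing g x (η x) - ∑ r, pd r (fun y => momentum r (g y, grad g y) (η y)) x := by
  set G : ℝ → Spacetime → SymTensor := fun s y => g y + s • η y with hG
  have hGs : ∀ s, ContDiff ℝ ∞ (G s) := fun s => hg.add (hη.const_smul s)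
  have hpair : ∀ s y, (G s y, grad (G s) y) = (g y, grad g y) + s • (η y, grad η y) :=
    fun s y => pair_add_smul hg hη s y
  have hdet : ∀ᶠ s : ℝ in 𝓝 0, (mat (G s x)).det ≠ 0 := by
    have h1 : Tendsto (fun s : ℝ => g x + s • η x) (𝓝 0) (𝓝 (g x)) := by
      have : Continuous fun s : ℝ => g x + s • η x := by fun_prop
      simpa using this.tendsto 0
    exact h1.eventually (eventually_det_ne_zero hx)
  have hp : ∀ y, ContDiffAt ℝ ∞ (fun y => (g y, grad g y)) y := fun y => contDiffAt_pair hg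
  have hq : ∀ y, ContDiffAt ℝ ∞ (fun y => (η y, grad η y)) y := fun y => contDiffAt_pair hη
  have hchr : ∀ r m n, ContDiffAt ℝ ∞ (chr r m n) (g x, grad g x) :=
    fun r m n => contDiffAt_chr (p := (g x, grad g x)) hx r m n
  -- both sides of `scalarCurvature_eq` are differentiated along `g + s η` at `s = 0`
  have v1 : HasDerivAt (fun s => gammaLagrangian (G s x, grad (G s) x))
      (fderiv ℝ gammaLagrangian (g x, grad g x) (η x, grad η x)) 0 := by
    simp only [hpair]
    exact hasDerivAt_family _ _ (contDiffAt_gammaLagrangian (p := (g x, grad g x)) hx)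
  have v2 : ∀ r m n, HasDerivAt (fun s => christoffel (G s) r m n x)
      (varChristoffel g η r m n x) 0 := by
    intro r m n
    simp only [christoffel_eq, hpair]
    exact hasDerivAt_family _ _ (hchr r m n)
  have v3 : ∀ c r m n, HasDerivAt (fun s => pd c (christoffel (G s) r m n) x)
      (pd c (varChristoffel g η r m n) x) 0 := by
    intro c r m n
    have : ∀ s, christoffel (G s) r m n = fun y => chr r m n ((g y, grad g y) + s • (η y, grad η y)) :=
      fun s => funext fun y => by rw [christoffel_eq, hpair]
    simp only [this]
    exact hasDerivAt_pd_family (Φ := fun y => (g y, grad g y)) (Ψ := fun y => (η y, grad η y))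
      (hchr r m n) (hp x) (hq x) c
  have v4 : ∀ r, HasDerivAt (fun s => pd r (fun y => gupTrace (G s y)
      (fun a b c => christoffel (G s) a b c y) r) x)
      (pd r (fun y => gupTrace (g y) (fun a b c => varChristoffel g η a b c y) r) x
        + pd r (fun y => momentum r (g y, grad g y) (η y)) x) 0 := by
    intro r
    have : ∀ s, (fun y => gupTrace (G s y) (fun a b c => christoffel (G s) a b c y) r) =
        fun y => chrTrace r ((g y, grad g y) + s • (η y, grad η y)) := by
      intro s
      funext y
      rw [← hpair]
      rfl
    simp only [this]
    refine (hasDerivAt_pd_family (Φ := fun y => (g y, grad g y)) (Ψ := fun y => (η y, grad η y))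
      (contDiffAt_chrTrace (p := (g x, grad g x)) hx r) (hp x) (hq x) r).congr_deriv ?_
    rw [← pd_add]
    · refine pd_congr ?_
      filter_upwards [eventually_det_field hg hx] with y hy
      exact fderiv_chrTrace (p := (g y, grad g y)) hy r _
    · have h1 : ∀ m n, DifferentiableAt ℝ (fun y => gup (g y) m n) x :=
        fun m n => (contDiffAt_gup_field hg hx m n).differentiableAt (by simp)
      have h2 : ∀ r m n, DifferentiableAt ℝ (varChristoffel g η r m n) x :=
        fun r m n => (contDiffAt_varChristoffel hg hη hx r m n).differentiableAt (by simp)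
      exact (DifferentiableAt.fun_sum fun m _ => .fun_sum fun n _ => (h1 m n).fun_mul
        (h2 r m n)).fun_sub (.fun_sum fun m _ => (h1 m r).fun_mul (.fun_sum fun s _ => h2 s m s))
    · exact (contDiffAt_momentum hg hη hx r).differentiableAt (by simp)
  have v5 : ∀ m n, HasDerivAt (fun s => gup (G s x) m n)
      (fderiv ℝ (fun B => gup B m n) (g x) (η x)) 0 :=
    fun m n => hasDerivAt_family (f := fun B => gup B m n) _ _ (contDiffAt_gup hx m n)
  have v6 : ∀ m n, HasDerivAt (fun s => ricci (G s) m n x)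
      (∑ r, (pd r (varChristoffel g η r m n) x - pd n (varChristoffel g η r m r) x
        + ∑ s, (varChristoffel g η r r s x * christoffel g s m n x
          + christoffel g r r s x * varChristoffel g η s m n x
          - varChristoffel g η r n s x * christoffel g s m r x
          - christoffel g r n s x * varChristoffel g η s m r x))) 0 := by
    intro m n
    have h0 : G 0 = g := by funext y; simp [hG]
    refine (HasDerivAt.fun_sum (u := Finset.univ) fun r _ => ((v3 r r m n).fun_sub
      (v3 n r m r)).fun_add (HasDerivAt.fun_sum (u := Finset.univ) fun s _ =>
      ((v2 r r s).fun_mul (v2 s m n)).fun_sub ((v2 r n s).fun_mul (v2 s m r)))).congr_deriv ?_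
    rw [h0]
    refine Finset.sum_congr rfl fun r _ => ?_
    congr 1
    exact Finset.sum_congr rfl fun s _ => by ring
  have v7 := (HasDerivAt.fun_sum (u := Finset.univ) fun m _ => HasDerivAt.fun_sum
    (u := Finset.univ) fun n _ => (v5 m n).fun_mul (v6 m n)).fun_sub
    (HasDerivAt.fun_sum (u := Finset.univ) fun r _ => v4 r)
  have hev : (fun s => gammaLagrangian (G s x, grad (G s) x)) =ᶠ[𝓝 0] fun s =>
      ∑ m, ∑ n, gup (G s x) m n * ricci (G s) m n x
      - ∑ r, pd r (fun y => gupTrace (G s y) (fun a b c => christoffel (G s) a b c y) r) x := by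
    filter_upwards [hdet] with s hs
    rw [← sqrtDet_mul_scalarCurvature, scalarCurvature_eq (hGs s) hs]
    ring
  have hfin := v1.unique (v7.congr_of_eventuallyEq hev)
  have h0 : G 0 = g := by funext y; simp [hG]
  rw [hfin, h0]
  have hpal := palatini hg hx (D := varChristoffel g η)
    (fun r m n => (contDiffAt_varChristoffel hg hη hx r m n).differentiableAt (by simp))
    (fun r m n => by
      funext y
      simp only [varChristoffel]
      rw [show chr r m n = chr r n m from funext fun p => chr_symm r m n p])
  simp only [Finset.sum_add_distrib, einsteinPairing] at hpal ⊢
  linear_combination hpal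

end

section

variable {g : Spacetime → SymTensor} {x : Spacetime}

/-! ### Euler-Lagrange derivative and energy of the first order Lagrangian -/

theorem momentum_smul (r : Fin 4) (p : SymTensor × (Fin 4 → SymTensor)) (c : ℝ) (w : SymTensor) :
    momentum r p (c • w) = c * momentum r p w := by
  simp only [momentum, map_smul, smul_eq_mul, mul_sub, Finset.mul_sum, mul_assoc]

/-- The first order Lagrangian has the momentum `- momentum`: test the first variation with
`δg = (x^μ - x₀^μ) w`. -/
theorem fderiv_gammaLagrangian_single (hg : ContDiff ℝ ∞ g) (hx : (mat (g x)).det ≠ 0)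
    (μ : Fin 4) (w : SymTensor) :
    fderiv ℝ gammaLagrangian (g x, grad g x) (0, Pi.single μ w) =
      -momentum μ (g x, grad g x) w := by
  have hc : ∀ y : Spacetime, DifferentiableAt ℝ (fun y : Spacetime => y μ - x μ) y :=
    fun y => (contDiffAt_coord_sub (x μ) (n := ∞)).differentiableAt (by simp)
  have hη : ContDiff ℝ ∞ fun y : Spacetime => (y μ - x μ) • w :=
    contDiff_iff_contDiffAt.2 fun y => (contDiffAt_coord_sub (x μ)).smul contDiffAt_const
  have h := fderiv_gammaLagrangian hg hη hx
  have h1 : grad (fun y : Spacetime => (y μ - x μ) • w) x = Pi.single μ w := by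
    funext ν
    rw [grad, pd_smul (hc x) (differentiableAt_const _), pd_coord_sub, Pi.single_apply]
    simp
  have h2 : ∀ r, pd r (fun y => momentum r (g y, grad g y) ((y μ - x μ) • w)) x =
      if r = μ then momentum r (g x, grad g x) w else 0 := by
    intro r
    simp only [momentum_smul]
    rw [pd_mul (hc x) ((contDiffAt_momentum hg contDiff_const hx r).differentiableAt (by simp)),
      pd_coord_sub]
    simp
  rw [h1] at h
  simp only [h2, sub_self, zero_smul] at h
  rw [h]
  simp [einsteinPairing]

/-- The first variation tested with the constant field `δg = w`. -/
theorem fderiv_gammaLagrangian_const (hg : ContDiff ℝ ∞ g) (hx : (mat (g x)).det ≠ 0)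
    (w : SymTensor) :
    fderiv ℝ gammaLagrangian (g x, grad g x) (w, 0) =
      einsteinPairing g x w - ∑ r, pd r (fun y => momentum r (g y, grad g y) w) x := by
  have h1 : grad (fun _ : Spacetime => w) x = 0 := by
    funext ν
    simp [grad]
  have h := fderiv_gammaLagrangian hg (contDiff_const (c := w)) hx
  rwa [h1] at h

/-- The first order Lagrangian has the Einstein equations as its equations of motion. -/
theorem gammaLagrangian_eulerLagrange (hg : ContDiff ℝ ∞ g) (hx : (mat (g x)).det ≠ 0)
    (w : SymTensor) :
    fderiv ℝ gammaLagrangian (g x, grad g x) (w, 0)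
      - ∑ μ, pd μ (fun y => fderiv ℝ gammaLagrangian (g y, grad g y) (0, Pi.single μ w)) x =
      einsteinPairing g x w := by
  have h : ∀ μ, pd μ (fun y => fderiv ℝ gammaLagrangian (g y, grad g y) (0, Pi.single μ w)) x =
      -pd μ (fun y => momentum μ (g y, grad g y) w) x := by
    intro μ
    rw [← pd_neg]
    refine pd_congr ?_
    filter_upwards [eventually_det_field hg hx] with y hy
    exact fderiv_gammaLagrangian_single hg hy μ w
  simp only [h, fderiv_gammaLagrangian_const hg hx, Finset.sum_neg_distrib]
  ring

/-- The superpotential `√|g| (Γ^i_{jμ} g^{μj} - Γ^j_{jμ} g^{μi})`, summed over spatial `j`. -/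
def gammaSuperpotential (g : Spacetime → SymTensor) (i : Fin 3) (y : Spacetime) : ℝ :=
  gupTrace (g y) (fun a b c => christoffel g a b c y) i.succ - komar g 0 i.succ y

/-- The energy density of the first order Lagrangian of general relativity, the Einstein
pseudotensor, is `2 G_0^0` plus a spatial divergence. -/
theorem gammaLagrangian_energy (hg : ContDiff ℝ ∞ g) (hx : (mat (g x)).det ≠ 0) :
    fderiv ℝ gammaLagrangian (g x, grad g x) (0, Pi.single 0 (pd 0 g x))
      - gammaLagrangian (g x, grad g x) =
    2 * einstein g 0 0 x + ∑ i : Fin 3, pd i.succ (gammaSuperpotential g i) x := by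
  have hG : ∀ m n, DifferentiableAt ℝ (fun y => gup (g y) m n) x :=
    fun m n => (contDiffAt_gup_field hg hx m n).differentiableAt (by simp)
  have hΓ : ∀ r m n, DifferentiableAt ℝ (christoffel g r m n) x :=
    fun r m n => (contDiffAt_christoffel hg hx r m n).differentiableAt (by simp)
  have hT : ∀ r, DifferentiableAt ℝ
      (fun y => gupTrace (g y) (fun a b c => christoffel g a b c y) r) x := fun r =>
    (DifferentiableAt.fun_sum fun m _ => .fun_sum fun n _ => (hG m n).fun_mul
        (hΓ r m n)).fun_sub (.fun_sum fun m _ => (hG m r).fun_mul (.fun_sum fun s _ => hΓ s m s))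
  have hK : ∀ n, DifferentiableAt ℝ (komar g 0 n) x := fun n =>
    (DifferentiableAt.fun_sum fun m _ => (hG m 0).fun_mul (hΓ n 0 m)).fun_sub
      (.fun_sum fun m _ => (hG m n).fun_mul (hΓ 0 0 m))
  have hgup : ∀ m n, fderiv ℝ (fun B => gup B m n) (g x) (pd 0 g x) =
      pd 0 (fun y => gup (g y) m n) x := fun m n =>
    (pd_comp ((contDiffAt_gup hx m n).differentiableAt (by simp))
      (hg.differentiable (by simp) x)).symm
  have h1 : pd 0 (fun y => gupTrace (g y) (fun a b c => christoffel g a b c y) 0) x =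
      gupTrace (g x) (fun r m n => pd 0 (christoffel g r m n) x) 0
      + momentum 0 (g x, grad g x) (pd 0 g x) := by
    simp only [gupTrace, momentum, hgup]
    rw [pd_sub (.fun_sum fun m _ => .fun_sum fun n _ => (hG m n).fun_mul (hΓ 0 m n))
      (.fun_sum fun m _ => (hG m 0).fun_mul (.fun_sum fun s _ => hΓ s m s)),
      pd_sum_gup_mul hg hx (fun m n => hΓ 0 m n),
      pd_sum_gup_mul' hg hx (fun m => .fun_sum fun s _ => hΓ s m s)]
    simp only [pd_sum fun s _ => hΓ s _ s]
    simp only [christoffel_eq]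
    ring
  have h2 : ∀ i : Fin 3, pd i.succ (gammaSuperpotential g i) x =
      pd i.succ (fun y => gupTrace (g y) (fun a b c => christoffel g a b c y) i.succ) x
      - pd i.succ (komar g 0 i.succ) x := fun i => pd_sub (hT _) (hK _)
  have h3 : pd 0 (komar g 0 0) x = 0 := by
    have : komar g 0 0 = fun _ => 0 := funext fun y => by simp [komar]
    rw [this, pd_const]
  have h4 := scalarCurvature_eq hg hx
  have h5 := gupTrace_pd_christoffel hg hx 0
  rw [Fin.sum_univ_succ] at h4
  rw [Fin.sum_univ_succ (f := fun n => pd n (komar g 0 n) x)] at h5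
  have h6 : einstein g 0 0 x = ∑ m, gup (g x) 0 m * ricci g m 0 x
      - (1 / 2) * (sqrtDet (g x) * scalarCurvature g x) := by
    simp only [einstein, gup, mul_sub, Finset.mul_sum, if_true, mul_assoc]
    ring
  rw [fderiv_gammaLagrangian_single hg hx]
  simp only [h2, Finset.sum_sub_distrib]
  linear_combination h1 + h4 + h5 - 2 * h6 - h3

/-- The symmetric tensor `g_{μ0} δ_ν^0 + g_{0ν} δ_μ^0`. At time `t₀` it is the Lie derivative of `g`
along `(t - t₀) ∂_t`. Its pairing with a symmetric `S^{μν}` is `2 S_0^0`. -/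
def timeLowering (A : SymTensor) : SymTensor := ∑ σ, (2 * A.1 σ 0) • symUnit 0 σ

theorem timeLowering_apply (A : SymTensor) (a b : Fin 4) :
    (timeLowering A).1 a b = (if a = 0 then A.1 b 0 else 0) + if b = 0 then A.1 a 0 else 0 := by
  have h : (timeLowering A).1 a b = ∑ σ, ((if a = 0 then (if b = σ then A.1 σ 0 else 0) else 0)
      + if b = 0 then (if a = σ then A.1 σ 0 else 0) else 0) := by
    rw [← entry_apply, timeLowering, map_sum]
    refine Finset.sum_congr rfl fun σ _ => ?_
    change 2 * A.1 σ 0 * ((1 / 2) * ((if a = 0 ∧ b = σ then (1 : ℝ) else 0)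
      + if a = σ ∧ b = 0 then 1 else 0)) = _
    split_ifs <;> first | (exfalso; tauto) | ring
  rw [h, Finset.sum_add_distrib]
  by_cases h1 : a = 0 <;> by_cases h2 : b = 0 <;> simp [h1, h2]

theorem einsteinPairing_timeLowering (hg : ContDiff ℝ ∞ g) (hx : (mat (g x)).det ≠ 0) :
    einsteinPairing g x (timeLowering (g x)) = -2 * einstein g 0 0 x := by
  set A := g x with hA
  set w := timeLowering A with hw
  have h2 : ∀ m b, ∑ n, up A b n * w.1 m n =
      (if m = 0 then (if b = 0 then 1 else 0) else 0) + up A b 0 * A.1 m 0 := by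
    intro m b
    have e := sum_up_mul hx b 0
    simp only [hw, timeLowering_apply, mul_add, Finset.sum_add_distrib, mul_ite, mul_zero]
    congr 1
    · by_cases hm : m = 0
      · simp only [hm, if_true, e]
      · simp [hm]
    · simp
  have h3 : ∑ m, ∑ n, up A m n * w.1 m n = 2 := by
    simp only [h2, Finset.sum_add_distrib]
    have e : ∑ m, up A m 0 * A.1 m 0 = 1 := by
      have := sum_up_mul hx 0 0
      simp only [up_symm A _ 0, this, if_true]
    rw [e, Finset.sum_eq_single (0 : Fin 4)]
    · norm_num
    · intro b _ hb
      simp [hb]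
    · simp
  have h4 : ∀ a b, ∑ m, ∑ n, up A a m * up A b n * w.1 m n =
      (if b = 0 then up A a 0 else 0) + if a = 0 then up A b 0 else 0 := by
    intro a b
    have e := sum_up_mul hx a 0
    simp only [mul_assoc, ← Finset.mul_sum, h2, mul_add, Finset.sum_add_distrib]
    congr 1
    · by_cases hb : b = 0 <;> simp [hb]
    · have : ∑ m, up A a m * (up A b 0 * A.1 m 0) = up A b 0 * ∑ m, up A a m * A.1 m 0 := by
        rw [Finset.mul_sum]
        exact Finset.sum_congr rfl fun m _ => by ring
      rw [this, e]
      simp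
  have h5 : einsteinPairing g x w = sqrtDet A * scalarCurvature g x
      - sqrtDet A * (2 * ∑ m, up A 0 m * ricci g m 0 x) := by
    have e1 : einsteinPairing g x w = sqrtDet A * ∑ m, ∑ n, up A m n * ricci g m n x
        - sqrtDet A * (∑ m, ∑ n, (if n = 0 then up A m 0 * ricci g m n x else 0)
          + ∑ m, ∑ n, if m = 0 then up A n 0 * ricci g m n x else 0) := by
      simp only [einsteinPairing, fderiv_gup hx, ← hA, h3, h4, mul_add, Finset.mul_sum,
        ← Finset.sum_add_distrib, ← Finset.sum_sub_distrib]
      refine Finset.sum_congr rfl fun m _ => Finset.sum_congr rfl fun n _ => ?_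
      split_ifs <;> ring
    rw [e1, scalarCurvature, ← hA]
    congr 2
    have e2 : ∑ m, ∑ n, (if m = 0 then up A n 0 * ricci g m n x else 0) =
        ∑ n, up A n 0 * ricci g 0 n x := by
      rw [Finset.sum_eq_single (0 : Fin 4)]
      · simp
      · intro b _ hb
        simp [hb]
      · simp
    rw [e2]
    simp only [Finset.sum_ite_eq', Finset.mem_univ, if_true, up_symm A _ 0,
      ricci_symm hg hx 0]
    ring
  rw [h5, einstein, ← hA]
  simp only [if_true]
  ring

end

section

/-! ### Minors of the metric and the angles -/

/-- Jacobi's complementary minor formula for principal minors. -/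
theorem det_mul_det_inv_minor (M : Matrix (Fin 4) (Fin 4) ℝ) (hM : M.det ≠ 0)
    (p : Fin 4 → Prop) [DecidablePred p] :
    M.det * (Matrix.of fun a b : {a // ¬p a} => M⁻¹ a b).det =
      (Matrix.of fun a b : {a // p a} => M a b).det := by
  set B : Matrix (Fin 4) (Fin 4) ℝ := Matrix.of fun a b =>
    if p b then (1 : Matrix (Fin 4) (Fin 4) ℝ) a b else M⁻¹ a b with hB
  have hMB : ∀ a b, (M * B) a b = if p b then M a b else (1 : Matrix (Fin 4) (Fin 4) ℝ) a b := by
    intro a b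
    rw [Matrix.mul_apply]
    by_cases hb : p b
    · simp only [hB, Matrix.of_apply, hb, if_true]
      rw [← Matrix.mul_apply, mul_one]
    · simp only [hB, Matrix.of_apply, hb, if_false]
      rw [← Matrix.mul_apply, Matrix.mul_nonsing_inv _ (isUnit_iff_ne_zero.2 hM)]
  have h1 : B.det = (Matrix.of fun a b : {a // ¬p a} => M⁻¹ a b).det := by
    rw [Matrix.twoBlockTriangular_det B p]
    · have e1 : Matrix.toSquareBlockProp B p = 1 := by
        ext a b
        simp [Matrix.toSquareBlockProp, hB, b.2, Matrix.one_apply, Subtype.ext_iff]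
      have e2 : Matrix.toSquareBlockProp B (fun i => ¬p i) =
          Matrix.of fun a b : {a // ¬p a} => M⁻¹ a b := by
        ext a b
        simp [Matrix.toSquareBlockProp, hB, b.2]
      rw [e1, e2, Matrix.det_one, one_mul]
    · intro i hi j hj
      have : i ≠ j := fun h => hi (h ▸ hj)
      simp [hB, hj, this]
  have h2 : (M * B).det = (Matrix.of fun a b : {a // p a} => M a b).det := by
    rw [Matrix.twoBlockTriangular_det' (M * B) p]
    · have e1 : Matrix.toSquareBlockProp (M * B) p = Matrix.of fun a b : {a // p a} => M a b := by
        ext a b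
        simp [Matrix.toSquareBlockProp, hMB, b.2]
      have e2 : Matrix.toSquareBlockProp (M * B) (fun i => ¬p i) = 1 := by
        ext a b
        simp [Matrix.toSquareBlockProp, hMB, b.2, Matrix.one_apply, Subtype.ext_iff]
      rw [e1, e2, Matrix.det_one, mul_one]
    · intro i hi j hj
      have : i ≠ j := fun h => hj (h ▸ hi)
      simp [hMB, hj, this]
  rw [← h1, ← Matrix.det_mul, h2]

variable {A : SymTensor}

theorem gamma1_eq (hA : (mat A).det ≠ 0) (μ : Fin 4) : gamma1 A μ = (mat A).det * up A μ μ := by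
  have h := det_mul_det_inv_minor (mat A) hA (fun a => a ≠ μ)
  rw [gamma1]
  refine Eq.trans h.symm ?_
  congr 1
  have hμ : ¬(μ ≠ μ) := by simp
  let i : Unique {a : Fin 4 // ¬a ≠ μ} := ⟨⟨⟨μ, hμ⟩⟩, fun a => Subtype.ext (not_not.1 a.2)⟩
  rw [Matrix.det_unique]
  rfl

theorem gamma2_eq (hA : (mat A).det ≠ 0) {μ ν : Fin 4} (h : μ ≠ ν) :
    gamma2 A μ ν = (mat A).det * (up A μ μ * up A ν ν - up A μ ν ^ 2) := by
  have hj := det_mul_det_inv_minor (mat A) hA (fun a => a ≠ μ ∧ a ≠ ν)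
  rw [gamma2]
  refine Eq.trans hj.symm ?_
  congr 1
  let e : Fin 2 ≃ {a : Fin 4 // ¬(a ≠ μ ∧ a ≠ ν)} :=
    Equiv.ofBijective ![⟨μ, by simp⟩, ⟨ν, by simp⟩] (by
      constructor
      · intro a b hab
        fin_cases a <;> fin_cases b <;> simp_all [Subtype.ext_iff]
      · rintro ⟨a, ha⟩
        by_cases h1 : a = μ
        · exact ⟨0, Subtype.ext h1.symm⟩
        · exact ⟨1, Subtype.ext (by by_contra h2; exact ha ⟨h1, fun h3 => h2 h3.symm⟩)⟩)
  rw [← Matrix.det_submatrix_equiv_self e, Matrix.det_fin_two]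
  change up A μ μ * up A ν ν - up A μ ν * up A ν μ = _
  rw [up_symm A ν μ]
  ring

/-- The open set of metrics for which the trace K Lagrangian is a smooth function. -/
def regular : Set SymTensor := {A | (mat A).det ≠ 0 ∧ up A 0 0 < 0 ∧
  (∀ i : Fin 3, 0 < up A i.succ i.succ) ∧ ∀ i j : Fin 3, i ≠ j → |q A i.succ j.succ| < 1}

theorem Admissible.mem_regular (h : Admissible A) : A ∈ regular := by
  obtain ⟨⟨P, hP, hA⟩, h2⟩ := h
  refine ⟨?_, h2⟩
  have hη : (mat minkowski).det ≠ 0 := by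
    have : mat minkowski = Matrix.diagonal sgn := by
      ext a b
      simp [mat, minkowski, Matrix.diagonal_apply]
    rw [this, Matrix.det_diagonal, Fin.prod_univ_four]
    simp [sgn]
  rw [hA, Matrix.det_mul, Matrix.det_mul, Matrix.det_transpose]
  exact mul_ne_zero (mul_ne_zero hP.ne_zero hη) hP.ne_zero

/-- `ξ(μ) ξ(ν) g^{μμ} g^{νν}`. -/
def diagProd (A : SymTensor) (μ ν : Fin 4) : ℝ := sgn μ * sgn ν * up A μ μ * up A ν ν

theorem q_eq (A : SymTensor) (μ ν : Fin 4) : q A μ ν = up A μ ν / √(diagProd A μ ν) := rfl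

theorem sgn_mul_up_pos (hA : A ∈ regular) (μ : Fin 4) : 0 < sgn μ * up A μ μ := by
  obtain rfl | ⟨i, rfl⟩ := Fin.eq_zero_or_eq_succ μ
  · simp only [sgn, if_true]
    linarith [hA.2.1]
  · simpa [sgn, Fin.succ_ne_zero] using hA.2.2.1 i

theorem up_diag_ne_zero (hA : A ∈ regular) (μ : Fin 4) : up A μ μ ≠ 0 :=
  right_ne_zero_of_mul (sgn_mul_up_pos hA μ).ne'

theorem diagProd_pos (hA : A ∈ regular) (μ ν : Fin 4) : 0 < diagProd A μ ν := by
  have := mul_pos (sgn_mul_up_pos hA μ) (sgn_mul_up_pos hA ν)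
  rw [diagProd]
  nlinarith

theorem contDiffAt_diagProd (hA : (mat A).det ≠ 0) (μ ν : Fin 4) :
    ContDiffAt ℝ ∞ (fun B => diagProd B μ ν) A :=
  (contDiffAt_const.mul (contDiffAt_up hA μ μ)).mul (contDiffAt_up hA ν ν)

theorem contDiffAt_q (hA : A ∈ regular) (μ ν : Fin 4) : ContDiffAt ℝ ∞ (fun B => q B μ ν) A := by
  simp only [q_eq]
  exact (contDiffAt_up hA.1 μ ν).div ((contDiffAt_diagProd hA.1 μ ν).sqrt
    (diagProd_pos hA μ ν).ne') (Real.sqrt_pos.2 (diagProd_pos hA μ ν)).ne'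

theorem isOpen_regular : IsOpen regular := by
  rw [isOpen_iff_mem_nhds]
  intro A hA
  have h1 := eventually_det_ne_zero hA.1
  have hc : ∀ μ ν, ContinuousAt (fun B => up B μ ν) A :=
    fun μ ν => (contDiffAt_up hA.1 μ ν (n := 0)).continuousAt
  have h2 := (hc 0 0).eventually_lt_const hA.2.1
  have h3 : ∀ᶠ B in 𝓝 A, ∀ i : Fin 3, 0 < up B i.succ i.succ :=
    eventually_all.2 fun i => (hc _ _).eventually_const_lt (hA.2.2.1 i)
  have h4 : ∀ᶠ B in 𝓝 A, ∀ i j : Fin 3, i ≠ j → |q B i.succ j.succ| < 1 :=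
    eventually_all.2 fun i => eventually_all.2 fun j => by
      by_cases hij : i = j
      · simp [hij]
      · filter_upwards [(contDiffAt_q hA i.succ j.succ).continuousAt.abs.eventually_lt_const
          (hA.2.2.2 i j hij)] with B hB _ using hB
  filter_upwards [h1, h2, h3, h4] with B b1 b2 b3 b4 using ⟨b1, b2, b3, b4⟩

/-- `1 + q²` when one of the indices is temporal and `1 - q²` when both are spatial. -/
def radicand (A : SymTensor) (μ ν : Fin 4) : ℝ :=
  if μ = 0 ∨ ν = 0 then 1 + q A μ ν ^ 2 else 1 - q A μ ν ^ 2

theorem abs_q_lt_one (hA : A ∈ regular) {μ ν : Fin 4} (h : μ ≠ ν) (h0 : ¬(μ = 0 ∨ ν = 0)) :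
    |q A μ ν| < 1 := by
  obtain ⟨i, rfl⟩ := Fin.exists_succ_eq.2 fun h => h0 (Or.inl h)
  obtain ⟨j, rfl⟩ := Fin.exists_succ_eq.2 fun h => h0 (Or.inr h)
  exact hA.2.2.2 i j fun hij => h (by rw [hij])

theorem radicand_pos (hA : A ∈ regular) {μ ν : Fin 4} (h : μ ≠ ν) : 0 < radicand A μ ν := by
  rw [radicand]
  split_ifs with h0
  · positivity
  · have := (sq_lt_one_iff_abs_lt_one _).2 (abs_q_lt_one hA h h0)
    linarith

theorem sqrt_gamma2 (hA : A ∈ regular) {μ ν : Fin 4} (h : μ ≠ ν) :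
    √|gamma2 A μ ν| = sqrtDet A * (√(diagProd A μ ν) * √(radicand A μ ν)) := by
  have hP := diagProd_pos hA μ ν
  have hR := radicand_pos hA h
  have hq : up A μ ν ^ 2 = q A μ ν ^ 2 * diagProd A μ ν := by
    rw [q_eq, div_pow, Real.sq_sqrt hP.le, div_mul_cancel₀ _ hP.ne']
  have hs : ∀ κ, κ ≠ 0 → sgn κ = 1 := fun κ hκ => by simp [sgn, hκ]
  have h1 : |up A μ μ * up A ν ν - up A μ ν ^ 2| = diagProd A μ ν * radicand A μ ν := by
    rw [hq, radicand]
    split_ifs with h0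
    · have e : up A μ μ * up A ν ν = -diagProd A μ ν := by
        rcases h0 with rfl | rfl
        · rw [diagProd, hs ν h.symm]; simp [sgn]
        · rw [diagProd, hs μ h]; simp [sgn]
      rw [e, abs_of_neg]
      · ring
      · nlinarith [sq_nonneg (q A μ ν)]
    · have e : up A μ μ * up A ν ν = diagProd A μ ν := by
        push Not at h0
        rw [diagProd, hs μ h0.1, hs ν h0.2]
        ring
      rw [radicand, if_neg h0] at hR
      rw [e, show diagProd A μ ν - q A μ ν ^ 2 * diagProd A μ ν =
        diagProd A μ ν * (1 - q A μ ν ^ 2) by ring, abs_of_pos (mul_pos hP hR)]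
  rw [gamma2_eq hA.1 h, abs_mul, h1, Real.sqrt_mul (abs_nonneg _), Real.sqrt_mul hP.le]
  rfl

theorem gamma2_ne_zero (hA : A ∈ regular) {μ ν : Fin 4} (h : μ ≠ ν) : gamma2 A μ ν ≠ 0 := by
  have h1 : 0 < √|gamma2 A μ ν| := by
    rw [sqrt_gamma2 hA h]
    exact mul_pos (sqrtDet_pos hA.1) (mul_pos (Real.sqrt_pos.2 (diagProd_pos hA μ ν))
      (Real.sqrt_pos.2 (radicand_pos hA h)))
  intro h0
  simp [h0] at h1

theorem contDiffAt_sqrt_gamma2 (hA : A ∈ regular) {μ ν : Fin 4} (h : μ ≠ ν) :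
    ContDiffAt ℝ ∞ (fun B => √|gamma2 B μ ν|) A := by
  have h1 : ContDiff ℝ ∞ fun B : SymTensor => gamma2 B μ ν :=
    contDiff_det fun a b => (entry a b).contDiff
  exact (h1.contDiffAt.abs (gamma2_ne_zero hA h)).sqrt (abs_ne_zero.2 (gamma2_ne_zero hA h))

/-- The two cases of the definition of the angle `α` have the same form of derivative. -/
theorem hasDerivAt_angle {t : ℝ} {c : Prop} [Decidable c] (hc : ¬c → |t| < 1) :
    HasDerivAt (fun s => if c then Real.arsinh s else Real.arcsin s)
      (√(if c then 1 + t ^ 2 else 1 - t ^ 2))⁻¹ t := by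
  by_cases h : c
  · simp only [h, if_true]
    exact Real.hasDerivAt_arsinh t
  · simp only [h, if_false]
    have := abs_lt.1 (hc h)
    simpa using Real.hasDerivAt_arcsin this.1.ne' this.2.ne

theorem contDiffAt_angle (hA : A ∈ regular) {μ ν : Fin 4} (h : μ ≠ ν) :
    ContDiffAt ℝ ∞ (fun B => angle B μ ν) A := by
  simp only [angle]
  by_cases h0 : μ = 0 ∨ ν = 0
  · simp only [h0, if_true]
    exact Real.contDiff_arsinh.contDiffAt.comp A (contDiffAt_q hA μ ν)
  · simp only [h0, if_false]
    have := abs_lt.1 (abs_q_lt_one hA h h0)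
    exact ContDiffAt.comp A (g := Real.arcsin) (Real.contDiffAt_arcsin this.1.ne' this.2.ne)
      (contDiffAt_q hA μ ν)

theorem contDiffAt_log_up (hA : A ∈ regular) (μ : Fin 4) :
    ContDiffAt ℝ ∞ (fun B => Real.log (up B μ μ)) A :=
  (contDiffAt_up hA.1 μ μ).log (up_diag_ne_zero hA μ)

theorem fderiv_log_up (hA : A ∈ regular) (μ : Fin 4) (w : SymTensor) :
    fderiv ℝ (fun B => Real.log (up B μ μ)) A w = fderiv ℝ (fun B => up B μ μ) A w / up A μ μ := by
  rw [fderiv.log ((contDiffAt_up hA.1 μ μ (n := 1)).differentiableAt (by simp))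
    (up_diag_ne_zero hA μ)]
  simp only [smul_apply, smul_eq_mul]
  ring

/-- The differential of the angle `α(μν)`, multiplied by the area density `√|γ(μν)|`: the square
roots cancel, and no angle is left. -/
theorem sqrt_gamma2_mul_fderiv_angle (hA : A ∈ regular) {μ ν : Fin 4} (h : μ ≠ ν)
    (w : SymTensor) :
    √|gamma2 A μ ν| * fderiv ℝ (fun B => angle B μ ν) A w =
      sqrtDet A * (fderiv ℝ (fun B => up B μ ν) A w - (1 / 2) * up A μ ν *
        (fderiv ℝ (fun B => Real.log (up B μ μ)) A w
          + fderiv ℝ (fun B => Real.log (up B ν ν)) A w)) := by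
  have hu : ∀ a b, HasFDerivAt (fun B => up B a b) (fderiv ℝ (fun B => up B a b) A) A :=
    fun a b => ((contDiffAt_up hA.1 a b (n := 1)).differentiableAt (by simp)).hasFDerivAt
  have hP := diagProd_pos hA μ ν
  have hsP := Real.sqrt_pos.2 hP
  have hsR := Real.sqrt_pos.2 (radicand_pos hA h)
  have hPd : HasFDerivAt (fun B => diagProd B μ ν) _ A :=
    ((hu μ μ).const_mul (sgn μ * sgn ν)).mul (hu ν ν)
  have hqd : HasFDerivAt (fun B => q B μ ν) _ A :=
    (hu μ ν).fun_mul ((hasDerivAt_inv hsP.ne').comp_hasFDerivAt A (hPd.sqrt hP.ne'))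
  have hαd : HasFDerivAt (fun B => angle B μ ν) _ A :=
    HasDerivAt.comp_hasFDerivAt
      (h₂ := fun s => if μ = 0 ∨ ν = 0 then Real.arsinh s else Real.arcsin s)
      (f := fun B => q B μ ν) A (hasDerivAt_angle fun h0 => abs_q_lt_one hA h h0) hqd
  have hdP : sgn μ * sgn ν * up A μ μ * up A ν ν = √(diagProd A μ ν) ^ 2 := by
    rw [Real.sq_sqrt hP.le]; rfl
  have hμ := up_diag_ne_zero hA μ
  have hν := up_diag_ne_zero hA ν
  rw [hαd.fderiv, sqrt_gamma2 hA h, fderiv_log_up hA, fderiv_log_up hA]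
  simp only [smul_apply, add_apply, smul_eq_mul]
  rw [← radicand, ← diagProd]
  set s := √(diagProd A μ ν) with hs
  set R := √(radicand A μ ν) with hR
  set a := up A μ μ
  set b := up A ν ν
  set u := up A μ ν
  have hsne : s ≠ 0 := hsP.ne'
  have hRne : R ≠ 0 := hsR.ne'
  field_simp
  linear_combination (-(sqrtDet A * u * (a * fderiv ℝ (fun B => up B ν ν) A w
    + b * fderiv ℝ (fun B => up B μ μ) A w))) * hdP

end

section

/-! ### The trace K Lagrangian in divergence form -/

theorem contDiffAt_smul_clm {W : Type*} [NormedAddCommGroup W] [NormedSpace ℝ W] {f : W → ℝ}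
    {h : W → W →L[ℝ] ℝ} {w : W} {n : WithTop ℕ∞} (hf : ContDiffAt ℝ n f w)
    (hh : ContDiffAt ℝ n h w) : ContDiffAt ℝ n (fun x => f x • h x) w :=
  hf.smul hh

/-- The 1-form `θ^{μa} = -α(μa) d√|γ(μa)| + ½ √|g| g^{μa} (d log g^{aa} - d log g^{μμ})` on the space
of metrics, for `μ ≠ a`; it is set to zero for `μ = a`. It is what is left
of the boundary terms of the trace K Lagrangian once the derivatives normal to the boundary are gone. -/
def theta (μ a : Fin 4) (A : SymTensor) : SymTensor →L[ℝ] ℝ :=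
  if μ = a then 0 else
    -(angle A μ a • fderiv ℝ (fun B => √|gamma2 B μ a|) A)
      + ((1 / 2) * gup A μ a) • (fderiv ℝ (fun B => Real.log (up B a a)) A
        - fderiv ℝ (fun B => Real.log (up B μ μ)) A)

theorem theta_self (μ : Fin 4) : theta μ μ = 0 := by
  funext A
  simp [theta]

theorem contDiffAt_theta_metric {A : SymTensor} (hA : A ∈ regular) (μ a : Fin 4) :
    ContDiffAt ℝ ∞ (theta μ a) A := by
  by_cases h : μ = a
  · subst h
    rw [theta_self]
    exact contDiffAt_const
  · have e : theta μ a = fun A => -(angle A μ a • fderiv ℝ (fun B => √|gamma2 B μ a|) A)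
      + ((1 / 2) * gup A μ a) • (fderiv ℝ (fun B => Real.log (up B a a)) A
        - fderiv ℝ (fun B => Real.log (up B μ μ)) A) := by
      funext A
      rw [theta, if_neg h]
    rw [e]
    have h1 : ∀ κ, ContDiffAt ℝ ∞ (fderiv ℝ (fun B => Real.log (up B κ κ))) A := fun κ =>
      (contDiffAt_log_up hA κ).fderiv_right (m := ∞) (by simp)
    have h2 : ContDiffAt ℝ ∞ (fderiv ℝ (fun B => √|gamma2 B μ a|)) A :=
      (contDiffAt_sqrt_gamma2 hA h).fderiv_right (m := ∞) (by simp)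
    exact ((contDiffAt_smul_clm (contDiffAt_angle hA h) h2).neg).add
      (contDiffAt_smul_clm (contDiffAt_const.mul (contDiffAt_gup hA.1 μ a)) ((h1 a).sub (h1 μ)))

section Field

variable {g : Spacetime → SymTensor} {x : Spacetime}

theorem eventually_regular (hg : ContDiff ℝ ∞ g) (hx : g x ∈ regular) :
    ∀ᶠ y in 𝓝 x, g y ∈ regular :=
  hg.continuous.continuousAt.eventually (isOpen_regular.mem_nhds hx)

/-- `√|γ(μ)| K(μ) = - √|g| γ^{ab}(μ) Γ^μ_{ab}`. -/
theorem sqrt_gamma1_mul_extrinsicTrace (hx : g x ∈ regular) (μ : Fin 4) :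
    √|gamma1 (g x) μ| * extrinsicTrace g μ x =
      -(sqrtDet (g x) * ∑ a, ∑ b, gammaUp (g x) μ a b * christoffel g μ a b x) := by
  have h1 : √|gamma1 (g x) μ| = sqrtDet (g x) * √|up (g x) μ μ| := by
    rw [gamma1_eq hx.1, abs_mul, Real.sqrt_mul (abs_nonneg _)]
    rfl
  have h2 : √|up (g x) μ μ| ≠ 0 :=
    (Real.sqrt_pos.2 (abs_pos.2 (up_diag_ne_zero hx μ))).ne'
  rw [h1, extrinsicTrace, mul_assoc, ← mul_neg, Finset.mul_sum, ← Finset.sum_neg_distrib]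
  congr 1
  refine Finset.sum_congr rfl fun a _ => ?_
  rw [Finset.mul_sum, ← Finset.sum_neg_distrib]
  refine Finset.sum_congr rfl fun b _ => ?_
  field_simp

/-- `∂_a log g^{μμ} = - 2 g^{μb} Γ^μ_{ab} / g^{μμ}`. -/
theorem pd_log_up (hg : ContDiff ℝ ∞ g) (hx : g x ∈ regular) (μ a : Fin 4) :
    pd a (fun y => Real.log (up (g y) μ μ)) x =
      -2 * (∑ b, up (g x) μ b * christoffel g μ a b x) / up (g x) μ μ := by
  rw [pd_comp (h := Real.log) (Real.differentiableAt_log (up_diag_ne_zero hx μ))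
    ((contDiffAt_up_field hg hx.1 μ μ).differentiableAt (by simp)), pd_up hg hx.1,
    Finset.sum_add_distrib]
  simp
  ring

theorem sum_gammaUp_mul_christoffel (hg : ContDiff ℝ ∞ g) (hx : g x ∈ regular) (μ : Fin 4) :
    ∑ a, ∑ b, gammaUp (g x) μ a b * christoffel g μ a b x =
      ∑ a, ∑ b, up (g x) a b * christoffel g μ a b x
      + (1 / 2) * ∑ a, up (g x) μ a * pd a (fun y => Real.log (up (g y) μ μ)) x := by
  rw [Finset.mul_sum, ← Finset.sum_add_distrib]
  refine Finset.sum_congr rfl fun a _ => ?_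
  rw [pd_log_up hg hx, Finset.mul_sum, Finset.sum_div, Finset.mul_sum, Finset.mul_sum,
    ← Finset.sum_add_distrib]
  refine Finset.sum_congr rfl fun b _ => ?_
  rw [gammaUp, up_symm (g x) a μ]
  ring

/-- The boundary terms of the trace K Lagrangian remove every derivative normal to the boundary:
the sum of the divergence part of `√|g| R` in the direction `μ`, of `2 √|γ(μ)| K(μ)` and of the angle
terms only contains the derivatives `∂_a g` with `a ≠ μ`. -/
theorem boundary_terms (hg : ContDiff ℝ ∞ g) (hx : g x ∈ regular) (μ : Fin 4) :
    gupTrace (g x) (fun a b c => christoffel g a b c x) μ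
      + 2 * (√|gamma1 (g x) μ| * extrinsicTrace g μ x)
      - ∑ a, (if μ = a then 0 else pd a (fun y => √|gamma2 (g y) μ a| * angle (g y) μ a) x) =
    ∑ a, theta μ a (g x) (pd a g x) := by
  have hgd : DifferentiableAt ℝ g x := hg.differentiable (by simp) x
  have hlog : ∀ κ a, pd a (fun y => Real.log (up (g y) κ κ)) x =
      fderiv ℝ (fun B => Real.log (up B κ κ)) (g x) (pd a g x) := fun κ a =>
    pd_comp (h := fun B => Real.log (up B κ κ))
      ((contDiffAt_log_up hx κ).differentiableAt (by simp)) hgd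
  have hup : ∀ m n a, pd a (fun y => up (g y) m n) x =
      fderiv ℝ (fun B => up B m n) (g x) (pd a g x) := fun m n a =>
    pd_comp (h := fun B => up B m n)
      ((contDiffAt_up hx.1 m n (n := 1)).differentiableAt (by simp)) hgd
  -- the derivatives of `√|g|` cancel, only those of `g^{μa}` are left
  have h1 : gupTrace (g x) (fun a b c => christoffel g a b c x) μ
      + 2 * (√|gamma1 (g x) μ| * extrinsicTrace g μ x) =
      ∑ a, sqrtDet (g x) * (pd a (fun y => up (g y) μ a) x
        - up (g x) μ a * pd a (fun y => Real.log (up (g y) μ μ)) x) := by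
    have e1 := sum_pd_gup hg hx.1 μ
    have e2 : ∀ b, pd b (fun y => gup (g y) μ b) x = sqrtDet (g x) * pd b (fun y => up (g y) μ b) x
        + up (g x) μ b * pd b (fun y => sqrtDet (g y)) x := by
      intro b
      simp only [gup]
      rw [pd_mul ((contDiffAt_sqrtDet_field hg hx.1).differentiableAt (by simp))
        ((contDiffAt_up_field hg hx.1 μ b).differentiableAt (by simp))]
      ring
    have e3 : ∑ m, gup (g x) m μ * ∑ s, christoffel g s m s x =
        ∑ b, up (g x) μ b * pd b (fun y => sqrtDet (g y)) x :=
      Finset.sum_congr rfl fun m _ => by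
        rw [pd_sqrtDet hg hx.1, gup, up_symm (g x) m μ]
        ring
    have e4 : ∑ a, ∑ b, gup (g x) a b * christoffel g μ a b x =
        sqrtDet (g x) * ∑ a, ∑ b, up (g x) a b * christoffel g μ a b x := by
      simp only [gup, Finset.mul_sum, mul_assoc]
    rw [sqrt_gamma1_mul_extrinsicTrace hx, sum_gammaUp_mul_christoffel hg hx, gupTrace, e3, e4]
    rw [e4] at e1
    simp only [e2, Finset.sum_add_distrib] at e1
    simp only [mul_sub, Finset.sum_sub_distrib, ← Finset.mul_sum] at e1 ⊢
    linear_combination -e1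
  rw [h1, ← Finset.sum_sub_distrib]
  refine Finset.sum_congr rfl fun a _ => ?_
  by_cases h : μ = a
  · -- the derivative normal to the boundary: `∂_μ g^{μμ} - g^{μμ} ∂_μ log g^{μμ} = 0`
    subst h
    have h0 := up_diag_ne_zero hx μ
    rw [theta_self, if_pos rfl, hlog, fderiv_log_up hx, hup]
    simp only [Pi.zero_apply, zero_apply]
    field_simp
    ring
  · have hγ : pd a (fun y => √|gamma2 (g y) μ a|) x =
        fderiv ℝ (fun B => √|gamma2 B μ a|) (g x) (pd a g x) :=
      pd_comp (h := fun B => √|gamma2 B μ a|)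
        ((contDiffAt_sqrt_gamma2 hx h).differentiableAt (by simp)) hgd
    have hα : pd a (fun y => angle (g y) μ a) x =
        fderiv ℝ (fun B => angle B μ a) (g x) (pd a g x) :=
      pd_comp (h := fun B => angle B μ a)
        ((contDiffAt_angle hx h).differentiableAt (by simp)) hgd
    have c1 : DifferentiableAt ℝ (fun y => √|gamma2 (g y) μ a|) x :=
      (ContDiffAt.comp x (g := fun B => √|gamma2 B μ a|) (contDiffAt_sqrt_gamma2 hx h)
        hg.contDiffAt).differentiableAt (by simp)
    have c2 : DifferentiableAt ℝ (fun y => angle (g y) μ a) x :=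
      (ContDiffAt.comp x (g := fun B => angle B μ a) (contDiffAt_angle hx h)
        hg.contDiffAt).differentiableAt (by simp)
    rw [if_neg h, pd_mul c1 c2, hγ, hα, sqrt_gamma2_mul_fderiv_angle hx h, theta, if_neg h,
      hlog, hup, gup]
    simp only [add_apply, neg_apply, smul_apply, sub_apply, smul_eq_mul]
    ring

/-- The trace K Lagrangian is the first order Lagrangian of general relativity plus divergences of
terms `θ^{μa}(g)(∂_a g)` with `a ≠ μ`. -/
theorem traceK_eq (hg : ContDiff ℝ ∞ g) (hx : g x ∈ regular) :
    traceK g x = gammaLagrangian (g x, grad g x)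
      + ∑ μ, ∑ a, pd μ (fun y => theta μ a (g y) (pd a g y)) x := by
  have hT : ∀ r, DifferentiableAt ℝ
      (fun y => gupTrace (g y) (fun a b c => christoffel g a b c y) r) x := fun r =>
    (ContDiffAt.comp x (g := chrTrace r) (f := fun y => (g y, grad g y))
      (contDiffAt_chrTrace (p := (g x, grad g x)) hx.1 r) (contDiffAt_pair hg)).differentiableAt
      (by simp)
  have hK : ∀ μ, DifferentiableAt ℝ (fun y => √|gamma1 (g y) μ| * extrinsicTrace g μ y) x := by
    intro μ
    have e : (fun y => √|gamma1 (g y) μ| * extrinsicTrace g μ y) =ᶠ[𝓝 x] fun y =>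
        -(sqrtDet (g y) * ∑ a, ∑ b, gammaUp (g y) μ a b * christoffel g μ a b y) := by
      filter_upwards [eventually_regular hg hx] with y hy
      exact sqrt_gamma1_mul_extrinsicTrace hy μ
    refine DifferentiableAt.congr_of_eventuallyEq ?_ e
    have hu : ∀ m n, ContDiffAt ℝ ∞ (fun y => up (g y) m n) x := contDiffAt_up_field hg hx.1
    have hc : ∀ a b, ContDiffAt ℝ ∞ (christoffel g μ a b) x :=
      fun a b => contDiffAt_christoffel hg hx.1 μ a b
    have hγ : ∀ a b, ContDiffAt ℝ ∞ (fun y => gammaUp (g y) μ a b) x := fun a b =>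
      (hu a b).sub (((hu a μ).mul (hu μ b)).div (hu μ μ) (up_diag_ne_zero hx μ))
    exact (((contDiffAt_sqrtDet_field hg hx.1).mul (ContDiffAt.sum fun a _ => ContDiffAt.sum
      fun b _ => (hγ a b).mul (hc a b))).neg).differentiableAt (by simp)
  have hA : ∀ μ a, DifferentiableAt ℝ (fun z => if μ = a then 0 else
      pd a (fun y => √|gamma2 (g y) μ a| * angle (g y) μ a) z) x := by
    intro μ a
    by_cases h : μ = a
    · simp [h]
    · simp only [h, if_false]
      exact (contDiffAt_pd_top ((ContDiffAt.comp x (g := fun B => √|gamma2 B μ a|)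
        (contDiffAt_sqrt_gamma2 hx h) hg.contDiffAt).mul (ContDiffAt.comp x
        (g := fun B => angle B μ a) (contDiffAt_angle hx h) hg.contDiffAt))).differentiableAt
        (by simp)
  have hθ : ∀ μ a, DifferentiableAt ℝ (fun y => theta μ a (g y) (pd a g y)) x := fun μ a =>
    (ContDiffAt.clm_apply (ContDiffAt.comp x (contDiffAt_theta_metric hx μ a) hg.contDiffAt)
      (contDiffAt_pd_top hg.contDiffAt)).differentiableAt (by simp)
  have h1 : ∀ μ, ∑ a, pd μ (fun y => theta μ a (g y) (pd a g y)) x =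
      pd μ (fun y => gupTrace (g y) (fun a b c => christoffel g a b c y) μ) x
      + 2 * pd μ (fun y => √|gamma1 (g y) μ| * extrinsicTrace g μ y) x
      - ∑ a, (if μ = a then 0 else
        pd μ (pd a (fun y => √|gamma2 (g y) μ a| * angle (g y) μ a)) x) := by
    intro μ
    rw [← pd_sum fun a _ => hθ μ a, ← pd_const_mul _ (hK μ), ← pd_add (hT μ) ((hK μ).const_mul _)]
    have e : ∀ a, (if μ = a then 0 else
        pd μ (pd a (fun y => √|gamma2 (g y) μ a| * angle (g y) μ a)) x) =
        pd μ (fun z => if μ = a then 0 else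
          pd a (fun y => √|gamma2 (g y) μ a| * angle (g y) μ a) z) x := by
      intro a
      by_cases h : μ = a <;> simp [h]
    simp only [e]
    rw [← pd_sum fun a _ => hA μ a, ← pd_sub ((hT μ).fun_add ((hK μ).const_mul _))
      (.fun_sum fun a _ => hA μ a)]
    refine pd_congr ?_
    filter_upwards [eventually_regular hg hx] with y hy
    exact (boundary_terms hg hy μ).symm
  rw [traceK, scalarCurvature_eq hg hx.1]
  simp only [h1, Finset.sum_add_distrib, Finset.sum_sub_distrib, Finset.mul_sum]
  ring

end Field

/-! ### The Lagrangian on jets -/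

section Quadratic

variable {W : Type*} [NormedAddCommGroup W] [NormedSpace ℝ W] (j : Jet W)

theorem contDiff_quadraticField : ContDiff ℝ ∞ (quadraticField j) := by
  unfold quadraticField
  fun_prop

theorem quadraticField_zero : quadraticField j 0 = j.1 := by
  simp [quadraticField]

theorem pd_coord_smul (μ κ : Fin 4) (w : W) (y : Spacetime) :
    pd κ (fun z : Spacetime => z μ • w) y = if κ = μ then w else 0 := by
  have h1 : pd κ (fun z : Spacetime => z μ) y = if κ = μ then 1 else 0 := by
    simpa using pd_coord_sub (x := y) (μ := μ) (ν := κ) 0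
  rw [pd_smul (by fun_prop) (differentiableAt_const _), h1]
  simp

theorem pd_quadraticField (κ : Fin 4) (y : Spacetime) :
    pd κ (quadraticField j) y = j.2.1 κ + (1 / 2 : ℝ) • ∑ ν, y ν • (j.2.2 κ ν + j.2.2 ν κ) := by
  have hc : ∀ μ, pd κ (fun z : Spacetime => z μ) y = if κ = μ then 1 else 0 := fun μ => by
    simpa using pd_coord_sub (x := y) (μ := μ) (ν := κ) 0
  have h2 : ∀ μ ν, pd κ (fun z : Spacetime => (z μ * z ν) • j.2.2 μ ν) y =
      (if κ = ν then y μ • j.2.2 μ ν else 0) + if κ = μ then y ν • j.2.2 μ ν else 0 := by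
    intro μ ν
    rw [pd_smul (by fun_prop) (differentiableAt_const _), pd_mul (by fun_prop) (by fun_prop),
      hc, hc, pd_const, smul_zero, zero_add, add_smul]
    congr 1 <;> split_ifs <;> simp
  unfold quadraticField
  rw [pd_add (by fun_prop) (by fun_prop), pd_add (by fun_prop) (by fun_prop), pd_const,
    pd_const_smul _ (by fun_prop), pd_sum (fun _ _ => by fun_prop),
    pd_sum (fun _ _ => by fun_prop), zero_add]
  congr 1
  · simp [pd_coord_smul]
  · congr 1
    have e : ∀ μ, pd κ (fun z : Spacetime => ∑ ν, (z μ * z ν) • j.2.2 μ ν) y =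
        y μ • j.2.2 μ κ + if κ = μ then ∑ ν, y ν • j.2.2 μ ν else 0 := by
      intro μ
      rw [pd_sum (fun _ _ => by fun_prop)]
      simp only [h2, Finset.sum_add_distrib]
      congr 1
      · simp
      · split_ifs <;> simp
    simp only [e, Finset.sum_add_distrib, smul_add, Finset.sum_ite_eq, Finset.mem_univ, if_true]
    rw [add_comm]

theorem pd_quadraticField_zero (κ : Fin 4) : pd κ (quadraticField j) 0 = j.2.1 κ := by
  simp [pd_quadraticField]

/-- Second derivatives see the symmetric part of a jet only, as `divJet` does. -/
theorem pd_pd_quadraticField_zero (μ κ : Fin 4) :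
    pd μ (pd κ (quadraticField j)) 0 = (1 / 2 : ℝ) • (j.2.2 μ κ + j.2.2 κ μ) := by
  rw [funext (pd_quadraticField j κ), pd_add (by fun_prop) (by fun_prop), pd_const, zero_add,
    pd_const_smul _ (by fun_prop), pd_sum (fun _ _ => by fun_prop)]
  congr 1
  have e : ∀ ν, pd μ (fun z : Spacetime => z ν • (j.2.2 κ ν + j.2.2 ν κ)) 0 =
      if μ = ν then j.2.2 κ ν + j.2.2 ν κ else 0 := fun ν => pd_coord_smul _ _ _ _
  simp [e, -smul_add, add_comm]

end Quadratic

/-- The trace K Lagrangian has divergence form: on a jet it is by definition evaluated on the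
quadratic field with this jet at the origin. -/
theorem lagrangianK_hasDivergenceForm :
    HasDivergenceForm lagrangianK gammaLagrangian theta {p | (mat p.1).det ≠ 0} regular where
  isOpen_fst := by
    have : Continuous fun p : SymTensor × (Fin 4 → SymTensor) => (mat p.1).det :=
      (contDiff_det_mat (n := 0)).continuous.comp continuous_fst
    exact isOpen_ne_fun this continuous_const
  isOpen_snd := isOpen_regular
  contDiffOn_fst := fun _ hp => (contDiffAt_gammaLagrangian hp).contDiffWithinAt
  contDiffOn_snd := fun μ a _ hA => (contDiffAt_theta_metric hA μ a).contDiffWithinAt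
  diag := theta_self
  eq := by
    intro j _ hj
    have h0 := quadraticField_zero j
    have hr : quadraticField j 0 ∈ regular := by rwa [h0]
    have hq := contDiff_quadraticField j
    rw [lagrangianK, traceK_eq hq hr]
    have h1 : grad (quadraticField j) 0 = j.2.1 := funext (pd_quadraticField_zero j)
    rw [h0, h1]
    congr 1
    refine Finset.sum_congr rfl fun μ _ => Finset.sum_congr rfl fun a _ => ?_
    rw [pd_oneForm (contDiffAt_theta_metric hr μ a) hq.contDiffAt
      ((contDiffAt_pd_top hq.contDiffAt).differentiableAt (by simp)), h0, divJet,
      pd_quadraticField_zero, pd_quadraticField_zero, pd_pd_quadraticField_zero]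

end

section

/-! ### The energy density of the trace K Lagrangian -/

variable {g : Spacetime → SymTensor} {x : Spacetime}

/-- The Komar superpotential of `∂_t` cancels the temporal terms of the contractions in `gupTrace`, so that
only the sum over spatial `j` is left. -/
theorem gammaSuperpotential_eq (g : Spacetime → SymTensor) (i : Fin 3) (y : Spacetime) :
    gammaSuperpotential g i y = ∑ j : Fin 3, ∑ m, (gup (g y) m j.succ * christoffel g i.succ j.succ m y
      - gup (g y) m i.succ * christoffel g j.succ j.succ m y) := by
  have e1 : ∑ m, ∑ n, gup (g y) m n * christoffel g i.succ m n y =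
      ∑ m, gup (g y) m 0 * christoffel g i.succ 0 m y
      + ∑ j : Fin 3, ∑ m, gup (g y) m j.succ * christoffel g i.succ j.succ m y := by
    rw [Finset.sum_comm, Fin.sum_univ_succ]
    congr 1
    · exact Finset.sum_congr rfl fun m _ => by rw [christoffel_symm]
    · exact Finset.sum_congr rfl fun j _ => Finset.sum_congr rfl fun m _ => by
        rw [christoffel_symm]
  have e2 : ∑ m, gup (g y) m i.succ * ∑ s, christoffel g s m s y =
      ∑ m, gup (g y) m i.succ * christoffel g 0 0 m y
      + ∑ j : Fin 3, ∑ m, gup (g y) m i.succ * christoffel g j.succ j.succ m y := by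
    rw [Finset.sum_comm, ← Finset.sum_add_distrib]
    refine Finset.sum_congr rfl fun m _ => ?_
    rw [Fin.sum_univ_succ, mul_add, Finset.mul_sum, christoffel_symm g 0 m 0]
    congr 1
    exact Finset.sum_congr rfl fun j _ => by rw [christoffel_symm]
  rw [gammaSuperpotential, gupTrace, komar, e1, e2]
  simp only [Finset.sum_sub_distrib]
  ring

/-- The terms by which `γ^{ab}(κ)` differs from `g^{ab}` in the superpotential are derivatives of
`log g^{κκ}`. -/
theorem sum_christoffel_mul_up (hg : ContDiff ℝ ∞ g) (hx : g x ∈ regular) (κ a : Fin 4) :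
    ∑ m, christoffel g κ a m x * up (g x) m κ =
      -(1 / 2) * up (g x) κ κ * pd a (fun y => Real.log (up (g y) κ κ)) x := by
  have h0 := up_diag_ne_zero hx κ
  have e : ∑ b, up (g x) κ b * christoffel g κ a b x = ∑ m, christoffel g κ a m x * up (g x) m κ :=
    Finset.sum_congr rfl fun m _ => by rw [up_symm, mul_comm]
  rw [pd_log_up hg hx, e]
  field_simp

/-- The superpotential is the one of the first order Lagrangian minus the divergence part of the
trace K Lagrangian. -/
theorem superpotential_eq (hg : ContDiff ℝ ∞ g) (hx : g x ∈ regular) (i : Fin 3) :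
    superpotential g i x = gammaSuperpotential g i x
      - ∑ j : Fin 3, theta i.succ j.succ (g x) (pd j.succ g x) := by
  have hgd : DifferentiableAt ℝ g x := hg.differentiable (by simp) x
  rw [superpotential, gammaSuperpotential_eq, ← Finset.sum_sub_distrib]
  refine Finset.sum_congr rfl fun j _ => ?_
  have hi := up_diag_ne_zero hx i.succ
  have hj := up_diag_ne_zero hx j.succ
  have e1 := sum_christoffel_mul_up hg hx i.succ j.succ
  have e2 := sum_christoffel_mul_up hg hx j.succ j.succ
  have e3 : sqrtDet (g x) * ∑ m, (christoffel g i.succ j.succ m x * gammaUp (g x) i.succ m j.succ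
      - christoffel g j.succ j.succ m x * gammaUp (g x) j.succ m i.succ) =
      ∑ m, (gup (g x) m j.succ * christoffel g i.succ j.succ m x
        - gup (g x) m i.succ * christoffel g j.succ j.succ m x)
      - sqrtDet (g x) * (up (g x) i.succ j.succ / up (g x) i.succ i.succ
          * ∑ m, christoffel g i.succ j.succ m x * up (g x) m i.succ
        - up (g x) i.succ j.succ / up (g x) j.succ j.succ
          * ∑ m, christoffel g j.succ j.succ m x * up (g x) m j.succ) := by
    simp only [Finset.mul_sum, ← Finset.sum_sub_distrib]
    refine Finset.sum_congr rfl fun m _ => ?_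
    rw [gammaUp, gammaUp, gup, gup, up_symm (g x) j.succ i.succ]
    ring
  have hlog : ∀ κ a, pd a (fun y => Real.log (up (g y) κ κ)) x =
      fderiv ℝ (fun B => Real.log (up B κ κ)) (g x) (pd a g x) := fun κ a =>
    pd_comp (h := fun B => Real.log (up B κ κ))
      ((contDiffAt_log_up hx κ).differentiableAt (by simp)) hgd
  rw [e3, e1, e2, hlog, hlog]
  by_cases h : i = j
  · subst h
    simp only [if_true, theta_self, Pi.zero_apply, zero_apply]
    ring
  · have h' : i.succ ≠ j.succ := fun h' => h (Fin.succ_injective _ h')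
    have hγ : pd j.succ (fun y => √|gamma2 (g y) i.succ j.succ|) x =
        fderiv ℝ (fun B => √|gamma2 B i.succ j.succ|) (g x) (pd j.succ g x) :=
      pd_comp (h := fun B => √|gamma2 B i.succ j.succ|)
        ((contDiffAt_sqrt_gamma2 hx h').differentiableAt (by simp)) hgd
    rw [if_neg h, theta, if_neg h', hγ]
    simp only [add_apply, neg_apply, smul_apply, sub_apply, smul_eq_mul, gup]
    field_simp
    ring

theorem contDiffAt_gammaSuperpotential (hg : ContDiff ℝ ∞ g) (hx : g x ∈ regular) (i : Fin 3) :
    ContDiffAt ℝ ∞ (gammaSuperpotential g i) x := by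
  rw [funext (gammaSuperpotential_eq g i)]
  exact ContDiffAt.sum fun j _ => ContDiffAt.sum fun m _ =>
    ((contDiffAt_gup_field hg hx.1 _ _).mul (contDiffAt_christoffel hg hx.1 _ _ _)).sub
    ((contDiffAt_gup_field hg hx.1 _ _).mul (contDiffAt_christoffel hg hx.1 _ _ _))

theorem contDiffAt_theta_field (hg : ContDiff ℝ ∞ g) (hx : g x ∈ regular) (μ a : Fin 4) :
    ContDiffAt ℝ ∞ (fun y => theta μ a (g y) (pd a g y)) x :=
  ContDiffAt.clm_apply (ContDiffAt.comp x (g := theta μ a) (contDiffAt_theta_metric hx μ a) hg.contDiffAt)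
    (contDiffAt_pd_top hg.contDiffAt)

theorem contDiff_superpotential (hg : ContDiff ℝ ∞ g) (hr : ∀ x, g x ∈ regular) (i : Fin 3) :
    ContDiff ℝ ∞ (superpotential g i) := by
  rw [funext fun x => superpotential_eq hg (hr x) i]
  exact contDiff_iff_contDiffAt.2 fun x => (contDiffAt_gammaSuperpotential hg (hr x) i).sub
    (ContDiffAt.sum fun j _ => contDiffAt_theta_field hg (hr x) _ _)

/-- The energy density of the first order Lagrangian and the spatial divergences of the trace K
Lagrangian add up to `2 G_0^0` and the divergence of the superpotential. -/
theorem gammaLagrangian_energy_sub (hg : ContDiff ℝ ∞ g) (hr : ∀ x, g x ∈ regular)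
    (x : Spacetime) :
    fderiv ℝ gammaLagrangian (g x, grad g x) (0, Pi.single 0 (pd 0 g x))
      - gammaLagrangian (g x, grad g x)
      - ∑ i : Fin 3, pd i.succ (fun y => ∑ j : Fin 3, theta i.succ j.succ (g y) (pd j.succ g y)) x =
    2 * einstein g 0 0 x + ∑ i : Fin 3, pd i.succ (superpotential g i) x := by
  have h : ∀ i : Fin 3, pd i.succ (superpotential g i) x = pd i.succ (gammaSuperpotential g i) x
      - pd i.succ (fun y => ∑ j : Fin 3, theta i.succ j.succ (g y) (pd j.succ g y)) x := by
    intro i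
    rw [funext fun x => superpotential_eq hg (hr x) i]
    exact pd_sub ((contDiffAt_gammaSuperpotential hg (hr x) i).differentiableAt (by simp))
      ((ContDiffAt.sum fun j _ => contDiffAt_theta_field hg (hr x) _ _).differentiableAt (by simp))
  rw [gammaLagrangian_energy hg (hr x).1]
  simp only [h, Finset.sum_sub_distrib]
  ring

theorem energyDensity_lagrangianK (hg : ContDiff ℝ ∞ g) (hr : ∀ x, g x ∈ regular)
    (x : Spacetime) : energyDensity lagrangianK g x =
      2 * einstein g 0 0 x + ∑ i : Fin 3, pd i.succ (superpotential g i) x := by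
  rw [lagrangianK_hasDivergenceForm.energyDensity_eq hg (fun x => (hr x).1) hr,
    gammaLagrangian_energy_sub hg hr]

theorem eulerLagrange_lagrangianK (hg : ContDiff ℝ ∞ g) (hr : ∀ x, g x ∈ regular)
    (x : Spacetime) (w : SymTensor) :
    eulerLagrange lagrangianK g x w = einsteinPairing g x w := by
  rw [lagrangianK_hasDivergenceForm.eulerLagrange_eq hg (fun x => (hr x).1) hr,
    gammaLagrangian_eulerLagrange hg (hr x).1]

/-- The equation of motion tested with `timeLowering`. -/
theorem einstein_eq_zero_of_onShell (hg : ContDiff ℝ ∞ g) (hr : ∀ x, g x ∈ regular)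
    (h : OnShell lagrangianK g) (x : Spacetime) : einstein g 0 0 x = 0 := by
  have h1 := h x (timeLowering (g x))
  rw [eulerLagrange_lagrangianK hg hr, einsteinPairing_timeLowering hg (hr x).1] at h1
  linarith

end

section

/-! ### The divergence theorem on coordinate balls -/

/-- The unit sphere of the coordinate space of a slice. -/
abbrev UnitSphere := Metric.sphere (0 : Space) 1

/-- Euclidean surface measure on the unit sphere. -/
abbrev sphereMeasure : Measure UnitSphere := (volume : Measure Space).toSphere

theorem norm_smul_sphere {r : ℝ} (hr : 0 < r) (n : UnitSphere) : ‖r • (n : Space)‖ = r := by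
  rw [norm_smul, norm_eq_of_mem_sphere n, mul_one, Real.norm_of_nonneg hr.le]

/-- Integration in polar coordinates. -/
theorem integral_polar {h : Space → ℝ} (hh : Integrable h) :
    ∫ x, h x = ∫ r in Set.Ioi (0 : ℝ), r ^ 2 * ∫ n : UnitSphere, h (r • (n : Space))
      ∂sphereMeasure := by
  have hdim : Module.finrank ℝ Space - 1 = 2 := by simp
  have hmp := (volume : Measure Space).measurePreserving_homeomorphUnitSphereProd
  rw [hdim] at hmp
  have hemb := (homeomorphUnitSphereProd Space).measurableEmbedding
  set H : UnitSphere × Set.Ioi (0 : ℝ) → ℝ := fun p => h ((p.2 : ℝ) • (p.1 : Space)) with hH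
  have hcomp : ∀ x : ({(0)}ᶜ : Set Space), H (homeomorphUnitSphereProd Space x) = h x := by
    intro x
    rw [hH]
    simp only
    congr 1
    exact congrArg Subtype.val ((homeomorphUnitSphereProd Space).symm_apply_apply x)
  have hmeas : MeasurableSet ({(0)}ᶜ : Set Space) := (measurableSet_singleton _).compl
  have hint : Integrable H (sphereMeasure.prod (Measure.volumeIoiPow 2)) := by
    rw [← hmp.integrable_comp_emb hemb]
    have : H ∘ homeomorphUnitSphereProd Space = fun x : ({(0)}ᶜ : Set Space) => h x :=
      funext hcomp
    rw [this]
    have h2 : IntegrableOn h ({(0)}ᶜ : Set Space) := hh.integrableOn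
    rwa [integrableOn_iff_comap_subtypeVal hmeas] at h2
  calc ∫ x, h x = ∫ x : ({(0)}ᶜ : Set Space), h x ∂((volume : Measure Space).comap (↑)) := by
        rw [integral_subtype_comap hmeas fun x => h x, restrict_compl_singleton]
    _ = ∫ p, H p ∂(sphereMeasure.prod (Measure.volumeIoiPow 2)) := by
        rw [← hmp.integral_comp hemb]
        simp only [hcomp]
    _ = ∫ r, ∫ n, H (n, r) ∂sphereMeasure ∂(Measure.volumeIoiPow 2) :=
        integral_prod_symm _ hint
    _ = _ := by
        simp only [Measure.volumeIoiPow, ENNReal.ofReal]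
        rw [integral_withDensity_eq_integral_smul,
          integral_subtype_comap measurableSet_Ioi fun a : ℝ => Real.toNNReal (a ^ 2) •
            ∫ n : UnitSphere, h (a • (n : Space)) ∂sphereMeasure,
          setIntegral_congr_fun measurableSet_Ioi fun x hx => ?_]
        · rw [NNReal.smul_def, Real.coe_toNNReal _ (by positivity)]; rfl
        · exact (measurable_subtype_coe.pow_const _).real_toNNReal

/-- Integration over a ball in polar coordinates. -/
theorem integral_ball_polar {h : Space → ℝ} (hh : Continuous h) {r : ℝ} (hr : 0 ≤ r) :
    ∫ x in Metric.ball (0 : Space) r, h x =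
      ∫ s in (0)..r, s ^ 2 * ∫ n : UnitSphere, h (s • (n : Space)) ∂sphereMeasure := by
  have hint : Integrable ((Metric.ball (0 : Space) r).indicator h) :=
    (integrable_indicator_iff Metric.isOpen_ball.measurableSet).2
      ((hh.continuousOn.integrableOn_compact (isCompact_closedBall 0 r)).mono_set
        Metric.ball_subset_closedBall)
  rw [← integral_indicator Metric.isOpen_ball.measurableSet, integral_polar hint,
    intervalIntegral.integral_of_le hr, ← integral_Ioc_eq_integral_Ioo.symm,
    ← Set.Ioi_inter_Iio, Set.inter_comm, ← Measure.restrict_restrict measurableSet_Iio,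
    ← integral_indicator measurableSet_Iio]
  refine setIntegral_congr_fun measurableSet_Ioi fun s hs => ?_
  by_cases hsr : s < r
  · rw [Set.indicator_of_mem (show s ∈ Set.Iio r from hsr)]
    congr 1
    refine integral_congr_ae (ae_of_all _ fun n => ?_)
    refine Set.indicator_of_mem ?_ _
    rw [mem_ball_zero_iff, norm_smul_sphere hs]
    exact hsr
  · rw [Set.indicator_of_notMem (show s ∉ Set.Iio r from hsr)]
    have : ∀ n : UnitSphere, (Metric.ball (0 : Space) r).indicator h (s • (n : Space)) = 0 := by
      intro n
      refine Set.indicator_of_notMem ?_ _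
      rw [mem_ball_zero_iff, norm_smul_sphere hs]
      exact hsr
    simp [this]

/-- Differentiation under the integral sign over a compact space. -/
theorem hasDerivAt_integral_of_compact {K : Type*} [TopologicalSpace K] [CompactSpace K]
    [SecondCountableTopology K] [MeasurableSpace K] [BorelSpace K]
    {μ : Measure K} [IsFiniteMeasure μ] {G G' : ℝ → K → ℝ}
    (hG : ∀ r, Continuous (G r)) (hG' : Continuous fun p : ℝ × K => G' p.1 p.2)
    (hd : ∀ r n, HasDerivAt (fun s => G s n) (G' r n) r) (r : ℝ) :
    HasDerivAt (fun s => ∫ n, G s n ∂μ) (∫ n, G' r n ∂μ) r := by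
  obtain ⟨C, hC⟩ := ((isCompact_closedBall r 1).prod (isCompact_univ (X := K))).exists_bound_of_continuousOn
    hG'.continuousOn
  have hmeas : ∀ s, AEStronglyMeasurable (G s) μ := fun s => (hG s).aestronglyMeasurable
  refine (hasDerivAt_integral_of_dominated_loc_of_deriv_le (F := G) (F' := G') (bound := fun _ => C)
    (s := Metric.closedBall r 1) (Metric.closedBall_mem_nhds r one_pos)
    (Eventually.of_forall hmeas) ?_ ?_ ?_ (integrable_const C) ?_).2
  · exact (hG r).integrable_of_hasCompactSupport (HasCompactSupport.of_compactSpace _)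
  · exact Continuous.aestronglyMeasurable (hG'.comp (Continuous.prodMk_right r))
  · exact ae_of_all _ fun n s hs => hC (s, n) ⟨hs, Set.mem_univ _⟩
  · exact ae_of_all _ fun n s _ => hd s n

variable {F : Space → Fin 3 → ℝ}

/-- The Euclidean divergence of a vector field on a slice. -/
def spaceDiv (F : Space → Fin 3 → ℝ) (x : Space) : ℝ :=
  ∑ i : Fin 3, fderiv ℝ (fun y => F y i) x (EuclideanSpace.single i 1)

theorem continuous_spaceDiv (hF : ∀ i, ContDiff ℝ ∞ fun y => F y i) : Continuous (spaceDiv F) :=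
  continuous_finsetSum _ fun i _ => ((hF i).continuous_fderiv (by simp)).clm_apply continuous_const

/-- The derivative of the flux through a sphere with respect to its radius. -/
theorem sphereFlux_hasDerivAt (hF : ∀ i, ContDiff ℝ ∞ fun y => F y i) :
    ∃ D : ℝ → ℝ, Continuous D ∧ ∀ r, HasDerivAt (sphereFlux F) (D r) r := by
  let G (r : ℝ) (n : UnitSphere) : ℝ := ∑ i : Fin 3, F (r • (n : Space)) i * (n : Space) i
  let G' (r : ℝ) (n : UnitSphere) : ℝ :=
    ∑ i : Fin 3, fderiv ℝ (fun y => F y i) (r • (n : Space)) (n : Space) * (n : Space) i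
  have hcn : ∀ i, Continuous fun p : ℝ × UnitSphere => (p.2 : Space) i := fun i => by fun_prop
  have hG : Continuous fun p : ℝ × UnitSphere => G p.1 p.2 :=
    continuous_finsetSum _ fun i _ =>
      ((hF i).continuous.comp (by fun_prop : Continuous fun p : ℝ × UnitSphere =>
        p.1 • (p.2 : Space))).mul (hcn i)
  have hG' : Continuous fun p : ℝ × UnitSphere => G' p.1 p.2 :=
    continuous_finsetSum _ fun i _ =>
      ((((hF i).continuous_fderiv (by simp)).comp (by fun_prop : Continuous fun p : ℝ × UnitSphere =>
        p.1 • (p.2 : Space))).clm_apply (by fun_prop)).mul (hcn i)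
  have hd : ∀ r n, HasDerivAt (fun s => G s n) (G' r n) r := by
    intro r n
    refine HasDerivAt.fun_sum fun i _ => HasDerivAt.mul_const ?_ _
    have h1 : HasFDerivAt (fun y => F y i) (fderiv ℝ (fun y => F y i) (r • (n : Space)))
        (r • (n : Space)) := ((hF i).differentiable (by simp) _).hasFDerivAt
    have h2 : HasDerivAt (fun s : ℝ => s • (n : Space)) (n : Space) r := by
      simpa using (hasDerivAt_id r).smul_const (n : Space)
    exact h1.comp_hasDerivAt r h2
  have hI := hasDerivAt_integral_of_compact (μ := sphereMeasure)
    (fun r => hG.comp (Continuous.prodMk_right r)) hG' hd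
  have hcont : ∀ {Q : ℝ → UnitSphere → ℝ}, Continuous (fun p : ℝ × UnitSphere => Q p.1 p.2) →
      Continuous fun r => ∫ n, Q r n ∂sphereMeasure := by
    intro Q hQ
    exact continuous_parametric_integral_of_continuous
      (f := Q) hQ isCompact_univ |>.congr fun r => by rw [Measure.restrict_univ]
  refine ⟨fun r => (2 * r) * (∫ n, G r n ∂sphereMeasure) + r ^ 2 * ∫ n, G' r n ∂sphereMeasure,
    ((continuous_const.mul continuous_id).mul (hcont hG)).add
      ((continuous_pow 2).mul (hcont hG')), fun r => ?_⟩
  have := (hasDerivAt_pow 2 r).fun_mul (hI r)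
  refine (show sphereFlux F = fun r => r ^ 2 * ∫ n, G r n ∂sphereMeasure from rfl) ▸ ?_
  simpa using this

section RadialTest

variable {f : ℝ → ℝ}

/-- A function supported in `(0, ∞)` vanishes near the origin when it is applied to the norm. -/
theorem radial_eventuallyEq_zero (hf : tsupport f ⊆ Set.Ioi 0) :
    (fun x : Space => f ‖x‖) =ᶠ[𝓝 0] fun _ => 0 := by
  have h0 : (0 : ℝ) ∉ tsupport f := fun h => lt_irrefl (0 : ℝ) (hf h)
  have h1 : f =ᶠ[𝓝 0] 0 := notMem_tsupport_iff_eventuallyEq.1 h0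
  have h2 : Tendsto (fun x : Space => ‖x‖) (𝓝 0) (𝓝 0) := by
    simpa using (continuous_norm (E := Space)).tendsto 0
  exact h2.eventually h1

theorem contDiff_radial (hf : ContDiff ℝ ∞ f) (hs : tsupport f ⊆ Set.Ioi 0) :
    ContDiff ℝ ∞ fun x : Space => f ‖x‖ := by
  refine contDiff_iff_contDiffAt.2 fun x => ?_
  rcases eq_or_ne x 0 with rfl | hx
  · exact contDiffAt_const.congr_of_eventuallyEq (radial_eventuallyEq_zero hs)
  · exact hf.contDiffAt.comp x (contDiffAt_norm ℝ hx)

theorem hasCompactSupport_radial (hc : HasCompactSupport f) :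
    HasCompactSupport fun x : Space => f ‖x‖ := by
  obtain ⟨R, hR⟩ := hc.isBounded.subset_closedBall 0
  refine HasCompactSupport.intro (isCompact_closedBall (0 : Space) R) fun x hx => ?_
  refine image_eq_zero_of_notMem_tsupport fun h => hx ?_
  simpa using hR h

theorem fderiv_radial (hf : ContDiff ℝ ∞ f) {r : ℝ} (hr : 0 < r) (n : UnitSphere) (i : Fin 3) :
    fderiv ℝ (fun x : Space => f ‖x‖) (r • (n : Space)) (EuclideanSpace.single i 1) =
      deriv f r * (n : Space) i := by
  have hx : r • (n : Space) ≠ 0 := by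
    rw [← norm_ne_zero_iff, norm_smul_sphere hr]; exact hr.ne'
  have h1 : HasDerivAt f (deriv f r) ‖r • (n : Space)‖ := by
    rw [norm_smul_sphere hr]; exact (hf.differentiable (by simp) r).hasDerivAt
  have h2 : HasFDerivAt (fun x : Space => ‖x‖) (fderiv ℝ (fun x : Space => ‖x‖) (r • (n : Space)))
      (r • (n : Space)) := ((contDiffAt_norm ℝ hx (n := 1)).differentiableAt (by simp)).hasFDerivAt
  have h3 := h1.comp_hasFDerivAt _ h2
  have h4 : HasFDerivAt (fun x : Space => ‖x‖ ^ 2) _ (r • (n : Space)) := h2.pow 2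
  have h5 := (hasStrictFDerivAt_norm_sq (r • (n : Space))).hasFDerivAt.unique h4
  have h6 := DFunLike.congr_fun h5 (EuclideanSpace.single i 1)
  have h7 : fderiv ℝ (fun x : Space => ‖x‖) (r • (n : Space)) (EuclideanSpace.single i 1) =
      (n : Space) i := by
    have : r * fderiv ℝ (fun x : Space => ‖x‖) (r • (n : Space)) (EuclideanSpace.single i 1) =
        r * (n : Space) i := by
      have h8 : 2 * r * fderiv ℝ (fun x : Space => ‖x‖) (r • (n : Space))
          (EuclideanSpace.single i 1) = 2 * (r * (n : Space) i) := by
        simpa [norm_smul_sphere hr, real_inner_smul_left, EuclideanSpace.inner_single_right,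
          -mul_eq_mul_left_iff] using h6.symm
      linarith
    exact mul_left_cancel₀ hr.ne' this
  rw [HasFDerivAt.fderiv (f := fun x : Space => f ‖x‖) h3, smul_apply, h7, smul_eq_mul]

end RadialTest

/-- The derivative of the flux through the sphere of radius `r` is the integral of the divergence
over that sphere, as a distribution on `(0, ∞)`. -/
theorem integral_deriv_mul_sphereFlux (hF : ∀ i, ContDiff ℝ ∞ fun y => F y i) {f : ℝ → ℝ}
    (hf : ContDiff ℝ ∞ f) (hc : HasCompactSupport f) (hs : tsupport f ⊆ Set.Ioi 0) :
    ∫ r in Set.Ioi (0 : ℝ), f r * (r ^ 2 * ∫ n : UnitSphere, spaceDiv F (r • (n : Space))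
      ∂sphereMeasure) = -∫ r in Set.Ioi (0 : ℝ), deriv f r * sphereFlux F r := by
  set η : Space → ℝ := fun x => f ‖x‖ with hη
  have hηs : ContDiff ℝ ∞ η := contDiff_radial hf hs
  have hηc : HasCompactSupport η := hasCompactSupport_radial hc
  let e (i : Fin 3) : Space := EuclideanSpace.single i 1
  have hη' : ∀ i, Continuous fun x => fderiv ℝ η x (e i) := fun i =>
    (hηs.continuous_fderiv (by simp)).clm_apply continuous_const
  have hF' : ∀ i, Continuous fun x => fderiv ℝ (fun y => F y i) x (e i) := fun i =>
    ((hF i).continuous_fderiv (by simp)).clm_apply continuous_const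
  have hηc' : ∀ i, HasCompactSupport fun x => fderiv ℝ η x (e i) := fun i =>
    hηc.fderiv_apply (𝕜 := ℝ) (e i)
  have i1 : ∀ i, Integrable fun x => η x * fderiv ℝ (fun y => F y i) x (e i) := fun i =>
    (hηs.continuous.mul (hF' i)).integrable_of_hasCompactSupport hηc.mul_right
  have i2 : ∀ i, Integrable fun x => fderiv ℝ η x (e i) * F x i := fun i =>
    ((hη' i).mul (hF i).continuous).integrable_of_hasCompactSupport (hηc' i).mul_right
  have i3 : ∀ i, Integrable fun x => η x * F x i := fun i =>
    (hηs.continuous.mul (hF i).continuous).integrable_of_hasCompactSupport hηc.mul_right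
  have parts : ∀ i, ∫ x, η x * fderiv ℝ (fun y => F y i) x (e i) =
      -∫ x, fderiv ℝ η x (e i) * F x i := fun i =>
    integral_mul_fderiv_eq_neg_fderiv_mul_of_integrable (i2 i) (i1 i) (i3 i)
      (fun x _ => hηs.differentiable (by simp) x) (fun x _ => (hF i).differentiable (by simp) x)
  have key : ∫ x, ∑ i, η x * fderiv ℝ (fun y => F y i) x (e i) =
      -∫ x, ∑ i, fderiv ℝ η x (e i) * F x i := by
    rw [integral_finsetSum _ fun i _ => i1 i, integral_finsetSum _ fun i _ => i2 i,
      ← Finset.sum_neg_distrib]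
    exact Finset.sum_congr rfl fun i _ => parts i
  rw [integral_polar (integrable_finsetSum _ fun i _ => i1 i),
    integral_polar (integrable_finsetSum _ fun i _ => i2 i)] at key
  refine Eq.trans (setIntegral_congr_fun measurableSet_Ioi fun r hr => ?_)
    (key.trans (congrArg Neg.neg (setIntegral_congr_fun measurableSet_Ioi fun r hr => ?_)))
  · simp only [hη, norm_smul_sphere hr, ← Finset.mul_sum, integral_const_mul, spaceDiv, e]
    ring
  · simp only [hη, fderiv_radial hf hr, e, sphereFlux, mul_assoc, ← Finset.mul_sum,
      integral_const_mul]
    rw [mul_left_comm]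
    simp only [mul_comm]

/-- The divergence theorem on a ball. -/
theorem integral_ball_spaceDiv (hF : ∀ i, ContDiff ℝ ∞ fun y => F y i) {r : ℝ} (hr : 0 ≤ r) :
    ∫ x in Metric.ball (0 : Space) r, spaceDiv F x = sphereFlux F r := by
  obtain ⟨Φ', hΦc, hΦ⟩ := sphereFlux_hasDerivAt hF
  have hΦcont : Continuous (sphereFlux F) :=
    continuous_iff_continuousAt.2 fun r => (hΦ r).continuousAt
  let D (s : ℝ) : ℝ := s ^ 2 * ∫ n : UnitSphere, spaceDiv F (s • (n : Space)) ∂sphereMeasure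
  have hD : Continuous D := by
    refine (continuous_pow 2).mul ?_
    exact continuous_parametric_integral_of_continuous
      (f := fun s (n : UnitSphere) => spaceDiv F (s • (n : Space)))
      ((continuous_spaceDiv hF).comp (by fun_prop : Continuous fun p : ℝ × UnitSphere =>
        p.1 • (p.2 : Space))) isCompact_univ |>.congr fun r => by rw [Measure.restrict_univ]
  -- the two continuous densities agree as distributions on `(0, ∞)`
  have hae : ∀ᵐ s : ℝ, s ∈ Set.Ioi (0 : ℝ) → D s - Φ' s = 0 := by
    refine isOpen_Ioi.ae_eq_zero_of_integral_contDiff_smul_eq_zero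
      ((hD.sub hΦc).locallyIntegrable.locallyIntegrableOn _) fun f hf hc hs => ?_
    have hz : ∀ {h : ℝ → ℝ}, (∀ s, s ∉ tsupport f → h s = 0) →
        ∫ s in Set.Ioi (0 : ℝ), h s = ∫ s, h s := fun hh =>
      setIntegral_eq_integral_of_forall_compl_eq_zero fun s hs' => hh s fun h => hs' (hs h)
    have hf0 : ∀ s, s ∉ tsupport f → f s = 0 := fun s => image_eq_zero_of_notMem_tsupport
    have hf1 : ∀ s, s ∉ tsupport f → deriv f s = 0 := fun s h => by
      have h' : f =ᶠ[𝓝 s] fun _ => 0 := notMem_tsupport_iff_eventuallyEq.1 h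
      rw [h'.deriv_eq, deriv_const]
    have hfd : Continuous (deriv f) := hf.continuous_deriv (by simp)
    have i1 : Integrable fun s => f s * D s :=
      (hf.continuous.mul hD).integrable_of_hasCompactSupport hc.mul_right
    have i2 : Integrable fun s => f s * Φ' s :=
      (hf.continuous.mul hΦc).integrable_of_hasCompactSupport hc.mul_right
    have i3 : Integrable fun s => deriv f s * sphereFlux F s :=
      (hfd.mul hΦcont).integrable_of_hasCompactSupport hc.deriv.mul_right
    have i4 : Integrable fun s => f s * sphereFlux F s :=
      (hf.continuous.mul hΦcont).integrable_of_hasCompactSupport hc.mul_right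
    have parts : ∫ s, f s * Φ' s = -∫ s, deriv f s * sphereFlux F s :=
      integral_mul_deriv_eq_deriv_mul_of_integrable
        (fun s _ => (hf.differentiable (by simp) s).hasDerivAt) (fun s _ => hΦ s) i2 i3 i4
    have key : ∫ s in Set.Ioi (0 : ℝ), f s * D s =
        -∫ s in Set.Ioi (0 : ℝ), deriv f s * sphereFlux F s :=
      integral_deriv_mul_sphereFlux hF hf hc hs
    rw [hz fun s h => by rw [hf0 s h, zero_mul], hz fun s h => by rw [hf1 s h, zero_mul]] at key
    simp only [smul_eq_mul, mul_sub]
    rw [integral_sub i1 i2, key, parts, sub_self]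
  rw [integral_ball_polar (continuous_spaceDiv hF) hr]
  have h1 : ∫ s in (0)..r, D s = ∫ s in (0)..r, Φ' s := by
    refine intervalIntegral.integral_congr_ae ?_
    filter_upwards [hae] with s hs hs'
    rw [Set.uIoc_of_le hr] at hs'
    exact sub_eq_zero.1 (hs hs'.1)
  have h2 := intervalIntegral.integral_eq_sub_of_hasDerivAt (fun s _ => hΦ s)
    (hΦc.intervalIntegrable 0 r)
  have h3 : sphereFlux F 0 = 0 := by simp [sphereFlux]
  rw [h3, sub_zero] at h2
  exact h1.trans h2

end

section

/-! ### Slices and spatial divergences -/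

/-- The inclusion of the tangent space of a slice. -/
def sliceInclusion : Space →L[ℝ] Spacetime :=
  ContinuousLinearMap.pi (Fin.cons 0 fun i => EuclideanSpace.proj i)

theorem event_eq (t : ℝ) : event t = fun x => sliceInclusion x + event t 0 := by
  funext x μ
  obtain rfl | ⟨i, rfl⟩ := Fin.eq_zero_or_eq_succ μ <;>
  simp [event, sliceInclusion]

theorem sliceInclusion_single (i : Fin 3) :
    sliceInclusion (EuclideanSpace.single i 1) = Pi.single i.succ 1 := by
  funext μ
  obtain rfl | ⟨j, rfl⟩ := Fin.eq_zero_or_eq_succ μ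
  · simp [sliceInclusion]
  · simp [sliceInclusion, Pi.single_apply]

theorem contDiff_event (t : ℝ) : ContDiff ℝ ∞ (event t) := by
  rw [event_eq]
  exact sliceInclusion.contDiff.add contDiff_const

theorem fderiv_slice {Y : Spacetime → ℝ} (hY : ContDiff ℝ ∞ Y) (t : ℝ) (x : Space) (i : Fin 3) :
    fderiv ℝ (fun x => Y (event t x)) x (EuclideanSpace.single i 1) = pd i.succ Y (event t x) := by
  have h1 : HasFDerivAt Y (fderiv ℝ Y (event t x)) (event t x) :=
    (hY.differentiable (by simp) _).hasFDerivAt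
  have h2 : HasFDerivAt (event t) sliceInclusion x := by
    rw [event_eq]
    exact sliceInclusion.hasFDerivAt.add_const _
  have h3 : HasFDerivAt (fun x => Y (event t x)) _ x := h1.comp x h2
  rw [h3.fderiv, ContinuousLinearMap.comp_apply, sliceInclusion_single, pd]

/-- The divergence theorem for spatial divergences of fields on spacetime. -/
theorem integral_ball_sum_pd {Y : Fin 3 → Spacetime → ℝ} (hY : ∀ i, ContDiff ℝ ∞ (Y i)) (t : ℝ)
    {r : ℝ} (hr : 0 ≤ r) :
    ∫ x in Metric.ball (0 : Space) r, ∑ i : Fin 3, pd i.succ (Y i) (event t x) =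
      sphereFlux (fun x i => Y i (event t x)) r := by
  rw [← integral_ball_spaceDiv (F := fun x i => Y i (event t x))
    (fun i => (hY i).comp (contDiff_event t)) hr]
  simp only [spaceDiv, fderiv_slice (hY _)]

theorem sphereFlux_sub {F G : Space → Fin 3 → ℝ} (hF : ∀ i, Continuous fun x => F x i)
    (hG : ∀ i, Continuous fun x => G x i) (r : ℝ) :
    sphereFlux (fun x i => F x i - G x i) r = sphereFlux F r - sphereFlux G r := by
  have h : ∀ {H : Space → Fin 3 → ℝ}, (∀ i, Continuous fun x => H x i) →
      Integrable (fun n : UnitSphere => ∑ i : Fin 3, H (r • (n : Space)) i * (n : Space) i)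
        sphereMeasure := fun hH =>
    Continuous.integrable_of_hasCompactSupport
      (continuous_finsetSum _ fun i _ => ((hH i).comp (by fun_prop)).mul (by fun_prop))
      (HasCompactSupport.of_compactSpace _)
  simp only [sphereFlux, sub_mul, Finset.sum_sub_distrib]
  rw [integral_sub (h hF) (h hG), mul_sub]

/-- The flux of a field which decays faster than `r⁻²` tends to zero. -/
theorem tendsto_sphereFlux_zero {F : Space → Fin 3 → ℝ}
    (hF : ∀ i, (fun x => F x i) =O[Bornology.cobounded Space] fun x => (‖x‖ ^ 3)⁻¹) :
    Tendsto (sphereFlux F) atTop (𝓝 0) := by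
  choose C hC using fun i => (hF i).bound
  have hev : ∀ᶠ x in Bornology.cobounded Space, ∀ i, ‖F x i‖ ≤ C i * ‖(‖x‖ ^ 3)⁻¹‖ :=
    eventually_all.2 hC
  obtain ⟨R, -, hR⟩ := (Metric.hasBasis_cobounded_compl_closedBall (0 : Space)).eventually_iff.1 hev
  have hb : ∀ᶠ r : ℝ in atTop, ‖sphereFlux F r‖ ≤
      ((∑ i, C i) * sphereMeasure.real Set.univ) * r⁻¹ := by
    filter_upwards [eventually_gt_atTop (max R 0)] with r hr
    have hr0 : 0 < r := (le_max_right _ _).trans_lt hr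
    have hle : ∀ n : UnitSphere, ‖∑ i : Fin 3, F (r • (n : Space)) i * (n : Space) i‖ ≤
        (∑ i, C i) * (r ^ 3)⁻¹ := by
      intro n
      rw [Finset.sum_mul]
      refine norm_sum_le_of_le _ fun i _ => ?_
      have h1 := hR (x := r • (n : Space)) (by
        rw [Set.mem_compl_iff, mem_closedBall_zero_iff, norm_smul_sphere hr0, not_le]
        exact (le_max_left _ _).trans_lt hr) i
      rw [norm_smul_sphere hr0, norm_inv, norm_pow, Real.norm_of_nonneg hr0.le] at h1
      have h2 : ‖(n : Space) i‖ ≤ 1 := by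
        simpa [norm_eq_of_mem_sphere n] using PiLp.norm_apply_le (n : Space) i
      rw [norm_mul]
      exact (mul_le_of_le_one_right (norm_nonneg _) h2).trans h1
    have h3 := norm_integral_le_of_norm_le_const (μ := sphereMeasure) (ae_of_all _ hle)
    rw [sphereFlux, norm_mul, norm_pow, Real.norm_of_nonneg hr0.le]
    calc r ^ 2 * _ ≤ r ^ 2 * ((∑ i, C i) * (r ^ 3)⁻¹ * sphereMeasure.real Set.univ) := by gcongr
      _ = _ := by field_simp
  refine squeeze_zero_norm' hb ?_
  simpa using tendsto_inv_atTop_zero.const_mul ((∑ i, C i) * sphereMeasure.real Set.univ)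

/-! ### Decay at spatial infinity -/

section Decay

variable {E E' : Type*} [NormedAddCommGroup E] [NormedAddCommGroup E'] {t : ℝ} {k l : ℕ}

/-- The field `f` is `O(r⁻ᵏ)` as `r → ∞` in the slice `x⁰ = t`. -/
def HasDecay (t : ℝ) (k : ℕ) (f : Spacetime → E) : Prop :=
  (fun x : Space => f (event t x)) =O[Bornology.cobounded Space] fun x => (‖x‖ ^ k)⁻¹

namespace HasDecay

theorem add {f₁ f₂ : Spacetime → E} (h₁ : HasDecay t k f₁) (h₂ : HasDecay t k f₂) :
    HasDecay t k fun y => f₁ y + f₂ y := IsBigO.add h₁ h₂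

theorem sub {f₁ f₂ : Spacetime → E} (h₁ : HasDecay t k f₁) (h₂ : HasDecay t k f₂) :
    HasDecay t k fun y => f₁ y - f₂ y := IsBigO.sub h₁ h₂

theorem neg {f : Spacetime → E} (h : HasDecay t k f) : HasDecay t k fun y => -f y :=
  IsBigO.neg_left h

theorem sum {ι : Type*} {s : Finset ι} {f : ι → Spacetime → E}
    (h : ∀ i ∈ s, HasDecay t k (f i)) : HasDecay t k fun y => ∑ i ∈ s, f i y :=
  IsBigO.fun_sum h

theorem mul {f₁ f₂ : Spacetime → ℝ} (h₁ : HasDecay t k f₁) (h₂ : HasDecay t l f₂) :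
    HasDecay t (k + l) fun y => f₁ y * f₂ y := by
  refine (IsBigO.mul h₁ h₂).congr_right fun x => ?_
  rw [pow_add, mul_inv]

theorem const_mul (c : ℝ) {f : Spacetime → ℝ} (h : HasDecay t k f) :
    HasDecay t k fun y => c * f y := IsBigO.const_mul_left h c

theorem clm_apply [NormedSpace ℝ E] [NormedSpace ℝ E'] {A : Spacetime → E →L[ℝ] E'}
    {f : Spacetime → E} (h₁ : HasDecay t k A) (h₂ : HasDecay t l f) : HasDecay t (k + l) fun y => A y (f y) := by
  refine IsBigO.trans (g := fun x => ‖A (event t x)‖ * ‖f (event t x)‖) ?_ ?_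
  · refine IsBigO.of_norm_le fun x => ?_
    exact (A (event t x)).le_opNorm _
  · refine (IsBigO.mul h₁.norm_left h₂.norm_left).congr_right fun x => ?_
    rw [pow_add, mul_inv]

theorem clm [NormedSpace ℝ E] [NormedSpace ℝ E'] (A : E →L[ℝ] E') {f : Spacetime → E}
    (h : HasDecay t k f) : HasDecay t k fun y => A (f y) :=
  (A.isBigO_comp _ _).trans h

end HasDecay

end Decay

/-! ### The Minkowski metric -/

theorem mat_minkowski : mat minkowski = Matrix.diagonal sgn := by
  ext μ ν
  simp only [mat, minkowski, Matrix.of_apply, Matrix.diagonal_apply]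

theorem det_minkowski : (mat minkowski).det = -1 := by
  rw [mat_minkowski, Matrix.det_diagonal, Fin.prod_univ_four]
  simp [sgn]

theorem up_minkowski (μ ν : Fin 4) : up minkowski μ ν = if μ = ν then sgn μ else 0 := by
  have h : (mat minkowski)⁻¹ = Matrix.diagonal sgn := by
    refine Matrix.inv_eq_left_inv ?_
    rw [mat_minkowski, Matrix.diagonal_mul_diagonal, ← Matrix.diagonal_one]
    congr 1
    funext μ
    by_cases h : μ = 0 <;> simp [sgn, h]
  rw [up, h, Matrix.diagonal_apply]

theorem sqrtDet_minkowski : sqrtDet minkowski = 1 := by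
  simp [sqrtDet, det_minkowski]

theorem gup_minkowski (μ ν : Fin 4) : gup minkowski μ ν = if μ = ν then sgn μ else 0 := by
  rw [gup, sqrtDet_minkowski, one_mul, up_minkowski]

theorem q_minkowski {μ ν : Fin 4} (h : μ ≠ ν) : q minkowski μ ν = 0 := by
  rw [q, up_minkowski, if_neg h, zero_div]

theorem minkowski_mem_regular : minkowski ∈ regular := by
  refine ⟨by rw [det_minkowski]; norm_num, ?_, fun i => ?_, fun i j h => ?_⟩
  · simp [up_minkowski, sgn]
  · simp [up_minkowski, sgn]
  · rw [q_minkowski fun h' => h (Fin.succ_injective _ h')]; simp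

/-- Both the angle `α(μa)` and `g^{μa}` vanish for the Minkowski metric. -/
theorem theta_minkowski (μ a : Fin 4) : theta μ a minkowski = 0 := by
  by_cases h : μ = a
  · subst h; rw [theta_self]; rfl
  · have h1 : angle minkowski μ a = 0 := by
      rw [angle, q_minkowski h]; simp
    rw [theta, if_neg h, h1, gup_minkowski, if_neg h]
    ext w
    simp

end

section

/-! ### Decay of the energy density and of the superpotential -/

section General

variable {W : Type*} [NormedAddCommGroup W] {t : ℝ} {φ : Spacetime → W}

theorem HasDecay.comp_of_tendsto {E : Type*} [NormedAddCommGroup E] {w : W} {f : W → E}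
    (hf : ContinuousAt f w)
    (hφ : Tendsto (fun x : Space => φ (event t x)) (Bornology.cobounded Space) (𝓝 w)) :
    HasDecay t 0 fun y => f (φ y) := by
  have h1 := (hf.tendsto.comp hφ).isBigO_one ℝ
  exact h1.congr_right fun x => by simp

variable [NormedSpace ℝ W]

theorem HasDecay.pd_pd (hφ : ContDiff ℝ ∞ φ) {w : W} {k : ℕ}
    (h : (fun x : Space => iteratedFDeriv ℝ 2 (fun y => φ y - w) (event t x))
      =O[Bornology.cobounded Space] fun x => (‖x‖ ^ k)⁻¹) (μ ν : Fin 4) :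
    HasDecay t k (pd μ (pd ν φ)) := by
  have h1 : HasDecay t k (fderiv ℝ (fderiv ℝ φ)) := by
    refine IsBigO.of_norm_left (h.norm_left.congr_left fun x => ?_)
    rw [← norm_iteratedFDeriv_fderiv, norm_iteratedFDeriv_one]
    congr 2
    funext y
    rw [fderiv_sub_const]
  rw [show pd μ (pd ν φ) = fun y => fderiv ℝ (fderiv ℝ φ) y (Pi.single μ 1) (Pi.single ν 1) from
    funext fun y => pd_pd_eq_fderiv_fderiv hφ.contDiffAt]
  exact (h1.clm (ContinuousLinearMap.apply ℝ (Spacetime →L[ℝ] W) (Pi.single μ 1 : Spacetime))).clm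
    (ContinuousLinearMap.apply ℝ W (Pi.single ν 1 : Spacetime))

theorem HasDecay.fderiv_oneForm {θ : W → W →L[ℝ] ℝ} {w : W} (hθ : ContDiffAt ℝ ∞ θ w)
    (hφ : Tendsto (fun x : Space => φ (event t x)) (Bornology.cobounded Space) (𝓝 w))
    {u v : Spacetime → W} {k l : ℕ} (hu : HasDecay t k u) (hv : HasDecay t l v) :
    HasDecay t (k + l) fun y => fderiv ℝ θ (φ y) (u y) (v y) := by
  have h := ((HasDecay.comp_of_tendsto (f := fderiv ℝ θ)
    (hθ.fderiv_right (m := ∞) (by simp)).continuousAt hφ).clm_apply hu).clm_apply hv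
  rwa [zero_add] at h

end General

variable {g : Spacetime → SymTensor} {t : ℝ}

namespace AsymptoticallyFlat

theorem hasDecay_sub (h : AsymptoticallyFlat g) (t : ℝ) :
    HasDecay t 1 fun y => g y - minkowski :=
  (IsBigO.of_norm_left (f' := fun x : Space => g (event t x) - minkowski)
    ((h t 0).norm_left.congr_left fun _ => norm_iteratedFDeriv_zero))

theorem hasDecay_fderiv (h : AsymptoticallyFlat g) (t : ℝ) : HasDecay t 2 (fderiv ℝ g) :=
  (IsBigO.of_norm_left (f' := fun x : Space => fderiv ℝ g (event t x))
    ((h t 1).norm_left.congr_left fun x => by rw [norm_iteratedFDeriv_one, fderiv_sub_const]))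

theorem hasDecay_pd (h : AsymptoticallyFlat g) (t : ℝ) (μ : Fin 4) : HasDecay t 2 (pd μ g) :=
  (h.hasDecay_fderiv t).clm (ContinuousLinearMap.apply ℝ SymTensor (Pi.single μ 1 : Spacetime))

theorem hasDecay_pd_pd (h : AsymptoticallyFlat g) (hg : ContDiff ℝ ∞ g) (t : ℝ) (μ ν : Fin 4) :
    HasDecay t 3 (pd μ (pd ν g)) :=
  HasDecay.pd_pd hg (h t 2) μ ν

theorem hasDecay_entry (h : AsymptoticallyFlat g) (t : ℝ) (κ μ ν : Fin 4) :
    HasDecay t 2 fun y => (pd κ g y).1 μ ν :=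
  (h.hasDecay_pd t κ).clm (entry μ ν)

theorem tendsto (h : AsymptoticallyFlat g) (t : ℝ) :
    Tendsto (fun x : Space => g (event t x)) (Bornology.cobounded Space) (𝓝 minkowski) := by
  have h1 : Tendsto (fun x : Space => g (event t x) - minkowski) (Bornology.cobounded Space)
      (𝓝 0) := by
    refine IsBigO.trans_tendsto (h.hasDecay_sub t) ?_
    simp only [pow_one]
    exact tendsto_inv_atTop_zero.comp tendsto_norm_cobounded_atTop
  simpa using h1.add_const minkowski

variable {E : Type*} [NormedAddCommGroup E]

theorem hasDecay_comp (h : AsymptoticallyFlat g) {f : SymTensor → E}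
    (hf : ContinuousAt f minkowski) : HasDecay t 0 fun y => f (g y) :=
  HasDecay.comp_of_tendsto hf (h.tendsto t)

theorem hasDecay_comp_sub [NormedSpace ℝ E] (h : AsymptoticallyFlat g) {f : SymTensor → E}
    (hf : DifferentiableAt ℝ f minkowski) :
    HasDecay t 1 fun y => f (g y) - f minkowski :=
  (hf.isBigO_sub.comp_tendsto (h.tendsto t)).trans (h.hasDecay_sub t)

theorem hasDecay_gup (h : AsymptoticallyFlat g) (a b : Fin 4) :
    HasDecay t 0 fun y => gup (g y) a b :=
  h.hasDecay_comp (f := fun A => gup A a b) (contDiffAt_gup minkowski_mem_regular.1 a b).continuousAt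

theorem hasDecay_christoffel (h : AsymptoticallyFlat g) (ρ μ ν : Fin 4) :
    HasDecay t 2 (christoffel g ρ μ ν) :=
  (HasDecay.sum fun σ _ => (h.hasDecay_comp (f := fun A => up A ρ σ)
    (contDiffAt_up (n := ∞) minkowski_mem_regular.1 ρ σ).continuousAt).mul
    (l := 2) (((h.hasDecay_entry t μ σ ν).add (h.hasDecay_entry t ν σ μ)).sub
      (h.hasDecay_entry t σ μ ν))).const_mul (1 / 2)

theorem hasDecay_gammaLagrangian (h : AsymptoticallyFlat g) :
    HasDecay t 4 fun y => gammaLagrangian (g y, grad g y) :=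
  HasDecay.sum fun m _ => HasDecay.sum fun n _ => (h.hasDecay_gup m n).mul (l := 4)
    (HasDecay.sum fun r _ => HasDecay.sum fun s _ =>
      ((h.hasDecay_christoffel r n s).mul (h.hasDecay_christoffel s m r)).sub
      ((h.hasDecay_christoffel r r s).mul (h.hasDecay_christoffel s m n)))

theorem hasDecay_fderiv_gup (h : AsymptoticallyFlat g) (m n : Fin 4) (κ : Fin 4) :
    HasDecay t 2 fun y => fderiv ℝ (fun B => gup B m n) (g y) (pd κ g y) :=
  HasDecay.clm_apply (k := 0) (h.hasDecay_comp (f := fderiv ℝ fun B => gup B m n)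
    ((contDiffAt_gup minkowski_mem_regular.1 m n).fderiv_right (m := ∞) (by simp)).continuousAt)
    (h.hasDecay_pd t κ)

theorem hasDecay_momentum (h : AsymptoticallyFlat g) (r κ : Fin 4) :
    HasDecay t 4 fun y => momentum r (g y, grad g y) (pd κ g y) :=
  (HasDecay.sum fun m _ => HasDecay.sum fun n _ =>
    (h.hasDecay_fderiv_gup m n κ).mul (h.hasDecay_christoffel r m n)).sub
  (HasDecay.sum fun m _ => (h.hasDecay_fderiv_gup m r κ).mul
    (HasDecay.sum fun s _ => h.hasDecay_christoffel s m s))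

theorem hasDecay_theta (h : AsymptoticallyFlat g) (μ a : Fin 4) :
    HasDecay t 1 fun y => theta μ a (g y) := by
  have := h.hasDecay_comp_sub (t := t) (f := theta μ a)
    ((contDiffAt_theta_metric minkowski_mem_regular μ a).differentiableAt (by simp))
  rw [show (fun y => theta μ a (g y)) = fun y => theta μ a (g y) - theta μ a minkowski from
    funext fun y => by rw [theta_minkowski]; ext w; simp]
  exact this

theorem hasDecay_pd_theta (h : AsymptoticallyFlat g) (hg : ContDiff ℝ ∞ g)
    (hr : ∀ x, g x ∈ regular) (i μ a : Fin 4) :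
    HasDecay t 4 (pd i fun y => theta μ a (g y) (pd a g y)) := by
  rw [show (pd i fun y => theta μ a (g y) (pd a g y)) = fun x =>
      fderiv ℝ (theta μ a) (g x) (pd i g x) (pd a g x) + theta μ a (g x) (pd i (pd a g) x) from
    funext fun x => pd_oneForm (contDiffAt_theta_metric (hr x) μ a) hg.contDiffAt
      ((contDiffAt_pd_top hg.contDiffAt).differentiableAt (by simp))]
  exact (HasDecay.fderiv_oneForm (contDiffAt_theta_metric minkowski_mem_regular μ a) (h.tendsto t)
    (h.hasDecay_pd t i) (h.hasDecay_pd t a)).add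
    ((h.hasDecay_theta μ a).clm_apply (h.hasDecay_pd_pd hg t i a))

/-- Every term of the energy density is quadratic in the deviation from the Minkowski metric; the
terms with second derivatives are so because the 1-forms `theta` vanish at the Minkowski metric. -/
theorem hasDecay_energyDensity (h : AsymptoticallyFlat g) (hg : ContDiff ℝ ∞ g)
    (hr : ∀ x, g x ∈ regular) : HasDecay t 4 (energyDensity lagrangianK g) := by
  have hd : ∀ (i j : Fin 3) x, DifferentiableAt ℝ
      (fun y => theta i.succ j.succ (g y) (pd j.succ g y)) x := fun i j x =>
    (contDiffAt_theta_field hg (hr x) _ _).differentiableAt (by simp)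
  rw [show energyDensity lagrangianK g = fun x => -momentum 0 (g x, grad g x) (pd 0 g x)
      - gammaLagrangian (g x, grad g x) - ∑ i : Fin 3, ∑ j : Fin 3,
        pd i.succ (fun y => theta i.succ j.succ (g y) (pd j.succ g y)) x from funext fun x => by
    rw [lagrangianK_hasDivergenceForm.energyDensity_eq hg (fun x => (hr x).1) hr,
      fderiv_gammaLagrangian_single hg (hr x).1]
    simp only [pd_sum fun j _ => hd _ j x]]
  exact ((h.hasDecay_momentum 0 0).neg.sub h.hasDecay_gammaLagrangian).sub
    (HasDecay.sum fun i _ => HasDecay.sum fun j _ => h.hasDecay_pd_theta hg hr _ _ _)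

end AsymptoticallyFlat

/-- The linearized Christoffel symbols: `Γ^ρ_{μν}` with the index raised by the Minkowski metric. -/
def flatChristoffel (g : Spacetime → SymTensor) (ρ μ ν : Fin 4) (x : Spacetime) : ℝ :=
  chr ρ μ ν (minkowski, grad g x)

theorem flatChristoffel_eq (ρ μ ν : Fin 4) (x : Spacetime) : flatChristoffel g ρ μ ν x =
    (1 / 2) * (sgn ρ * ((pd μ g x).1 ρ ν + (pd ν g x).1 ρ μ - (pd ρ g x).1 μ ν)) := by
  simp [flatChristoffel, chr, up_minkowski, grad]

namespace AsymptoticallyFlat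

theorem hasDecay_flatChristoffel (h : AsymptoticallyFlat g) (ρ μ ν : Fin 4) :
    HasDecay t 2 (flatChristoffel g ρ μ ν) := by
  rw [show flatChristoffel g ρ μ ν = _ from funext fun x => flatChristoffel_eq ρ μ ν x]
  exact (((((h.hasDecay_entry t μ ρ ν).add (h.hasDecay_entry t ν ρ μ)).sub
      (h.hasDecay_entry t ρ μ ν))).const_mul _).const_mul _

theorem hasDecay_christoffel_sub (h : AsymptoticallyFlat g) (ρ μ ν : Fin 4) :
    HasDecay t 3 fun x => christoffel g ρ μ ν x - flatChristoffel g ρ μ ν x := by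
  have e : (fun x => christoffel g ρ μ ν x - flatChristoffel g ρ μ ν x) = fun x =>
      (1 / 2) * ∑ σ, (up (g x) ρ σ - up minkowski ρ σ) *
        ((pd μ g x).1 σ ν + (pd ν g x).1 σ μ - (pd σ g x).1 μ ν) := by
    funext x
    simp only [christoffel, flatChristoffel, chr, grad, ← mul_sub, ← Finset.sum_sub_distrib, sub_mul]
  rw [e]
  exact (HasDecay.sum fun σ _ => (h.hasDecay_comp_sub (f := fun A => up A ρ σ)
    ((contDiffAt_up (n := ∞) minkowski_mem_regular.1 ρ σ).differentiableAt (by simp))).mul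
    (l := 2) (((h.hasDecay_entry t μ σ ν).add (h.hasDecay_entry t ν σ μ)).sub
      (h.hasDecay_entry t σ μ ν))).const_mul (1 / 2)

theorem hasDecay_gup_mul_christoffel_sub (h : AsymptoticallyFlat g) (a b ρ μ ν : Fin 4) :
    HasDecay t 3 fun x => gup (g x) a b * christoffel g ρ μ ν x
      - gup minkowski a b * flatChristoffel g ρ μ ν x := by
  have e : (fun x => gup (g x) a b * christoffel g ρ μ ν x
      - gup minkowski a b * flatChristoffel g ρ μ ν x) = fun x =>
      gup (g x) a b * (christoffel g ρ μ ν x - flatChristoffel g ρ μ ν x)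
      + (gup (g x) a b - gup minkowski a b) * flatChristoffel g ρ μ ν x := by
    funext x; ring
  rw [e]
  exact ((h.hasDecay_gup a b).mul (l := 3) (h.hasDecay_christoffel_sub ρ μ ν)).add
    ((h.hasDecay_comp_sub (f := fun A => gup A a b)
      ((contDiffAt_gup minkowski_mem_regular.1 a b).differentiableAt (by simp))).mul (l := 2)
      (h.hasDecay_flatChristoffel ρ μ ν))

/-- The linear part of the superpotential is the integrand of the ADM energy. -/
theorem hasDecay_superpotential_sub (h : AsymptoticallyFlat g) (hg : ContDiff ℝ ∞ g)
    (hr : ∀ x, g x ∈ regular) (t : ℝ) (i : Fin 3) :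
    HasDecay t 3 fun x => superpotential g i x - ∑ j : Fin 3,
      ((pd j.succ g x).1 i.succ j.succ - (pd i.succ g x).1 j.succ j.succ) := by
  have hs : ∀ j : Fin 3, sgn j.succ = 1 := fun j => by simp [sgn]
  have e : (fun x => superpotential g i x - ∑ j : Fin 3,
      ((pd j.succ g x).1 i.succ j.succ - (pd i.succ g x).1 j.succ j.succ)) = fun x =>
      ∑ j : Fin 3, ∑ m : Fin 4,
        ((gup (g x) m j.succ * christoffel g i.succ j.succ m x
            - gup minkowski m j.succ * flatChristoffel g i.succ j.succ m x)
          - (gup (g x) m i.succ * christoffel g j.succ j.succ m x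
            - gup minkowski m i.succ * flatChristoffel g j.succ j.succ m x))
      - ∑ j : Fin 3, theta i.succ j.succ (g x) (pd j.succ g x) := by
    funext x
    have hflat : ∑ j : Fin 3, ((pd j.succ g x).1 i.succ j.succ - (pd i.succ g x).1 j.succ j.succ) =
        ∑ j : Fin 3, ∑ m : Fin 4, (gup minkowski m j.succ * flatChristoffel g i.succ j.succ m x
          - gup minkowski m i.succ * flatChristoffel g j.succ j.succ m x) := by
      refine Finset.sum_congr rfl fun j _ => ?_
      simp only [gup_minkowski, ite_mul, zero_mul, Finset.sum_sub_distrib, Finset.sum_ite_eq',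
        Finset.mem_univ, if_true, flatChristoffel_eq, hs]
      rw [(pd j.succ g x).2 j.succ i.succ]
      ring
    rw [superpotential_eq hg (hr x), gammaSuperpotential_eq, hflat]
    simp only [Finset.sum_sub_distrib]
    ring
  rw [e]
  exact (HasDecay.sum fun j _ => HasDecay.sum fun m _ =>
      (h.hasDecay_gup_mul_christoffel_sub _ _ _ _ _).sub
      (h.hasDecay_gup_mul_christoffel_sub _ _ _ _ _)).sub
    (HasDecay.sum fun j _ => (h.hasDecay_theta _ _).clm_apply (h.hasDecay_pd t _))

/-- At large radius the flux of the superpotential is the ADM integral. -/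
theorem tendsto_flux_sub_admFlux (h : AsymptoticallyFlat g) (hg : ContDiff ℝ ∞ g)
    (hr : ∀ x, g x ∈ regular) (t : ℝ) :
    Tendsto (fun r => sphereFlux (fun x i => superpotential g i (event t x)) r - admFlux g t r)
      atTop (𝓝 0) := by
  have hpd : ∀ κ, Continuous (pd κ g) := fun κ =>
    continuous_iff_continuousAt.2 fun x => (contDiffAt_pd_top (hg.contDiffAt (x := x))).continuousAt
  have he := (contDiff_event t).continuous
  refine (tendsto_sphereFlux_zero fun i => h.hasDecay_superpotential_sub hg hr t i).congr fun r => ?_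
  refine sphereFlux_sub (fun i => ((contDiff_superpotential hg hr i).continuous.comp he))
    (fun i => continuous_finsetSum _ fun j _ => ?_) r
  exact (((entry i.succ j.succ).continuous.comp (hpd j.succ)).comp he).sub
    (((entry j.succ j.succ).continuous.comp (hpd i.succ)).comp he)

end AsymptoticallyFlat

/-- A continuous function on a slice which is `O(r⁻⁴)` is integrable. -/
theorem HasDecay.integrable {f : Spacetime → ℝ} (h : HasDecay t 4 f) (hf : Continuous f) :
    Integrable fun x : Space => f (event t x) := by
  have hc : Continuous fun x : Space => f (event t x) := hf.comp (contDiff_event t).continuous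
  have hdim : (Module.finrank ℝ Space : ℝ) < 4 := by
    rw [finrank_euclideanSpace_fin]; norm_num
  refine hc.locallyIntegrable.integrable_of_isBigO_cocompact
    (g := fun x : Space => (1 + ‖x‖) ^ (-(4 : ℝ))) ?_
    ((integrable_one_add_norm (μ := (volume : Measure Space)) hdim).integrableAtFilter _)
  rw [← Metric.cobounded_eq_cocompact]
  refine IsBigO.trans h (IsBigO.of_bound 16 ?_)
  filter_upwards [tendsto_norm_cobounded_atTop.eventually_ge_atTop 1] with x hx
  have h0 : 0 < ‖x‖ := one_pos.trans_le hx
  rw [Real.rpow_neg (by positivity), show (4 : ℝ) = ((4 : ℕ) : ℝ) by norm_num, Real.rpow_natCast,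
    Real.norm_of_nonneg (by positivity), Real.norm_of_nonneg (by positivity),
    ← div_eq_mul_inv, inv_le_iff_one_le_mul₀ (by positivity), div_mul_eq_mul_div, one_le_div (by positivity)]
  calc (1 + ‖x‖) ^ 4 ≤ (2 * ‖x‖) ^ 4 := by gcongr; linarith
    _ = _ := by ring

theorem tendsto_integral_ball {f : Space → ℝ} (hf : Integrable f) :
    Tendsto (fun r : ℝ => ∫ x in Metric.ball (0 : Space) r, f x) atTop (𝓝 (∫ x, f x)) :=
  (aecover_ball tendsto_id).integral_tendsto_of_countably_generated hf

/-- Without matter, the energy of an asymptotically flat solution is the ADM energy. -/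
theorem energy_eq_adm (hg : ContDiff ℝ ∞ g) (hr : ∀ x, g x ∈ regular)
    (h : AsymptoticallyFlat g) (hs : OnShell lagrangianK g) (t : ℝ) :
    Integrable (fun x : Space => energyDensity lagrangianK g (event t x)) ∧
    Tendsto (fun r : ℝ => admFlux g t r) atTop
      (𝓝 (∫ x : Space, energyDensity lagrangianK g (event t x))) := by
  have hE : ∀ x, energyDensity lagrangianK g x =
      ∑ i : Fin 3, pd i.succ (superpotential g i) x := fun x => by
    rw [energyDensity_lagrangianK hg hr, einstein_eq_zero_of_onShell hg hr hs, mul_zero, zero_add]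
  have hcont : Continuous (energyDensity lagrangianK g) := by
    rw [funext hE]
    exact continuous_finsetSum _ fun i _ => continuous_iff_continuousAt.2 fun x =>
      (contDiffAt_pd_top (contDiff_superpotential hg hr i).contDiffAt).continuousAt
  have hint := (h.hasDecay_energyDensity (t := t) hg hr).integrable hcont
  refine ⟨hint, ?_⟩
  have h1 := (tendsto_integral_ball hint).sub (h.tendsto_flux_sub_admFlux hg hr t)
  rw [sub_zero] at h1
  refine h1.congr' ?_
  filter_upwards [eventually_ge_atTop 0] with r hr0
  simp only [hE]
  rw [integral_ball_sum_pd (contDiff_superpotential hg hr) t hr0]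
  ring

end

section

/-! ### Coupling to matter -/

section Coupling

variable {W V : Type*} [NormedAddCommGroup W] [NormedSpace ℝ W] [NormedAddCommGroup V]
  [NormedSpace ℝ V]

/-- The values of the first of two fields and of its gradient. -/
def fieldPart : (W × V) × (Fin 4 → W × V) →L[ℝ] W × (Fin 4 → W) :=
  ((ContinuousLinearMap.fst ℝ W V).comp (ContinuousLinearMap.fst ℝ _ _)).prod
    (ContinuousLinearMap.pi fun μ => (ContinuousLinearMap.fst ℝ W V).comp
      ((ContinuousLinearMap.proj (R := ℝ) (φ := fun _ : Fin 4 => W × V) μ).comp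
        (ContinuousLinearMap.snd ℝ _ _)))

/-- The values of two fields and of the gradient of the second one. -/
def matterPart : (W × V) × (Fin 4 → W × V) →L[ℝ] W × V × (Fin 4 → V) :=
  ((ContinuousLinearMap.fst ℝ W V).comp (ContinuousLinearMap.fst ℝ _ _)).prod
    (((ContinuousLinearMap.snd ℝ W V).comp (ContinuousLinearMap.fst ℝ _ _)).prod
      (ContinuousLinearMap.pi fun μ => (ContinuousLinearMap.snd ℝ W V).comp
        ((ContinuousLinearMap.proj (R := ℝ) (φ := fun _ : Fin 4 => W × V) μ).comp
          (ContinuousLinearMap.snd ℝ _ _))))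

theorem fieldPart_apply (p : (W × V) × (Fin 4 → W × V)) :
    fieldPart p = (p.1.1, fun μ => (p.2 μ).1) := rfl

theorem matterPart_apply (p : (W × V) × (Fin 4 → W × V)) :
    matterPart p = (p.1.1, p.1.2, fun μ => (p.2 μ).2) := rfl

theorem fieldPart_single (μ : Fin 4) (w : W × V) :
    fieldPart (0, Pi.single μ w) = (0, Pi.single μ w.1) := by
  refine Prod.ext rfl (funext fun κ => ?_)
  by_cases h : κ = μ
  · subst h; simp [fieldPart_apply]
  · simp [fieldPart_apply, Pi.single_eq_of_ne h]

theorem matterPart_single (μ : Fin 4) (w : W × V) :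
    matterPart (0, Pi.single μ w) = (0, 0, Pi.single μ w.2) := by
  refine Prod.ext rfl (Prod.ext rfl (funext fun κ => ?_))
  by_cases h : κ = μ
  · subst h; simp [matterPart_apply]
  · simp [matterPart_apply, Pi.single_eq_of_ne h]

/-- A 1-form in the first of two fields. -/
def liftForm (θ : W → W →L[ℝ] ℝ) (w : W × V) : W × V →L[ℝ] ℝ :=
  (θ w.1).comp (ContinuousLinearMap.fst ℝ W V)

theorem liftForm_eq (θ : W → W →L[ℝ] ℝ) : (liftForm θ : W × V → W × V →L[ℝ] ℝ) =
    fun w => (ContinuousLinearMap.compL ℝ (W × V) W ℝ).flip (ContinuousLinearMap.fst ℝ W V)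
      (θ w.1) := rfl

theorem contDiffAt_liftForm {θ : W → W →L[ℝ] ℝ} {w : W × V} (h : ContDiffAt ℝ ∞ θ w.1) :
    ContDiffAt ℝ ∞ (liftForm θ : W × V → W × V →L[ℝ] ℝ) w := by
  rw [liftForm_eq]
  exact ((ContinuousLinearMap.compL ℝ (W × V) W ℝ).flip
    (ContinuousLinearMap.fst ℝ W V)).contDiff.contDiffAt.comp w
    (ContDiffAt.comp w (g := θ) h contDiffAt_fst)

theorem fderiv_liftForm {θ : W → W →L[ℝ] ℝ} {w : W × V} (h : ContDiffAt ℝ ∞ θ w.1)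
    (u v : W × V) :
    fderiv ℝ (liftForm θ : W × V → W × V →L[ℝ] ℝ) w u v = fderiv ℝ θ w.1 u.1 v.1 := by
  have h1 : HasFDerivAt (fun w : W × V => θ w.1)
      ((fderiv ℝ θ w.1).comp (ContinuousLinearMap.fst ℝ W V)) w :=
    HasFDerivAt.comp w (g := θ) (f := Prod.fst) (h.differentiableAt (by simp)).hasFDerivAt
      hasFDerivAt_fst
  have h2 := ((ContinuousLinearMap.compL ℝ (W × V) W ℝ).flip
    (ContinuousLinearMap.fst ℝ W V)).hasFDerivAt.comp w h1
  rw [liftForm_eq]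
  rw [HasFDerivAt.fderiv (f := fun w : W × V => (ContinuousLinearMap.compL ℝ (W × V) W ℝ).flip
    (ContinuousLinearMap.fst ℝ W V) (θ w.1)) h2]
  rfl

variable {L : Jet W → ℝ} {ℓ : W × (Fin 4 → W) → ℝ} {θ : Fin 4 → Fin 4 → W → W →L[ℝ] ℝ}
  {O : Set (W × (Fin 4 → W))} {U : Set W} {Lm : W × V × (Fin 4 → V) → ℝ}
  {D : Set (W × V × (Fin 4 → V))}

/-- The sum of a Lagrangian for the first field and of a first order Lagrangian for the second field
which does not depend on the derivatives of the first one. -/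
def coupled (L : Jet W → ℝ) (Lm : W × V × (Fin 4 → V) → ℝ) (j : Jet (W × V)) : ℝ :=
  L (j.1.1, fun μ => (j.2.1 μ).1, fun μ ν => (j.2.2 μ ν).1)
    + Lm (j.1.1, j.1.2, fun μ => (j.2.1 μ).2)

/-- Adding a first order matter Lagrangian preserves the property of being first order up to
divergences. -/
theorem HasDivergenceForm.couple (h : HasDivergenceForm L ℓ θ O U) (hD : IsOpen D)
    (hLm : ContDiffOn ℝ ∞ Lm D) :
    HasDivergenceForm (coupled L Lm)
      (fun p => ℓ (fieldPart p) + Lm (matterPart p)) (fun μ a => liftForm (θ μ a))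
      (fieldPart ⁻¹' O ∩ matterPart ⁻¹' D) (Prod.fst ⁻¹' U) where
  isOpen_fst := (h.isOpen_fst.preimage fieldPart.continuous).inter
    (hD.preimage matterPart.continuous)
  isOpen_snd := h.isOpen_snd.preimage continuous_fst
  contDiffOn_fst := (h.contDiffOn_fst.comp fieldPart.contDiff.contDiffOn fun _ hp => hp.1).add
    (hLm.comp matterPart.contDiff.contDiffOn fun _ hp => hp.2)
  contDiffOn_snd := fun μ a w hw =>
    (contDiffAt_liftForm (h.contDiffAt_snd hw μ a)).contDiffWithinAt
  diag := fun μ => by rw [h.diag]; rfl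
  eq := by
    intro j hj hj'
    have e : ∀ μ a, divJet (liftForm (V := V) (θ μ a)) μ a j =
        divJet (θ μ a) μ a (j.1.1, fun μ => (j.2.1 μ).1, fun μ ν => (j.2.2 μ ν).1) := by
      intro μ a
      rw [divJet, divJet, fderiv_liftForm (h.contDiffAt_snd hj' μ a)]
      rfl
    simp only [e]
    rw [coupled, h.eq (j.1.1, fun μ => (j.2.1 μ).1, fun μ ν => (j.2.2 μ ν).1) hj.1 hj', fieldPart_apply,
      matterPart_apply]
    ring

theorem fderiv_couple {p : (W × V) × (Fin 4 → W × V)}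
    (hℓ : DifferentiableAt ℝ ℓ (fieldPart p)) (hLm : DifferentiableAt ℝ Lm (matterPart p))
    (k : (W × V) × (Fin 4 → W × V)) :
    fderiv ℝ (fun p => ℓ (fieldPart p) + Lm (matterPart p)) p k =
      fderiv ℝ ℓ (fieldPart p) (fieldPart k) + fderiv ℝ Lm (matterPart p) (matterPart k) := by
  have h := (HasFDerivAt.comp p (f := fieldPart) hℓ.hasFDerivAt
      (fieldPart (W := W) (V := V)).hasFDerivAt).add
    (HasFDerivAt.comp p (f := matterPart) hLm.hasFDerivAt
      (matterPart (W := W) (V := V)).hasFDerivAt)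
  rw [HasFDerivAt.fderiv (f := fun p => ℓ (fieldPart p) + Lm (matterPart p)) h]
  rfl

variable {g : Spacetime → W} {ψ : Spacetime → V} {x : Spacetime}

theorem pd_prodMk (hg : DifferentiableAt ℝ g x) (hψ : DifferentiableAt ℝ ψ x) (μ : Fin 4) :
    pd μ (fun y => (g y, ψ y)) x = (pd μ g x, pd μ ψ x) := by
  simp only [pd, hg.fderiv_prodMk hψ]
  rfl

theorem fieldPart_jet (hg : ContDiff ℝ ∞ g) (hψ : ContDiff ℝ ∞ ψ) (x : Spacetime) :
    fieldPart ((g x, ψ x), grad (fun y => (g y, ψ y)) x) = (g x, grad g x) := by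
  rw [fieldPart_apply]
  simp only [grad, pd_prodMk (hg.differentiable (by simp) x) (hψ.differentiable (by simp) x)]
  rfl

theorem matterPart_jet (hg : ContDiff ℝ ∞ g) (hψ : ContDiff ℝ ∞ ψ) (x : Spacetime) :
    matterPart ((g x, ψ x), grad (fun y => (g y, ψ y)) x) = (g x, ψ x, grad ψ x) := by
  rw [matterPart_apply]
  simp only [grad, pd_prodMk (hg.differentiable (by simp) x) (hψ.differentiable (by simp) x)]
  rfl

theorem HasDivergenceForm.fderiv_couple_jet (h : HasDivergenceForm L ℓ θ O U) (hD : IsOpen D)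
    (hLm : ContDiffOn ℝ ∞ Lm D) (hg : ContDiff ℝ ∞ g) (hψ : ContDiff ℝ ∞ ψ)
    (hO : ∀ x, (g x, grad g x) ∈ O) (hp : ∀ x, (g x, ψ x, grad ψ x) ∈ D) (y : Spacetime)
    (k : (W × V) × (Fin 4 → W × V)) :
    fderiv ℝ (fun p => ℓ (fieldPart p) + Lm (matterPart p))
      ((g y, ψ y), grad (fun y => (g y, ψ y)) y) k =
      fderiv ℝ ℓ (g y, grad g y) (fieldPart k)
        + fderiv ℝ Lm (g y, ψ y, grad ψ y) (matterPart k) := by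
  have h1 := (h.contDiffAt_fst (hO y)).differentiableAt (by simp)
  have h2 := (hLm.contDiffAt (hD.mem_nhds (hp y))).differentiableAt (by simp)
  rw [fderiv_couple (by rw [fieldPart_jet hg hψ]; exact h1)
    (by rw [matterPart_jet hg hψ]; exact h2), fieldPart_jet hg hψ, matterPart_jet hg hψ]

/-- The Euler-Lagrange derivative of coupled fields. -/
theorem HasDivergenceForm.eulerLagrange_couple (h : HasDivergenceForm L ℓ θ O U) (hD : IsOpen D)
    (hLm : ContDiffOn ℝ ∞ Lm D) (hg : ContDiff ℝ ∞ g) (hψ : ContDiff ℝ ∞ ψ)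
    (hO : ∀ x, (g x, grad g x) ∈ O) (hU : ∀ x, g x ∈ U) (hp : ∀ x, (g x, ψ x, grad ψ x) ∈ D)
    (x : Spacetime) (w : W) (v : V) :
    eulerLagrange (coupled L Lm) (fun y => (g y, ψ y)) x (w, v) =
      eulerLagrange L g x w + fderiv ℝ Lm (g x, ψ x, grad ψ x) (w, v, 0)
      - ∑ μ, pd μ (fun y => fderiv ℝ Lm (g y, ψ y, grad ψ y) (0, 0, Pi.single μ v)) x := by
  have hk := h.fderiv_couple_jet hD hLm hg hψ hO hp
  have hL : ∀ μ, DifferentiableAt ℝ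
      (fun y => fderiv ℝ ℓ (g y, grad g y) (0, Pi.single μ w)) x := fun μ =>
    (ContDiffAt.clm_apply (ContDiffAt.comp x (g := fderiv ℝ ℓ) (n := ∞)
      ((h.contDiffAt_fst (hO x)).fderiv_right (by simp))
      (hg.contDiffAt.prodMk (contDiffAt_grad_top hg.contDiffAt)))
      contDiffAt_const).differentiableAt (by simp)
  have hM : ∀ μ, DifferentiableAt ℝ
      (fun y => fderiv ℝ Lm (g y, ψ y, grad ψ y) (0, 0, Pi.single μ v)) x := fun μ =>
    (ContDiffAt.clm_apply (ContDiffAt.comp x (g := fderiv ℝ Lm) (n := ∞)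
      ((hLm.contDiffAt (hD.mem_nhds (hp x))).fderiv_right (by simp))
      (hg.contDiffAt.prodMk (hψ.contDiffAt.prodMk (contDiffAt_grad_top hψ.contDiffAt))))
      contDiffAt_const).differentiableAt (by simp)
  have hO' : ∀ y, ((g y, ψ y), grad (fun y => (g y, ψ y)) y) ∈
      (fieldPart ⁻¹' O ∩ matterPart ⁻¹' D : Set ((W × V) × (Fin 4 → W × V))) := fun y =>
    ⟨by rw [Set.mem_preimage, fieldPart_jet hg hψ]; exact hO y,
      by rw [Set.mem_preimage, matterPart_jet hg hψ]; exact hp y⟩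
  rw [(h.couple hD hLm).eulerLagrange_eq (hg.prodMk hψ) hO' hU, h.eulerLagrange_eq hg hO hU]
  simp only [hk, fieldPart_single, matterPart_single]
  simp only [pd_add (hL _) (hM _), Finset.sum_add_distrib, fieldPart_apply, matterPart_apply,
    Pi.zero_apply, Prod.fst_zero, Prod.snd_zero]
  simp only [← Pi.zero_def]
  ring

/-- The Noether energy density of coupled fields: the matter contributes the Legendre transform of
its Lagrangian. -/
theorem HasDivergenceForm.energyDensity_couple (h : HasDivergenceForm L ℓ θ O U) (hD : IsOpen D)
    (hLm : ContDiffOn ℝ ∞ Lm D) (hg : ContDiff ℝ ∞ g) (hψ : ContDiff ℝ ∞ ψ)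
    (hO : ∀ x, (g x, grad g x) ∈ O) (hU : ∀ x, g x ∈ U) (hp : ∀ x, (g x, ψ x, grad ψ x) ∈ D)
    (x : Spacetime) :
    energyDensity (coupled L Lm) (fun y => (g y, ψ y)) x = energyDensity L g x
      + fderiv ℝ Lm (g x, ψ x, grad ψ x) (0, 0, Pi.single 0 (pd 0 ψ x))
      - Lm (g x, ψ x, grad ψ x) := by
  have hpd : ∀ μ y, pd μ (fun y => (g y, ψ y)) y = (pd μ g y, pd μ ψ y) := fun μ y =>
    pd_prodMk (hg.differentiable (by simp) y) (hψ.differentiable (by simp) y) μ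
  have hO' : ∀ y, ((g y, ψ y), grad (fun y => (g y, ψ y)) y) ∈
      (fieldPart ⁻¹' O ∩ matterPart ⁻¹' D : Set ((W × V) × (Fin 4 → W × V))) := fun y =>
    ⟨by rw [Set.mem_preimage, fieldPart_jet hg hψ]; exact hO y,
      by rw [Set.mem_preimage, matterPart_jet hg hψ]; exact hp y⟩
  rw [(h.couple hD hLm).energyDensity_eq (hg.prodMk hψ) hO' hU, h.energyDensity_eq hg hO hU,
    h.fderiv_couple_jet hD hLm hg hψ hO hp, fieldPart_single, matterPart_single,
    fieldPart_jet hg hψ, matterPart_jet hg hψ]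
  simp only [hpd, liftForm, ContinuousLinearMap.comp_apply, ContinuousLinearMap.coe_fst']
  ring

end Coupling

end

section

/-! ### The energy of matter -/

variable {V : Type*} [NormedAddCommGroup V] [NormedSpace ℝ V]
  {D : Set (SymTensor × V × (Fin 4 → V))} {Lm : SymTensor × V × (Fin 4 → V) → ℝ}
  {g : Spacetime → SymTensor} {ψ : Spacetime → V}
  {ρ : Matrix (Fin 4) (Fin 4) ℝ →ₗ[ℝ] Module.End ℝ V}

/-- The infinitesimal diffeomorphism `(b (t - t₀) + c (t - t₀)² / 2) ∂_t`. -/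
def timeShift (b c t₀ : ℝ) (y : Spacetime) : Fin 4 → ℝ :=
  (b * (y 0 - t₀) + c / 2 * (y 0 - t₀) ^ 2) • Pi.single 0 1

theorem hasFDerivAt_time (t₀ : ℝ) (x : Spacetime) : HasFDerivAt (fun y : Spacetime => y 0 - t₀)
    (ContinuousLinearMap.proj (R := ℝ) (φ := fun _ : Fin 4 => ℝ) 0) x :=
  ((ContinuousLinearMap.proj (R := ℝ) (φ := fun _ : Fin 4 => ℝ) 0).hasFDerivAt).sub_const t₀

theorem contDiff_timeShift (b c t₀ : ℝ) : ContDiff ℝ ∞ (timeShift b c t₀) := by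
  unfold timeShift
  fun_prop

theorem contDiff_timeShift_coeff (b c t₀ : ℝ) :
    ContDiff ℝ ∞ fun y : Spacetime => b * (y 0 - t₀) + c / 2 * (y 0 - t₀) ^ 2 := by
  fun_prop

theorem pd_timeShift_coeff (b c t₀ : ℝ) (κ : Fin 4) (y : Spacetime) :
    pd κ (fun y : Spacetime => b * (y 0 - t₀) + c / 2 * (y 0 - t₀) ^ 2) y =
      if κ = 0 then b + c * (y 0 - t₀) else 0 := by
  have h := hasFDerivAt_time t₀ y
  have h1 : HasFDerivAt (fun y : Spacetime => b * (y 0 - t₀) + c / 2 * (y 0 - t₀) ^ 2) _ y :=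
    (h.const_mul b).fun_add ((h.pow 2).const_mul (c / 2))
  rw [pd, h1.fderiv]
  by_cases hκ : κ = 0
  · subst hκ
    simp
    ring
  · simp [hκ]

theorem pd_timeShift (b c t₀ : ℝ) (κ : Fin 4) (y : Spacetime) :
    pd κ (timeShift b c t₀) y =
      if κ = 0 then (b + c * (y 0 - t₀)) • (Pi.single 0 1 : Fin 4 → ℝ) else 0 := by
  rw [show timeShift b c t₀ = fun y : Spacetime => (b * (y 0 - t₀) + c / 2 * (y 0 - t₀) ^ 2) •
    (Pi.single 0 1 : Fin 4 → ℝ) from rfl,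
    pd_smul ((contDiff_timeShift_coeff b c t₀).differentiable (by simp) y)
      (differentiableAt_const _), pd_const, smul_zero, pd_timeShift_coeff]
  split_ifs <;> simp

/-- At time `t₀` the vector field vanishes and only its first derivative `b` contributes. -/
theorem lieMetric_timeShift (b c : ℝ) (x : Spacetime) :
    lieMetric (timeShift b c (x 0)) g x = b • timeLowering (g x) := by
  refine Subtype.ext (funext fun μ => funext fun ν => ?_)
  have h0 : timeShift b c (x 0) x = 0 := by simp [timeShift]
  have e : (b • timeLowering (g x)).1 μ ν = b * (timeLowering (g x)).1 μ ν := rfl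
  rw [e, timeLowering_apply]
  simp only [lieMetric, h0, pd_timeShift, sub_self, mul_zero, add_zero, Pi.zero_apply, zero_mul,
    zero_add]
  rw [(g x).2 ν 0]
  by_cases hμ : μ = 0 <;> by_cases hν : ν = 0 <;>
    simp [hμ, hν, Finset.sum_add_distrib, Pi.single_apply] <;> ring

theorem lieMatter_timeShift (b c t₀ : ℝ) (y : Spacetime) :
    lieMatter ρ (timeShift b c t₀) ψ y =
      (b * (y 0 - t₀) + c / 2 * (y 0 - t₀) ^ 2) • pd 0 ψ y
      - (b + c * (y 0 - t₀)) • ρ (Matrix.single 0 0 1) (ψ y) := by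
  have e1 : ∑ μ, timeShift b c t₀ y μ • pd μ ψ y =
      (b * (y 0 - t₀) + c / 2 * (y 0 - t₀) ^ 2) • pd 0 ψ y := by
    rw [Finset.sum_eq_single 0]
    · simp [timeShift]
    · intro μ _ hμ
      simp [timeShift, hμ]
    · simp
  have e2 : (Matrix.of fun μ ν => pd ν (timeShift b c t₀) y μ) =
      (b + c * (y 0 - t₀)) • Matrix.single (0 : Fin 4) (0 : Fin 4) (1 : ℝ) := by
    ext μ ν
    rw [Matrix.of_apply, pd_timeShift]
    by_cases hν : ν = 0 <;> by_cases hμ : μ = 0 <;> simp [hν, hμ, eq_comm]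
  rw [lieMatter, e1, e2, map_smul, LinearMap.smul_apply]

variable [FiniteDimensional ℝ V]

theorem contDiff_rep (hψ : ContDiff ℝ ∞ ψ) (M : Matrix (Fin 4) (Fin 4) ℝ) :
    ContDiff ℝ ∞ fun y => ρ M (ψ y) :=
  (LinearMap.toContinuousLinearMap (ρ M)).contDiff.comp hψ

theorem pd_rep (hψ : ContDiff ℝ ∞ ψ) (M : Matrix (Fin 4) (Fin 4) ℝ) (μ : Fin 4) (x : Spacetime) :
    pd μ (fun y => ρ M (ψ y)) x = ρ M (pd μ ψ x) :=
  pd_clm (LinearMap.toContinuousLinearMap (ρ M)) (hψ.differentiable (by simp) x)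

theorem grad_lieMatter_timeShift (hψ : ContDiff ℝ ∞ ψ) (b c : ℝ) (x : Spacetime) :
    grad (lieMatter ρ (timeShift b c (x 0)) ψ) x =
      b • ((Pi.single 0 (pd 0 ψ x) : Fin 4 → V) - fun μ => ρ (Matrix.single 0 0 1) (pd μ ψ x))
      - c • (Pi.single 0 (ρ (Matrix.single 0 0 1) (ψ x)) : Fin 4 → V) := by
  funext μ
  have h1 : DifferentiableAt ℝ (fun y : Spacetime => b * (y 0 - x 0) + c / 2 * (y 0 - x 0) ^ 2) x :=
    (contDiff_timeShift_coeff b c (x 0)).differentiable (by simp) x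
  have h2 : DifferentiableAt ℝ (fun y : Spacetime => b + c * (y 0 - x 0)) x := by fun_prop
  have h3 : DifferentiableAt ℝ (pd 0 ψ) x :=
    (contDiffAt_pd_top hψ.contDiffAt).differentiableAt (by simp)
  have h4 : DifferentiableAt ℝ (fun y => ρ (Matrix.single 0 0 1) (ψ y)) x :=
    (contDiff_rep hψ _).differentiable (by simp) x
  have h5 : pd μ (fun y : Spacetime => b + c * (y 0 - x 0)) x = if μ = 0 then c else 0 := by
    rw [pd, HasFDerivAt.fderiv (((hasFDerivAt_time (x 0) x).const_mul c).const_add b)]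
    by_cases hμ : μ = 0
    · subst hμ; simp
    · simp [hμ]
  rw [grad, show lieMatter ρ (timeShift b c (x 0)) ψ = _ from
    funext fun y => lieMatter_timeShift b c (x 0) y,
    pd_sub (h1.fun_smul h3) (h2.fun_smul h4), pd_smul h1 h3, pd_smul h2 h4, h5,
    pd_timeShift_coeff, pd_rep hψ]
  by_cases hμ : μ = 0
  · subst hμ
    simp [smul_sub]
    abel
  · simp [hμ]

/-- The consequence of diffeomorphism invariance for the diffeomorphisms `timeShift`, at time `t₀`. Of
all the variations only that of `∂_0 ψ` depends on `c`. -/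
theorem IsScalarDensity.fderiv_timeShift (h : IsScalarDensity ρ D Lm) (hD : IsOpen D)
    (hLm : ContDiffOn ℝ ∞ Lm D) (hg : ContDiff ℝ ∞ g) (hψ : ContDiff ℝ ∞ ψ)
    (hp : ∀ x, (g x, ψ x, grad ψ x) ∈ D) (b c : ℝ) (x : Spacetime) :
    fderiv ℝ Lm (g x, ψ x, grad ψ x) (b • timeLowering (g x),
      -(b • ρ (Matrix.single 0 0 1) (ψ x)),
      b • ((Pi.single 0 (pd 0 ψ x) : Fin 4 → V) - fun μ => ρ (Matrix.single 0 0 1) (pd μ ψ x))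
      - c • (Pi.single 0 (ρ (Matrix.single 0 0 1) (ψ x)) : Fin 4 → V)) = b * Lm (g x, ψ x, grad ψ x) := by
  have h1 := h g ψ (timeShift b c (x 0)) hg hψ (contDiff_timeShift b c (x 0)) x (hp x)
  have hL : DifferentiableAt ℝ (fun y => Lm (g y, ψ y, grad ψ y)) x :=
    (ContDiffAt.comp x (g := Lm) (hLm.contDiffAt (hD.mem_nhds (hp x)))
      (hg.contDiffAt.prodMk (hψ.contDiffAt.prodMk
        (contDiffAt_grad_top hψ.contDiffAt)))).differentiableAt (by simp)
  have hε : ∀ μ, DifferentiableAt ℝ (fun y => timeShift b c (x 0) y μ) x := fun μ =>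
    ((contDiff_pi.1 (contDiff_timeShift b c (x 0)) μ).differentiable (by simp)) x
  have h0 : timeShift b c (x 0) x = 0 := by simp [timeShift]
  have e : ∀ μ, pd μ (fun y => timeShift b c (x 0) y μ * Lm (g y, ψ y, grad ψ y)) x =
      if μ = 0 then b * Lm (g x, ψ x, grad ψ x) else 0 := by
    intro μ
    have h2 : pd μ (fun y => timeShift b c (x 0) y μ) x =
        pd μ (timeShift b c (x 0)) x μ := by
      rw [pd_pi ((contDiff_timeShift b c (x 0)).differentiable (by simp) x)]
    rw [pd_mul (hε μ) hL, h2, pd_timeShift, h0]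
    by_cases hμ : μ = 0
    · subst hμ; simp
    · simp [hμ]
  rw [lieMetric_timeShift, lieMatter_timeShift, grad_lieMatter_timeShift hψ] at h1
  simp only [e, Finset.sum_ite_eq', Finset.mem_univ, if_true] at h1
  rw [← h1]
  simp

end

section

/-! ### The energy of gravity with matter -/

variable {V : Type*} [NormedAddCommGroup V] [NormedSpace ℝ V]
  {D : Set (SymTensor × V × (Fin 4 → V))} {Lm : SymTensor × V × (Fin 4 → V) → ℝ}
  {g : Spacetime → SymTensor} {ψ : Spacetime → V}
  {ρ : Matrix (Fin 4) (Fin 4) ℝ →ₗ[ℝ] Module.End ℝ V}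

/-- The metric derivative of the matter Lagrangian in the direction `timeLowering` is `16π T_0^0`. -/
theorem fderiv_timeLowering (x : Spacetime) :
    fderiv ℝ Lm (g x, ψ x, grad ψ x) (timeLowering (g x), 0, 0) =
      16 * Real.pi * energyMomentum Lm g ψ 0 0 x := by
  have e : ((timeLowering (g x), 0, 0) : SymTensor × V × (Fin 4 → V)) =
      ∑ σ, (2 * (g x).1 σ 0) • ((symUnit 0 σ, 0, 0) : SymTensor × V × (Fin 4 → V)) := by
    simp [Prod.ext_iff, timeLowering, Prod.fst_sum, Prod.snd_sum]
  rw [e, map_sum, energyMomentum]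
  simp only [map_smul, smul_eq_mul, Finset.mul_sum]
  refine Finset.sum_congr rfl fun σ _ => ?_
  have := Real.pi_ne_zero
  field_simp
  ring

theorem eulerLagrange_totalLagrangian (hg : ContDiff ℝ ∞ g) (hr : ∀ x, g x ∈ regular)
    (hD : IsOpen D) (hLm : ContDiffOn ℝ ∞ Lm D) (hψ : ContDiff ℝ ∞ ψ)
    (hp : ∀ x, (g x, ψ x, grad ψ x) ∈ D) (x : Spacetime) (w : SymTensor) (v : V) :
    eulerLagrange (totalLagrangian Lm) (fun y => (g y, ψ y)) x (w, v) =
      einsteinPairing g x w + fderiv ℝ Lm (g x, ψ x, grad ψ x) (w, v, 0)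
      - ∑ μ, pd μ (fun y => fderiv ℝ Lm (g y, ψ y, grad ψ y) (0, 0, Pi.single μ v)) x := by
  rw [← eulerLagrange_lagrangianK hg hr]
  exact lagrangianK_hasDivergenceForm.eulerLagrange_couple hD hLm hg hψ (fun y => (hr y).1) hr hp
    x w v

/-- The metric equation of motion tested with `timeLowering`. -/
theorem einstein_eq_of_onShell (hg : ContDiff ℝ ∞ g) (hr : ∀ x, g x ∈ regular)
    (hD : IsOpen D) (hLm : ContDiffOn ℝ ∞ Lm D) (hψ : ContDiff ℝ ∞ ψ)
    (hp : ∀ x, (g x, ψ x, grad ψ x) ∈ D)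
    (h : OnShell (totalLagrangian Lm) fun y => (g y, ψ y)) (x : Spacetime) :
    einstein g 0 0 x = 8 * Real.pi * energyMomentum Lm g ψ 0 0 x := by
  have h1 := h x (timeLowering (g x), 0)
  rw [eulerLagrange_totalLagrangian hg hr hD hLm hψ hp, einsteinPairing_timeLowering hg (hr x).1,
    fderiv_timeLowering] at h1
  have h2 : ∀ μ, pd μ (fun y => fderiv ℝ Lm (g y, ψ y, grad ψ y)
      (0, 0, Pi.single μ (0 : V))) x = 0 := by
    intro μ
    simp only [Pi.single_zero]
    rw [show ((0 : SymTensor), (0 : V), (0 : Fin 4 → V)) = 0 from rfl]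
    simp only [map_zero, pd_const]
  simp only [h2, Finset.sum_const_zero] at h1
  linarith

theorem contDiffAt_fderiv_matter (hg : ContDiff ℝ ∞ g) (hD : IsOpen D)
    (hLm : ContDiffOn ℝ ∞ Lm D) (hψ : ContDiff ℝ ∞ ψ) (hp : ∀ x, (g x, ψ x, grad ψ x) ∈ D)
    (x : Spacetime) : ContDiffAt ℝ ∞ (fun y => fderiv ℝ Lm (g y, ψ y, grad ψ y)) x :=
  ContDiffAt.comp x (g := fderiv ℝ Lm) (n := ∞)
    ((hLm.contDiffAt (hD.mem_nhds (hp x))).fderiv_right (by simp))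
    (hg.contDiffAt.prodMk (hψ.contDiffAt.prodMk (contDiffAt_grad_top hψ.contDiffAt)))

/-- The momentum `∂Lm/∂ψ_μ` as a linear form on variations of the matter field. -/
def matterMomentum (Lm : SymTensor × V × (Fin 4 → V) → ℝ) (μ : Fin 4)
    (p : SymTensor × V × (Fin 4 → V)) : V →L[ℝ] ℝ :=
  (fderiv ℝ Lm p).comp ((ContinuousLinearMap.inr ℝ SymTensor (V × (Fin 4 → V))).comp
    ((ContinuousLinearMap.inr ℝ V (Fin 4 → V)).comp
      (ContinuousLinearMap.single ℝ (fun _ : Fin 4 => V) μ)))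

theorem matterMomentum_apply (μ : Fin 4) (p : SymTensor × V × (Fin 4 → V)) (v : V) :
    matterMomentum Lm μ p v = fderiv ℝ Lm p (0, 0, Pi.single μ v) := rfl

theorem contDiffAt_matterMomentum (hg : ContDiff ℝ ∞ g) (hD : IsOpen D)
    (hLm : ContDiffOn ℝ ∞ Lm D) (hψ : ContDiff ℝ ∞ ψ) (hp : ∀ x, (g x, ψ x, grad ψ x) ∈ D)
    (μ : Fin 4) (x : Spacetime) :
    ContDiffAt ℝ ∞ (fun y => matterMomentum Lm μ (g y, ψ y, grad ψ y)) x :=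
  (contDiffAt_fderiv_matter hg hD hLm hψ hp x).clm_comp contDiffAt_const

theorem sum_fderiv_single (p : SymTensor × V × (Fin 4 → V)) (u : Fin 4 → V) :
    fderiv ℝ Lm p (0, 0, u) = ∑ μ, matterMomentum Lm μ p (u μ) := by
  have e : ((0, 0, u) : SymTensor × V × (Fin 4 → V)) =
      ∑ μ, ((0, 0, Pi.single μ (u μ)) : SymTensor × V × (Fin 4 → V)) := by
    simp [Prod.ext_iff, Prod.fst_sum, Prod.snd_sum, Finset.univ_sum_single]
  rw [e, map_sum]
  rfl

variable [FiniteDimensional ℝ V]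

theorem contDiff_matterFlux (hg : ContDiff ℝ ∞ g) (hD : IsOpen D)
    (hLm : ContDiffOn ℝ ∞ Lm D) (hψ : ContDiff ℝ ∞ ψ) (hp : ∀ x, (g x, ψ x, grad ψ x) ∈ D)
    (M : Matrix (Fin 4) (Fin 4) ℝ) (i : Fin 3) : ContDiff ℝ ∞ (matterFlux ρ Lm g ψ M i) :=
  contDiff_iff_contDiffAt.2 fun x =>
    (contDiffAt_matterMomentum hg hD hLm hψ hp i.succ x).clm_apply (contDiff_rep hψ M).contDiffAt

/-- On the matter equations of motion, the energy density of matter is `-16π T_0^0` up to a spatial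
divergence: diffeomorphism invariance under `(t - t₀) ∂_t` gives this identity with a full
divergence, whose time part vanishes by invariance under `(t - t₀)² ∂_t / 2`. -/
theorem matter_energy (h : IsScalarDensity ρ D Lm) (hg : ContDiff ℝ ∞ g) (hD : IsOpen D)
    (hLm : ContDiffOn ℝ ∞ Lm D) (hψ : ContDiff ℝ ∞ ψ) (hp : ∀ x, (g x, ψ x, grad ψ x) ∈ D)
    (hm : ∀ x v, fderiv ℝ Lm (g x, ψ x, grad ψ x) (0, v, 0) =
      ∑ μ, pd μ (fun y => fderiv ℝ Lm (g y, ψ y, grad ψ y) (0, 0, Pi.single μ v)) x)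
    (x : Spacetime) :
    fderiv ℝ Lm (g x, ψ x, grad ψ x) (0, 0, Pi.single 0 (pd 0 ψ x)) - Lm (g x, ψ x, grad ψ x) =
      -(16 * Real.pi * energyMomentum Lm g ψ 0 0 x)
      + ∑ i : Fin 3, pd i.succ (matterFlux ρ Lm g ψ (Matrix.single 0 0 1) i) x := by
  set E : Matrix (Fin 4) (Fin 4) ℝ := Matrix.single 0 0 1 with hE
  have hM := fun μ => contDiffAt_matterMomentum hg hD hLm hψ hp μ x
  -- invariance under `(t - t₀)² ∂_t / 2`: there is no time component
  have h0 : ∀ y, matterMomentum Lm 0 (g y, ψ y, grad ψ y) (ρ E (ψ y)) = 0 := by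
    intro y
    have := h.fderiv_timeShift hD hLm hg hψ hp 0 1 y
    simp only [zero_smul, one_smul, neg_zero, zero_sub, zero_mul] at this
    rw [matterMomentum_apply, ← neg_eq_zero, ← map_neg]
    simpa using this
  -- invariance under `(t - t₀) ∂_t`
  have h1 := h.fderiv_timeShift hD hLm hg hψ hp 1 0 x
  simp only [one_smul, zero_smul, sub_zero, one_mul] at h1
  have e1 : ((timeLowering (g x), -(ρ E (ψ x)),
      (Pi.single 0 (pd 0 ψ x) : Fin 4 → V) - fun μ => ρ E (pd μ ψ x)) :
        SymTensor × V × (Fin 4 → V)) =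
      (timeLowering (g x), 0, 0) - (0, ρ E (ψ x), 0) + (0, 0, Pi.single 0 (pd 0 ψ x))
        - (0, 0, fun μ => ρ E (pd μ ψ x)) := by
    simp
  rw [e1, map_sub, map_add, map_sub, fderiv_timeLowering, hm,
    sum_fderiv_single _ fun μ => ρ E (pd μ ψ x)] at h1
  have h2 : ∀ μ, pd μ (fun y => matterMomentum Lm μ (g y, ψ y, grad ψ y) (ρ E (ψ y))) x =
      pd μ (fun y => fderiv ℝ Lm (g y, ψ y, grad ψ y) (0, 0, Pi.single μ (ρ E (ψ x)))) x
      + matterMomentum Lm μ (g x, ψ x, grad ψ x) (ρ E (pd μ ψ x)) := by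
    intro μ
    have hd := (hM μ).differentiableAt (by simp)
    rw [pd_clm_apply hd ((contDiff_rep hψ E).differentiable (by simp) x), pd_rep hψ]
    congr 1
    have := pd_clm_apply (μ := μ) hd (differentiableAt_const (ρ E (ψ x)))
    rw [pd_const, map_zero, add_zero] at this
    exact this.symm
  have h3 : ∑ μ, pd μ (fun y => matterMomentum Lm μ (g y, ψ y, grad ψ y) (ρ E (ψ y))) x =
      ∑ i : Fin 3, pd i.succ (matterFlux ρ Lm g ψ E i) x := by
    rw [Fin.sum_univ_succ]
    simp only [h0, pd_const, zero_add]
    rfl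
  rw [← h3]
  simp only [h2, Finset.sum_add_distrib]
  linarith

/-- The energy density of gravity with matter on the matter equations of motion. -/
theorem energyDensity_totalLagrangian (hg : ContDiff ℝ ∞ g) (hr : ∀ x, g x ∈ regular)
    (h : IsScalarDensity ρ D Lm) (hD : IsOpen D) (hLm : ContDiffOn ℝ ∞ Lm D)
    (hψ : ContDiff ℝ ∞ ψ) (hp : ∀ x, (g x, ψ x, grad ψ x) ∈ D)
    (hm : ∀ x v, eulerLagrange (totalLagrangian Lm) (fun y => (g y, ψ y)) x (0, v) = 0)
    (x : Spacetime) : energyDensity (totalLagrangian Lm) (fun y => (g y, ψ y)) x =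
      2 * (einstein g 0 0 x - 8 * Real.pi * energyMomentum Lm g ψ 0 0 x)
      + ∑ i : Fin 3, pd i.succ (fun y => superpotential g i y
          + matterFlux ρ Lm g ψ (Matrix.single 0 0 1) i y) x := by
  have hm' : ∀ x v, fderiv ℝ Lm (g x, ψ x, grad ψ x) (0, v, 0) =
      ∑ μ, pd μ (fun y => fderiv ℝ Lm (g y, ψ y, grad ψ y) (0, 0, Pi.single μ v)) x := by
    intro x v
    have h1 := hm x v
    have h2 : einsteinPairing g x 0 = 0 := by simp [einsteinPairing]
    rw [eulerLagrange_totalLagrangian hg hr hD hLm hψ hp, h2, zero_add] at h1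
    exact sub_eq_zero.1 h1
  have h1 : energyDensity (totalLagrangian Lm) (fun y => (g y, ψ y)) x = _ :=
    lagrangianK_hasDivergenceForm.energyDensity_couple hD hLm hg hψ (fun y => (hr y).1) hr hp x
  have h2 : ∀ i : Fin 3, pd i.succ (fun y => superpotential g i y
      + matterFlux ρ Lm g ψ (Matrix.single 0 0 1) i y) x = pd i.succ (superpotential g i) x
      + pd i.succ (matterFlux ρ Lm g ψ (Matrix.single 0 0 1) i) x := fun i =>
    pd_add ((contDiff_superpotential hg hr i).differentiable (by simp) x)
      ((contDiff_matterFlux hg hD hLm hψ hp _ i).differentiable (by simp) x)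
  rw [h1, add_sub_assoc, matter_energy h hg hD hLm hψ hp hm', energyDensity_lagrangianK hg hr]
  simp only [h2, Finset.sum_add_distrib]
  ring

/-- With matter, the energy in a large ball approaches the ADM integral. -/
theorem tendsto_energy_sub_admFlux (hg : ContDiff ℝ ∞ g) (hr : ∀ x, g x ∈ regular)
    (hflat : AsymptoticallyFlat g)
    (h : IsScalarDensity ρ D Lm) (hD : IsOpen D) (hLm : ContDiffOn ℝ ∞ Lm D)
    (hψ : ContDiff ℝ ∞ ψ) (hp : ∀ x, (g x, ψ x, grad ψ x) ∈ D)
    (hs : OnShell (totalLagrangian Lm) fun y => (g y, ψ y)) (t : ℝ)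
    (hb : Tendsto (sphereFlux fun x i =>
      matterFlux ρ Lm g ψ (Matrix.single 0 0 1) i (event t x)) atTop (𝓝 0)) :
    Tendsto (fun r : ℝ => (∫ x in Metric.ball (0 : Space) r,
      energyDensity (totalLagrangian Lm) (fun y => (g y, ψ y)) (event t x)) - admFlux g t r)
      atTop (𝓝 0) := by
  have hE : ∀ x, energyDensity (totalLagrangian Lm) (fun y => (g y, ψ y)) x =
      ∑ i : Fin 3, pd i.succ (fun y => superpotential g i y
        + matterFlux ρ Lm g ψ (Matrix.single 0 0 1) i y) x := fun x => by
    rw [energyDensity_totalLagrangian hg hr h hD hLm hψ hp fun x v => hs x (0, v),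
      einstein_eq_of_onShell hg hr hD hLm hψ hp hs, sub_self, mul_zero, zero_add]
  have hX := contDiff_superpotential hg hr
  have hF := contDiff_matterFlux (ρ := ρ) hg hD hLm hψ hp (Matrix.single 0 0 1)
  have he := (contDiff_event t).continuous
  have h1 := (hflat.tendsto_flux_sub_admFlux hg hr t).add hb
  rw [add_zero] at h1
  refine h1.congr' ?_
  filter_upwards [eventually_ge_atTop 0] with r hr0
  have h2 := sphereFlux_sub (F := fun x i => superpotential g i (event t x)
      + matterFlux ρ Lm g ψ (Matrix.single 0 0 1) i (event t x))
    (G := fun x i => matterFlux ρ Lm g ψ (Matrix.single 0 0 1) i (event t x))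
    (fun i => ((hX i).continuous.comp he).add ((hF i).continuous.comp he))
    (fun i => (hF i).continuous.comp he) r
  simp only [add_sub_cancel_right] at h2
  simp only [hE]
  rw [integral_ball_sum_pd (fun i => (hX i).add (hF i)) t hr0, h2]
  ring

end

end TraceK

end

theorem mainTheorem3
    (g : TraceK.Spacetime → TraceK.SymTensor) (hg : ContDiff ℝ ∞ g)
    (hadm : ∀ x, TraceK.Admissible (g x)) :
    -- the Noether energy density of the trace K Lagrangian
    (∀ x, TraceK.energyDensity TraceK.lagrangianK g x =
      2 * TraceK.einstein g 0 0 x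
        + ∑ i : Fin 3, TraceK.pd i.succ (TraceK.superpotential g i) x) ∧
    (TraceK.AsymptoticallyFlat g →
      -- pure gravity: the total energy on shell is the ADM energy
      (TraceK.OnShell TraceK.lagrangianK g → ∀ t : ℝ,
        Integrable (fun x : TraceK.Space =>
          TraceK.energyDensity TraceK.lagrangianK g (TraceK.event t x)) volume ∧
        Tendsto (fun r : ℝ => TraceK.admFlux g t r) atTop
          (𝓝 (∫ x : TraceK.Space,
            TraceK.energyDensity TraceK.lagrangianK g (TraceK.event t x)))) ∧
      -- gravity with matter
      (∀ (V : Type*) [NormedAddCommGroup V] [NormedSpace ℝ V] [FiniteDimensional ℝ V]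
        (ρ : Matrix (Fin 4) (Fin 4) ℝ →ₗ[ℝ] Module.End ℝ V)
        (D : Set (TraceK.SymTensor × V × (Fin 4 → V)))
        (Lm : TraceK.SymTensor × V × (Fin 4 → V) → ℝ) (ψ : TraceK.Spacetime → V),
        TraceK.IsRepresentation ρ → IsOpen D → ContDiffOn ℝ ∞ Lm D → TraceK.IsScalarDensity ρ D Lm →
        ContDiff ℝ ∞ ψ → (∀ x, (g x, ψ x, TraceK.grad ψ x) ∈ D) →
        -- on the matter equations of motion, `2 G_0^0` becomes `2 (G_0^0 - 8π T_0^0)`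
        ((∀ x v, TraceK.eulerLagrange (TraceK.totalLagrangian Lm) (fun y => (g y, ψ y)) x
            (0, v) = 0) →
          ∀ x, TraceK.energyDensity (TraceK.totalLagrangian Lm) (fun y => (g y, ψ y)) x =
            2 * (TraceK.einstein g 0 0 x - 8 * Real.pi * TraceK.energyMomentum Lm g ψ 0 0 x)
              + ∑ i : Fin 3, TraceK.pd i.succ (fun y => TraceK.superpotential g i y
                  + TraceK.matterFlux ρ Lm g ψ (Matrix.single 0 0 1) i y) x) ∧
        -- on shell, the total energy is still the ADM energy
        (TraceK.OnShell (TraceK.totalLagrangian Lm) (fun y => (g y, ψ y)) →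
          ((∀ x, TraceK.einstein g 0 0 x = 8 * Real.pi * TraceK.energyMomentum Lm g ψ 0 0 x) ∧
          ((∀ (M : Matrix (Fin 4) (Fin 4) ℝ) (t : ℝ),
            Tendsto (TraceK.sphereFlux fun x i =>
              TraceK.matterFlux ρ Lm g ψ M i (TraceK.event t x)) atTop (𝓝 0)) →
          ∀ t : ℝ,
            Tendsto (fun r : ℝ =>
              (∫ x in Metric.ball (0 : TraceK.Space) r,
                TraceK.energyDensity (TraceK.totalLagrangian Lm) (fun y => (g y, ψ y))
                  (TraceK.event t x)) - TraceK.admFlux g t r) atTop (𝓝 0) ∧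
            (Integrable (fun x : TraceK.Space =>
                TraceK.energyDensity (TraceK.totalLagrangian Lm) (fun y => (g y, ψ y))
                  (TraceK.event t x)) volume →
              Tendsto (fun r : ℝ => TraceK.admFlux g t r) atTop
                (𝓝 (∫ x : TraceK.Space,
                  TraceK.energyDensity (TraceK.totalLagrangian Lm) (fun y => (g y, ψ y))
                    (TraceK.event t x))))))))) := by
  have hr : ∀ x, g x ∈ TraceK.regular := fun x => (hadm x).mem_regular
  refine ⟨TraceK.energyDensity_lagrangianK hg hr, fun hflat =>
    ⟨TraceK.energy_eq_adm hg hr hflat, ?_⟩⟩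
  intro V _ _ _ ρ D Lm ψ _ hD hLm hinv hψ hp
  refine ⟨TraceK.energyDensity_totalLagrangian hg hr hinv hD hLm hψ hp, fun hs =>
    ⟨TraceK.einstein_eq_of_onShell hg hr hD hLm hψ hp hs, fun hb t => ?_⟩⟩
  have h := TraceK.tendsto_energy_sub_admFlux hg hr hflat hinv hD hLm hψ hp hs t (hb _ t)
  refine ⟨h, fun hint => ?_⟩
  simpa using (TraceK.tendsto_integral_ball hint).sub h
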